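/- Let $M$ be a connected $C^\infty$ manifold of dimension $n\ge 2$ and let $F=\alpha+\beta$ be a Randers metric on $M$: $\alpha(y)=\sqrt{a_{ij}(x)y^iy^j}$ for a smooth Riemannian metric $a$, and $\beta(y)=b_i(x)y^i$ for a smooth 1-form $b$ with $|\beta(y)|<\alpha(y)$ for all $y\ne 0$ (i.e. $\|b\|_a<1$ at every point). In local coordinates $(x^i,y^i)$ of $TM_0=TM\setminus\{0\}$ put $g_{ij}=\frac12\frac{\partial^2F^2}{\partial y^i\partial y^j}$, $(g^{ij})=(g_{ij})^{-1}$, $C_{ijk}=\frac14\frac{\partial^3F^2}{\partial y^i\partial y^j\partial y^k}$, $C^i_{jk}=g^{il}C_{ljk}$, $I_i=g^{jk}C_{jki}$, $I^k=g^{ki}I_i$, $\ell_i=\frac{\partial F}{\partial y^i}$, $G^i=\frac14g^{il}\{[F^2]_{x^ky^l}y^k-[F^2]_{x^l}\}$, $N^i_j=\frac{\partial G^i}{\partial y^j}$, $\delta_i=\frac{\partial}{\partial x^i}-N^j_i\frac{\partial}{\partial y^j}$, and let $$R^i{}_k=2\frac{\partial G^i}{\partial x^k}-y^j\frac{\partial^2G^i}{\partial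 x^j\partial y^k}+2G^j\frac{\partial^2G^i}{\partial y^j\partial y^k}-\frac{\partial G^i}{\partial y^j}\frac{\partial G^j}{\partial y^k}$$ be the Riemann curvature. $F$ is of scalar flag curvature $\mathbf K$, for a function $\mathbf K$ on $TM_0$, if for all linearly independent $y,u\in T_xM$ the flag curvature $$\frac{g_y(u,\mathbf R_y(u))}{g_y(y,y)g_y(u,u)-g_y(y,u)^2}$$ equals $\mathbf K(x,y)$. The hh-curvature of the Cartan connection is $$R_h{}^i{}_{jk}=\delta_k\Gamma^i_{hj}-\delta_j\Gamma^i_{hk}+\Gamma^m_{hj}\Gamma^i_{mk}-\Gamma^m_{hk}\Gamma^i_{mj}+C^i_{hm}(\delta_kN^m_j-\delta_jN^m_k),$$ $$\Gamma^i_{jk}=\tfrac12g^{il}(\delta_jg_{lk}+\delta_kg_{jl}-\delta_lg_{jk}).$$ Put $R_{hijk}=g_{im}R_h{}^m{}_{jk}$, $R_{ijk}=y^hR_{hijk}$, $R_{i0k}=R_{ijk}y^j$, $R_{ij}=R_i{}^r{}_{jr}$, $R_{0k}=R_{jk}y^j$, and $$\mathfrak R_{ij}=R_{ij}-\frac1{n+1}\Big(I^kR_{ijk}+I^kR_{kji}+F^{-1}\ell_iI^kR_{k0j}+I_iR_{0j}\Big),\qquad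 \mathfrak R_{i0}=\mathfrak R_{ij}y^j,\quad \mathfrak R_{0i}=\mathfrak R_{ji}y^j .$$ Suppose that $F$ is not Riemannian, i.e. $F$ is not of the form $\sqrt{h(y,y)}$ for any smooth Riemannian metric $h$ on $M$, and that $F$ is of scalar flag curvature $\mathbf K$. Then $\mathbf K=0$ identically on $TM_0$ if and only if $\mathfrak R_{i0}=\mathfrak R_{0i}$ for all $i$ everywhere on $TM_0$ (in every local coordinate system). -/

import Mathlib

open scoped Manifold ContDiff Bundle Topology

noncomputable section

/-!  Finsler geometry in local coordinates.  A local Finsler function is `F x y`, with `x` the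
position and `y` the fibre coordinate; all objects are used at `y ≠ 0` only. -/

namespace Finsler

/-- The coordinate space `ℝⁿ`. -/
abbrev Coord (n : ℕ) : Type := EuclideanSpace ℝ (Fin n)

variable {n : ℕ}

/-- `∂f/∂xⁱ`. -/
def dX (i : Fin n) (f : Coord n → Coord n → ℝ) (x y : Coord n) : ℝ :=
  fderiv ℝ (fun x' => f x' y) x (EuclideanSpace.single i 1)

/-- `∂f/∂yⁱ`. -/
def dY (i : Fin n) (f : Coord n → Coord n → ℝ) (x y : Coord n) : ℝ :=
  fderiv ℝ (fun y' => f x y') y (EuclideanSpace.single i 1)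

variable (F : Coord n → Coord n → ℝ)

/-- `F²`. -/
def sqF (x y : Coord n) : ℝ := F x y ^ 2

/-- The fundamental tensor `g_{ij} = ½ ∂²F²/∂yⁱ∂yʲ`. -/
def g (i j : Fin n) (x y : Coord n) : ℝ := (1 / 2) * dY i (dY j (sqF F)) x y

/-- The inverse matrix `g^{ij}`. -/
def gInv (i j : Fin n) (x y : Coord n) : ℝ :=
  (Matrix.of fun k l : Fin n => g F k l x y)⁻¹ i j

/-- The Cartan tensor `C_{ijk} = ¼ ∂³F²/∂yⁱ∂yʲ∂yᵏ`. -/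
def cartan (i j k : Fin n) (x y : Coord n) : ℝ := (1 / 4) * dY i (dY j (dY k (sqF F))) x y

/-- `Cⁱ_{jk} = g^{il} C_{ljk}`. -/
def cartanUp (i j k : Fin n) (x y : Coord n) : ℝ := ∑ l, gInv F i l x y * cartan F l j k x y

/-- The mean Cartan tensor `I_i = g^{jk} C_{jki}`. -/
def meanCartan (i : Fin n) (x y : Coord n) : ℝ := ∑ j, ∑ k, gInv F j k x y * cartan F j k i x y

/-- `Iᵏ = g^{ki} I_i`. -/
def meanCartanUp (k : Fin n) (x y : Coord n) : ℝ := ∑ i, gInv F k i x y * meanCartan F i x y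

/-- The spray coefficients `Gⁱ = ¼ g^{il} ([F²]_{xᵏyˡ} yᵏ - [F²]_{xˡ})`. -/
def spray (i : Fin n) (x y : Coord n) : ℝ :=
  (1 / 4) * ∑ l, gInv F i l x y * ((∑ k, dX k (dY l (sqF F)) x y * y k) - dX l (sqF F) x y)

/-- The Riemann curvature
`Rⁱ_k = 2 ∂Gⁱ/∂xᵏ - yʲ ∂²Gⁱ/∂xʲ∂yᵏ + 2 Gʲ ∂²Gⁱ/∂yʲ∂yᵏ - (∂Gⁱ/∂yʲ)(∂Gʲ/∂yᵏ)`. -/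
def riemann (i k : Fin n) (x y : Coord n) : ℝ :=
  2 * dX k (spray F i) x y - (∑ j, y j * dX j (dY k (spray F i)) x y)
    + 2 * (∑ j, spray F j x y * dY j (dY k (spray F i)) x y)
    - ∑ j, dY j (spray F i) x y * dY k (spray F j) x y

/-- The inner product `g_y(u, v)`. -/
def gForm (x y u v : Coord n) : ℝ := ∑ i, ∑ j, g F i j x y * u i * v j

/-- The linear map `R_y` applied to `u`. -/
def riemannApply (x y u : Coord n) : Coord n :=
  WithLp.toLp 2 fun i => ∑ k, riemann F i k x y * u k

/-- The flag curvature of the flag `span {y, u}` with flagpole `y`. -/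
def flagCurvature (x y u : Coord n) : ℝ :=
  gForm F x y u (riemannApply F x y u) /
    (gForm F x y y y * gForm F x y u u - gForm F x y y u ^ 2)

/-- The nonlinear connection `Nⁱ_j = ∂Gⁱ/∂yʲ`. -/
def nonlin (i j : Fin n) (x y : Coord n) : ℝ := dY j (spray F i) x y

/-- The horizontal derivative `δf/δxⁱ = ∂f/∂xⁱ - Nʲ_i ∂f/∂yʲ`. -/
def dH (i : Fin n) (f : Coord n → Coord n → ℝ) (x y : Coord n) : ℝ :=
  dX i f x y - ∑ j, nonlin F j i x y * dY j f x y

/-- The horizontal coefficients of the Cartan connection,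
`Γⁱ_{jk} = ½ g^{il} (δg_{lk}/δxʲ + δg_{jl}/δxᵏ - δg_{jk}/δxˡ)`.
The connection forms are `Γⁱ_{jk} dxᵏ + Cⁱ_{jk} δyᵏ`. -/
def gammaH (i j k : Fin n) (x y : Coord n) : ℝ :=
  (1 / 2) * ∑ l, gInv F i l x y *
    (dH F j (g F l k) x y + dH F k (g F j l) x y - dH F l (g F j k) x y)

/-- The curvature of the nonlinear connection, `δNⁱ_j/δxᵏ - δNⁱ_k/δxʲ`. -/
def nonlinCurv (i j k : Fin n) (x y : Coord n) : ℝ :=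
  dH F k (nonlin F i j) x y - dH F j (nonlin F i k) x y

/-- The hh-curvature `R_h{}^i{}_{jk}` of the Cartan connection, with arguments in the order
`h i j k`; the sign is the one for which `yʰ yʲ R_h{}^i{}_{jk} = Rⁱ_k`. -/
def hhCurv (h i j k : Fin n) (x y : Coord n) : ℝ :=
  dH F k (gammaH F i h j) x y - dH F j (gammaH F i h k) x y
    + (∑ m, gammaH F m h j x y * gammaH F i m k x y)
    - (∑ m, gammaH F m h k x y * gammaH F i m j x y)
    + ∑ m, cartanUp F i h m x y * nonlinCurv F m j k x y

/-- `R_{hijk} = g_{im} R_h{}^m{}_{jk}`. -/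
def hhCurvLow (h i j k : Fin n) (x y : Coord n) : ℝ := ∑ m, g F i m x y * hhCurv F h m j k x y

/-- `R_{ijk} = R_{0ijk} = yʰ R_{hijk}`. -/
def curv3 (i j k : Fin n) (x y : Coord n) : ℝ := ∑ h, y h * hhCurvLow F h i j k x y

/-- `R_{i0k} = R_{ijk} yʲ`. -/
def curv2 (i k : Fin n) (x y : Coord n) : ℝ := ∑ j, curv3 F i j k x y * y j

/-- The Ricci tensor `R_{ij} = R_i{}^r{}_{jr}`, with `R_i{}^r{}_{jr} = g^{rm} R_{imjr}`. -/
def ricci (i j : Fin n) (x y : Coord n) : ℝ :=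
  ∑ r, ∑ m, gInv F r m x y * hhCurvLow F i m j r x y

/-- `R_{0k} = R_{jk} yʲ`. -/
def ricciZero (k : Fin n) (x y : Coord n) : ℝ := ∑ j, ricci F j k x y * y j

/-- The tensor `ℜ_{ij} = R_{ij} - (1/(n+1)) (Iᵏ R_{ijk} + Iᵏ R_{kji} + F⁻¹ ℓ_i Iᵏ R_{k0j}
+ I_i R_{0j})`, where `ℓ_i = ∂F/∂yⁱ`. -/
def frakR (i j : Fin n) (x y : Coord n) : ℝ :=
  ricci F i j x y - (1 / ((n : ℝ) + 1)) *
    ((∑ k, meanCartanUp F k x y * curv3 F i j k x y)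
      + (∑ k, meanCartanUp F k x y * curv3 F k j i x y)
      + (F x y)⁻¹ * dY i F x y * (∑ k, meanCartanUp F k x y * curv2 F k j x y)
      + meanCartan F i x y * ricciZero F j x y)

/-- `ℜ_{i0} = ℜ_{ij} yʲ`. -/
def frakRRightZero (i : Fin n) (x y : Coord n) : ℝ := ∑ j, frakR F i j x y * y j

/-- `ℜ_{0i} = ℜ_{ji} yʲ`. -/
def frakRLeftZero (i : Fin n) (x y : Coord n) : ℝ := ∑ j, frakR F j i x y * y j

end Finsler

/-! ## Finsler functions and Randers metrics on a manifold -/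

namespace Finsler

variable {n : ℕ} {M : Type*} [TopologicalSpace M] [ChartedSpace (Coord n) M]
  [IsManifold (𝓡 n) ∞ M]

/-- The tangent vector `yⁱ ∂/∂xⁱ` at the point of `M` with coordinates `x` in the chart `φ`. -/
def tangentOfCoord (φ : OpenPartialHomeomorph M (Coord n)) (x y : Coord n) :
    TangentBundle (𝓡 n) M :=
  ⟨φ.symm x, mfderiv 𝓘(ℝ, Coord n) (𝓡 n) φ.symm x y⟩

/-- The coordinate expression in the chart `φ` of a function on the tangent bundle. -/
def localRep (F : TangentBundle (𝓡 n) M → ℝ) (φ : OpenPartialHomeomorph M (Coord n))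
    (x y : Coord n) : ℝ :=
  F (tangentOfCoord φ x y)

/-- `F` is of scalar flag curvature `K`: the flag curvature of every flag with flagpole `y`
is `K(y)`. -/
def IsOfScalarFlagCurvature (F K : TangentBundle (𝓡 n) M → ℝ) : Prop :=
  ∀ φ ∈ IsManifold.maximalAtlas (𝓡 n) ∞ M, ∀ x ∈ φ.target, ∀ y u : Coord n,
    LinearIndependent ℝ ![y, u] →
      flagCurvature (localRep F φ) x y u = K (tangentOfCoord φ x y)

/-- `ℜ_{i0} = ℜ_{0i}` on the slit tangent bundle, in all local coordinate systems. -/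
def FrakRZeroSymmetric (F : TangentBundle (𝓡 n) M → ℝ) : Prop :=
  ∀ φ ∈ IsManifold.maximalAtlas (𝓡 n) ∞ M, ∀ x ∈ φ.target, ∀ y : Coord n, y ≠ 0 →
    ∀ i : Fin n, frakRRightZero (localRep F φ) i x y = frakRLeftZero (localRep F φ) i x y

/-- `F` is Riemannian: it is the norm of a smooth Riemannian metric. -/
def IsRiemannian (F : TangentBundle (𝓡 n) M → ℝ) : Prop :=
  ∃ h : Bundle.ContMDiffRiemannianMetric (𝓡 n) ∞ (Coord n) (TangentSpace (𝓡 n) : M → Type _),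
    ∀ (p : M) (v : TangentSpace (𝓡 n) p), F ⟨p, v⟩ = Real.sqrt (h.inner p v v)

variable (n M) in
/-- The data of a Randers metric: a smooth Riemannian metric `a` and a smooth 1-form `b` of
pointwise norm less than one with respect to `a`. -/
structure RandersMetric where
  /-- The Riemannian metric. -/
  a : Bundle.ContMDiffRiemannianMetric (𝓡 n) ∞ (Coord n) (TangentSpace (𝓡 n) : M → Type _)
  /-- The 1-form. -/
  b : ∀ p : M, TangentSpace (𝓡 n) p →L[ℝ] ℝ
  contMDiff_b : ContMDiff (𝓡 n) ((𝓡 n).prod 𝓘(ℝ, Coord n →L[ℝ] ℝ)) ∞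
    (fun p => Bundle.TotalSpace.mk' (Coord n →L[ℝ] ℝ)
      (E := fun p : M => TangentSpace (𝓡 n) p →L[ℝ] ℝ) p (b p))
  norm_b_lt_one : ∀ (p : M) (v : TangentSpace (𝓡 n) p), v ≠ 0 →
    |b p v| < Real.sqrt (a.inner p v v)

/-- The Finsler function `F = α + β`, with `α(v) = √a(v, v)` and `β(v) = b(v)`. -/
def RandersMetric.finsler (R : RandersMetric n M) (v : TangentBundle (𝓡 n) M) : ℝ :=
  Real.sqrt (R.a.inner v.proj v.snd v.snd) + R.b v.proj v.snd

end Finsler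

end

/-! ### Abstract Finsler calculus: homogeneity, spray and Cartan connection. -/

noncomputable section

namespace Finsler

open Finset

/-! The heart of the matter is the identity `ℜ_{i0} - ℜ_{0i} = -K F² I_i`, valid for every Finsler
metric of scalar flag curvature. It comes from tracing the first Bianchi identity of the Cartan
connection after one contraction with `y` (`ricci_mul_y_sub`). The four correction terms in `ℜ` then
contribute `2 I_m R^m_i + I_i R^m_m` (`FinslerCalculus.frakR_sub`). For `R^i_k = K(F² δ^i_k - y^i
y_k)` everything collapses to a multiple of `K F² I_i`, and the factor `1/(n+1)` normalises it. So
`K = 0` gives the symmetry at once, and the symmetry is equivalent to `K I = 0`.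

It remains to deduce `K = 0` from `K I = 0` when `F` is not Riemannian. For a Randers metric `I_k`
is a nonzero multiple of `α² b_k - β a_{kj} y^j` (`toFinsler_meanCartan`, `meanCartan_eq`). Where `b
≠ 0` it therefore vanishes only for `y` in a line at most, a proper subspace since `n ≥ 2`. Hence `R
= 0` on a dense set of directions over the support of `b`, and by continuity over its closure
(`riemann_eq_zero`).

The remaining danger is a nonempty open set on which `b = 0`: there `F` is Riemannian and `K I = 0`
says nothing. Let `V` be the interior of the zero set of `b`; it is shown to be closed. Along a
geodesic `I` obeys a second order linear equation whose inhomogeneous part consists of fibre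
derivatives of `R` (`three_mul_flow_flow_meanCartan`). This part vanishes over the closure of the
support. A geodesic that starts over `V` thus carries the zero Cauchy data of `I` out of `V`
(`meanCartan_eq_zero_of_geodesic`). At a boundary point of `V` touched by a ball inside `V`,
geodesics from `V` reach an open set of tangent vectors, some of them over the support and off the
exceptional line, where `I ≠ 0` (`closure_zeroInterior`). Since `M` is connected, the clopen set `V`
is empty or all of `M`; the latter makes `F = α` Riemannian. So the support of `b` is dense, `R = 0`
everywhere, and `K = 0`.

The tensor identities are proved in a commutative ring with commuting derivations, so that
smoothness never has to be checked during an index computation. -/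

/-- A commutative algebra with commuting derivations `∂/∂xⁱ`, `∂/∂yⁱ` and fibre coordinates `yⁱ`. -/
structure SlitCalculus (n : ℕ) (A : Type*) [CommRing A] [Algebra ℝ A] where
  /-- `∂/∂xⁱ` -/
  dx : Fin n → Derivation ℝ A A
  /-- `∂/∂yⁱ` -/
  dy : Fin n → Derivation ℝ A A
  /-- The fibre coordinates. -/
  y : Fin n → A
  dx_dx : ∀ i j f, dx i (dx j f) = dx j (dx i f)
  dy_dy : ∀ i j f, dy i (dy j f) = dy j (dy i f)
  dy_dx : ∀ i j f, dy i (dx j f) = dx j (dy i f)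
  dx_y : ∀ i j, dx i (y j) = 0
  dy_y : ∀ i j, dy i (y j) = if i = j then 1 else 0

/-- The constant `1/2` of a real algebra. -/
def half (A : Type*) [CommRing A] [Algebra ℝ A] : A := algebraMap ℝ A (1 / 2)

section Half

variable {A : Type*} [CommRing A] [Algebra ℝ A]

theorem two_mul_half : 2 * half A = 1 := by
  rw [half, show (2 : A) = algebraMap ℝ A 2 from (map_ofNat (algebraMap ℝ A) 2).symm, ← map_mul]
  norm_num

@[simp] theorem derivation_half_mul (D : Derivation ℝ A A) (f : A) :
    D (half A * f) = half A * D f := by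
  rw [half, ← Algebra.smul_def, ← Algebra.smul_def, Derivation.map_smul]

theorem derivation_two (D : Derivation ℝ A A) : D 2 = 0 := by
  simpa using D.map_natCast 2

theorem derivation_sum_apply {ι : Type*} (s : Finset ι) (D : ι → Derivation ℝ A A) (f : A) :
    (∑ i ∈ s, D i) f = ∑ i ∈ s, D i f := by
  classical
  induction s using Finset.induction_on with
  | empty => simp
  | insert a s ha ih => simp [Finset.sum_insert ha, ih]

/-- The ring of smooth functions has zero divisors, so cancellation goes through the explicit
inverse `half A`. -/
theorem two_cancel {a b : A} (h : 2 * a = 2 * b) : a = b := by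
  linear_combination half A * h + (b - a) * two_mul_half (A := A)

end Half

/-- A `SlitCalculus` with a function `energy`, playing the role of `F²`, which is homogeneous of
degree two and has nondegenerate Hessian. -/
structure FinslerCalculus (n : ℕ) (A : Type*) [CommRing A] [Algebra ℝ A] extends
    SlitCalculus n A where
  /-- `F²` -/
  energy : A
  /-- `g^{ij}` -/
  gInv : Fin n → Fin n → A
  euler : ∑ k, y k * dy k energy = 2 * energy
  gInv_mul : ∀ i j, ∑ k, gInv i k * (half A * dy k (dy j energy)) = if i = j then 1 else 0

namespace FinslerCalculus

variable {n : ℕ} {A : Type*} [CommRing A] [Algebra ℝ A] (S : FinslerCalculus n A)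

/-- The fundamental tensor. -/
def g (i j : Fin n) : A := half A * S.dy i (S.dy j S.energy)

/-- `y_i = g_{ij} yʲ = ½ ∂F²/∂yⁱ`. -/
def yLow (i : Fin n) : A := half A * S.dy i S.energy

/-- The Cartan tensor. -/
def cartan (i j k : Fin n) : A := half A * (half A * S.dy i (S.dy j (S.dy k S.energy)))

/-- The Cartan tensor with its first index raised. -/
def cartanUp (i j k : Fin n) : A := ∑ l, S.gInv i l * S.cartan l j k

/-- The mean Cartan tensor. -/
def meanCartan (i : Fin n) : A := ∑ j, ∑ k, S.gInv j k * S.cartan j k i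

/-- The mean Cartan tensor with its index raised. -/
def meanCartanUp (k : Fin n) : A := ∑ i, S.gInv k i * S.meanCartan i

/-- The spray coefficients. -/
def spray (i : Fin n) : A :=
  half A * (half A * ∑ l, S.gInv i l *
    ((∑ k, S.dx k (S.dy l S.energy) * S.y k) - S.dx l S.energy))

/-- The Riemann curvature. -/
def riemann (i k : Fin n) : A :=
  2 * S.dx k (S.spray i) - (∑ j, S.y j * S.dx j (S.dy k (S.spray i)))
    + 2 * (∑ j, S.spray j * S.dy j (S.dy k (S.spray i)))
    - ∑ j, S.dy j (S.spray i) * S.dy k (S.spray j)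

/-- The nonlinear connection. -/
def nonlin (i j : Fin n) : A := S.dy j (S.spray i)

/-- The horizontal derivation `δ/δxⁱ`. -/
def dH (i : Fin n) : Derivation ℝ A A := S.dx i - ∑ j, S.nonlin j i • S.dy j

/-- The horizontal coefficients of the Cartan connection. -/
def gammaH (i j k : Fin n) : A :=
  half A * ∑ l, S.gInv i l * (S.dH j (S.g l k) + S.dH k (S.g j l) - S.dH l (S.g j k))

/-- The curvature of the nonlinear connection. -/
def nonlinCurv (i j k : Fin n) : A := S.dH k (S.nonlin i j) - S.dH j (S.nonlin i k)

/-- The hh-curvature of the Cartan connection. -/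
def hhCurv (h i j k : Fin n) : A :=
  S.dH k (S.gammaH i h j) - S.dH j (S.gammaH i h k)
    + (∑ m, S.gammaH m h j * S.gammaH i m k)
    - (∑ m, S.gammaH m h k * S.gammaH i m j)
    + ∑ m, S.cartanUp i h m * S.nonlinCurv m j k

/-- The hh-curvature with all indices lowered. -/
def hhCurvLow (h i j k : Fin n) : A := ∑ m, S.g i m * S.hhCurv h m j k

/-- `R_{ijk} = yʰ R_{hijk}`. -/
def curv3 (i j k : Fin n) : A := ∑ h, S.y h * S.hhCurvLow h i j k

/-- `R_{i0k} = R_{ijk} yʲ`. -/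
def curv2 (i k : Fin n) : A := ∑ j, S.curv3 i j k * S.y j

/-- The Ricci tensor of the Cartan connection. -/
def ricci (i j : Fin n) : A := ∑ r, ∑ m, S.gInv r m * S.hhCurvLow i m j r

/-- `R_{0k} = R_{jk} yʲ`. -/
def ricciZero (k : Fin n) : A := ∑ j, S.ricci j k * S.y j

/-- The spray as a derivation. -/
def flow : Derivation ℝ A A := (∑ k, S.y k • S.dx k) - ∑ k, (2 * S.spray k) • S.dy k

/-- The Euler derivation. -/
def eulerField : Derivation ℝ A A := ∑ k, S.y k • S.dy k

theorem flow_apply (f : A) :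
    S.flow f = ∑ k, S.y k * S.dx k f - ∑ k, 2 * S.spray k * S.dy k f := by
  simp [flow, derivation_sum_apply]

theorem eulerField_apply (f : A) : S.eulerField f = ∑ k, S.y k * S.dy k f := by
  simp [eulerField, derivation_sum_apply]

theorem dH_apply (i : Fin n) (f : A) :
    S.dH i f = S.dx i f - ∑ j, S.nonlin j i * S.dy j f := by
  simp [dH, derivation_sum_apply]

theorem dH_y (i j : Fin n) : S.dH i (S.y j) = - S.nonlin j i := by
  simp [dH_apply, S.dx_y, S.dy_y]

theorem eulerField_y (j : Fin n) : S.eulerField (S.y j) = S.y j := by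
  simp [eulerField_apply, S.dy_y]

theorem g_symm (i j : Fin n) : S.g i j = S.g j i := by
  rw [g, g, S.dy_dy]

theorem cartan_swap (i j k : Fin n) : S.cartan i j k = S.cartan j i k := by
  rw [cartan, cartan, S.dy_dy]

theorem cartan_swap' (i j k : Fin n) : S.cartan i j k = S.cartan i k j := by
  rw [cartan, cartan, S.dy_dy j k]

theorem cartan_eq (i j k : Fin n) : 2 * S.cartan i j k = S.dy i (S.g j k) := by
  rw [cartan, g, derivation_half_mul]
  linear_combination half A * S.dy i (S.dy j (S.dy k S.energy)) * two_mul_half (A := A)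

theorem gInv_g (i j : Fin n) : ∑ k, S.gInv i k * S.g k j = if i = j then 1 else 0 :=
  S.gInv_mul i j

theorem gInv_contract (u : Fin n → A) (i : Fin n) :
    ∑ l, S.gInv i l * ∑ k, S.g l k * u k = u i := by
  simp_rw [mul_sum, ← mul_assoc]
  rw [sum_comm]
  simp_rw [← sum_mul, S.gInv_g]
  simp

theorem g_gInv (i j : Fin n) : ∑ k, S.g i k * S.gInv k j = if i = j then 1 else 0 := by
  have h : (Matrix.of S.gInv) * (Matrix.of S.g) = 1 := by
    ext i j
    simp [Matrix.mul_apply, S.gInv_g, Matrix.one_apply]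
  have h' := congrArg (fun B : Matrix (Fin n) (Fin n) A => B i j) (mul_eq_one_comm.mp h)
  simpa [Matrix.mul_apply, Matrix.one_apply] using h'

theorem g_contract (u : Fin n → A) (i : Fin n) :
    ∑ l, S.g i l * ∑ k, S.gInv l k * u k = u i := by
  simp_rw [mul_sum, ← mul_assoc]
  rw [sum_comm]
  simp_rw [← sum_mul, S.g_gInv]
  simp

theorem gInv_symm (i j : Fin n) : S.gInv i j = S.gInv j i := by
  have h := S.gInv_contract (fun k => S.gInv j k) i
  rw [← h]
  have : ∀ l, ∑ k, S.g l k * S.gInv j k = if j = l then 1 else 0 := fun l => by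
    rw [← S.gInv_g j l]
    exact sum_congr rfl fun k _ => by rw [S.g_symm l k, mul_comm]
  simp [this]

theorem eq_of_g_contract {u v : Fin n → A}
    (h : ∀ l, ∑ k, S.g l k * u k = ∑ k, S.g l k * v k) (i : Fin n) : u i = v i := by
  rw [← S.gInv_contract u i, ← S.gInv_contract v i]
  simp_rw [h]

/-! ### Homogeneity -/

theorem eulerField_dy (i : Fin n) (f : A) :
    S.eulerField (S.dy i f) = S.dy i (S.eulerField f) - S.dy i f := by
  simp only [eulerField_apply, map_sum, Derivation.leibniz, smul_eq_mul, sum_add_distrib, S.dy_y,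
    S.dy_dy i]
  simp

theorem eulerField_dx (i : Fin n) (f : A) :
    S.eulerField (S.dx i f) = S.dx i (S.eulerField f) := by
  simp only [eulerField_apply, map_sum, Derivation.leibniz, smul_eq_mul, S.dx_y,
    S.dy_dx]
  simp

theorem eulerField_energy : S.eulerField S.energy = 2 * S.energy := by
  rw [eulerField_apply, S.euler]

theorem derivation_two_mul (D : Derivation ℝ A A) (f : A) : D (2 * f) = 2 * D f := by
  rw [two_mul, map_add, two_mul]

theorem eulerField_dy_energy (i : Fin n) :
    S.eulerField (S.dy i S.energy) = S.dy i S.energy := by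
  rw [eulerField_dy, eulerField_energy, derivation_two_mul]; ring

theorem sum_y_mul_yLow : ∑ i, S.y i * S.yLow i = S.energy := by
  have := S.euler
  simp only [yLow]
  simp_rw [mul_left_comm, ← mul_sum, this]
  linear_combination S.energy * two_mul_half (A := A)

theorem sum_g_mul_y (i : Fin n) : ∑ j, S.g i j * S.y j = S.yLow i := by
  have := S.eulerField_dy_energy i
  rw [eulerField_apply] at this
  rw [yLow, ← this, mul_sum]
  refine sum_congr rfl fun j _ => ?_
  rw [g, S.dy_dy]; ring

theorem eulerField_g (i j : Fin n) : S.eulerField (S.g i j) = 0 := by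
  rw [g, derivation_half_mul, eulerField_dy, eulerField_dy_energy]; ring

theorem sum_y_mul_cartan (i j : Fin n) : ∑ k, S.y k * S.cartan k i j = 0 := by
  apply two_cancel
  rw [mul_sum, mul_zero, ← S.eulerField_g i j, eulerField_apply]
  refine sum_congr rfl fun j _ => ?_
  rw [← cartan_eq]; ring

theorem dy_yLow (i j : Fin n) : S.dy i (S.yLow j) = S.g i j := by
  rw [yLow, derivation_half_mul, g]

theorem sum_y_mul_cartanUp (i j : Fin n) : ∑ k, S.y k * S.cartanUp i k j = 0 := by
  simp only [cartanUp, mul_sum]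
  rw [sum_comm]
  refine sum_eq_zero fun l _ => ?_
  simp_rw [mul_left_comm, ← mul_sum, S.cartan_swap l, S.sum_y_mul_cartan, mul_zero]

theorem sum_y_mul_meanCartan : ∑ k, S.y k * S.meanCartan k = 0 := by
  simp only [meanCartan, mul_sum]
  rw [sum_comm]
  refine sum_eq_zero fun l _ => ?_
  rw [sum_comm]
  refine sum_eq_zero fun m _ => ?_
  simp_rw [mul_left_comm, ← mul_sum, S.cartan_swap' l m, S.cartan_swap l _ m,
    S.sum_y_mul_cartan, mul_zero]

theorem cartanUp_symm (i j k : Fin n) : S.cartanUp i j k = S.cartanUp i k j := by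
  simp only [cartanUp, S.cartan_swap' _ j k]

theorem sum_g_mul_cartanUp (i j k : Fin n) : ∑ l, S.g i l * S.cartanUp l j k = S.cartan i j k :=
  S.g_contract (fun l => S.cartan l j k) i

/-- The spray with its index lowered: in this form it can be differentiated without differentiating
`g^{ij}`. -/
theorem spray_eq (l : Fin n) : 2 * (2 * ∑ k, S.g l k * S.spray k) =
    (∑ k, S.dx k (S.dy l S.energy) * S.y k) - S.dx l S.energy := by
  rw [← S.g_contract (fun l => (∑ k, S.dx k (S.dy l S.energy) * S.y k) - S.dx l S.energy) l]
  simp only [mul_sum (s := univ) (a := (2 : A))]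
  refine sum_congr rfl fun k _ => ?_
  rw [spray]
  linear_combination (S.g l k * ∑ i, S.gInv k i *
      ((∑ k, S.dx k (S.dy i S.energy) * S.y k) - S.dx i S.energy)) * (2 * half A + 1) *
      two_mul_half (A := A)

/-- Euler's identity for the spray, which is homogeneous of degree two. The Euler field is applied
to `spray_eq`, where `g` has degree zero and the right side degree two, and `g` is cancelled. -/
theorem sum_nonlin_mul_y (i : Fin n) : ∑ j, S.nonlin i j * S.y j = 2 * S.spray i := by
  refine S.eq_of_g_contract (u := fun i => ∑ j, S.nonlin i j * S.y j)
    (v := fun i => 2 * S.spray i) (fun l => ?_) i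
  have h := congrArg S.eulerField (S.spray_eq l)
  simp only [derivation_two, map_sum, map_sub, Derivation.leibniz, smul_eq_mul, eulerField_g,
    eulerField_dx, eulerField_dy_energy, eulerField_energy, eulerField_y] at h
  have e : ∀ k, S.eulerField (S.spray k) = ∑ j, S.nonlin k j * S.y j := fun k => by
    rw [eulerField_apply]
    exact sum_congr rfl fun j _ => by rw [nonlin]; ring
  have h2 := S.spray_eq l
  simp only [e, mul_zero, add_zero, sum_add_distrib] at h
  have h3 : ∑ k, S.y k * S.dx k (S.dy l S.energy) = ∑ k, S.dx k (S.dy l S.energy) * S.y k :=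
    sum_congr rfl fun _ _ => mul_comm _ _
  rw [h3] at h
  simp_rw [mul_left_comm _ (2 : A), ← mul_sum]
  apply two_cancel
  apply two_cancel
  linear_combination h - 2 * h2

/-! ### The spray and the nonlinear connection -/

theorem sum_y_mul_dH (f : A) : ∑ k, S.y k * S.dH k f = S.flow f := by
  simp only [dH_apply, flow_apply, mul_sub, sum_sub_distrib, ← S.sum_nonlin_mul_y, mul_sum, sum_mul]
  congr 1
  rw [sum_comm]
  exact sum_congr rfl fun _ _ => sum_congr rfl fun _ _ => by ring

theorem dy_flow (i : Fin n) (f : A) :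
    S.dy i (S.flow f) = S.flow (S.dy i f) + S.dx i f - 2 * ∑ m, S.nonlin m i * S.dy m f := by
  simp only [flow_apply, map_sub, map_sum, Derivation.leibniz, smul_eq_mul, S.dy_y, S.dy_dx,
    sum_add_distrib, derivation_two, S.dy_dy i, mul_sum, nonlin]
  simp only [mul_ite, mul_one, mul_zero, add_zero, sum_ite_eq, mem_univ, if_true]
  have : ∑ x, S.dy x f * (2 * S.dy i (S.spray x)) =
      ∑ x, 2 * (S.dy i (S.spray x) * S.dy x f) :=
    sum_congr rfl fun _ _ => by ring
  linear_combination -this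

theorem dx_flow (i : Fin n) (f : A) :
    S.dx i (S.flow f) = S.flow (S.dx i f) - 2 * ∑ m, S.dx i (S.spray m) * S.dy m f := by
  simp only [flow_apply, map_sub, map_sum, Derivation.leibniz, smul_eq_mul, S.dx_y, S.dy_dx,
    sum_add_distrib, derivation_two, S.dx_dx i, mul_sum]
  simp only [mul_zero, sum_const_zero, add_zero]
  have : ∑ x, S.dy x f * (2 * S.dx i (S.spray x)) = ∑ x, 2 * (S.dx i (S.spray x) * S.dy x f) :=
    sum_congr rfl fun _ _ => by ring
  linear_combination -this

/-- The Euler–Lagrange equation of `F²`, equivalent to the definition of the spray. -/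
theorem flow_dy_energy (l : Fin n) : S.flow (S.dy l S.energy) = S.dx l S.energy := by
  have h := S.spray_eq l
  rw [flow_apply]
  have h1 : ∑ k, 2 * S.spray k * S.dy k (S.dy l S.energy) = 2 * (2 * ∑ k, S.g l k * S.spray k) := by
    simp only [mul_sum]
    refine sum_congr rfl fun k _ => ?_
    rw [g, S.dy_dy]
    linear_combination - 2 * S.spray k * S.dy l (S.dy k S.energy) * two_mul_half (A := A)
  have h3 : ∑ k, S.y k * S.dx k (S.dy l S.energy) = ∑ k, S.dx k (S.dy l S.energy) * S.y k :=
    sum_congr rfl fun _ _ => mul_comm _ _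
  rw [h1, h3]
  linear_combination -h

/-- `N_{ij} = g_{im} Nᵐ_j`. -/
def nonlinLow (i j : Fin n) : A := ∑ m, S.g i m * S.nonlin m j

/-- The fibre derivative of the Euler–Lagrange equation, with the commutator of the flow and `∂/∂yⁱ`
moved to the right. -/
theorem flow_g_aux (i l : Fin n) : S.flow (S.g i l) =
    S.dx l (S.yLow i) - S.dx i (S.yLow l) + 2 * S.nonlinLow l i := by
  have h := S.dy_flow i (S.dy l S.energy)
  rw [flow_dy_energy, S.dy_dx] at h
  have h1 : ∑ m, S.nonlin m i * S.dy m (S.dy l S.energy) = 2 * S.nonlinLow l i := by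
    simp only [nonlinLow, mul_sum]
    refine sum_congr rfl fun k _ => ?_
    rw [g, S.dy_dy]
    linear_combination - S.nonlin k i * S.dy l (S.dy k S.energy) * two_mul_half (A := A)
  rw [h1] at h
  rw [g, yLow, yLow]
  simp only [derivation_half_mul]
  linear_combination - half A * h + 2 * S.nonlinLow l i * two_mul_half (A := A)

/-- The left side of `flow_g_aux` is symmetric in its indices, so the skew part of its right side
vanishes. -/
theorem dx_yLow_sub (i l : Fin n) :
    S.dx l (S.yLow i) - S.dx i (S.yLow l) = S.nonlinLow i l - S.nonlinLow l i := by
  have h1 := S.flow_g_aux i l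
  have h2 := S.flow_g_aux l i
  rw [S.g_symm l i] at h2
  apply two_cancel
  linear_combination h2 - h1

/-- Metric compatibility along the spray: the covariant derivative of `g` in the direction `y` is
zero. -/
theorem flow_g (i l : Fin n) : S.flow (S.g i l) = S.nonlinLow i l + S.nonlinLow l i := by
  linear_combination S.flow_g_aux i l + S.dx_yLow_sub i l

theorem dH_yLow (i l : Fin n) : S.dH i (S.yLow l) = S.dH l (S.yLow i) := by
  simp only [dH_apply, dy_yLow]
  have e : ∀ i l, ∑ j, S.nonlin j i * S.g j l = S.nonlinLow l i := fun i l =>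
    sum_congr rfl fun j _ => by rw [S.g_symm]; ring
  rw [e, e]
  linear_combination - S.dx_yLow_sub i l

/-- `Γ_{ijk} = g_{im} Γᵐ_{jk}`. -/
def gammaLow (i j k : Fin n) : A := ∑ m, S.g i m * S.gammaH m j k

theorem two_mul_gammaLow (i j k : Fin n) :
    2 * S.gammaLow i j k = S.dH j (S.g i k) + S.dH k (S.g j i) - S.dH i (S.g j k) := by
  rw [← S.g_contract (fun l => S.dH j (S.g l k) + S.dH k (S.g j l) - S.dH l (S.g j k)) i,
    gammaLow, mul_sum]
  refine sum_congr rfl fun m _ => ?_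
  rw [gammaH]
  linear_combination (S.g i m * ∑ l, S.gInv m l *
    (S.dH j (S.g l k) + S.dH k (S.g j l) - S.dH l (S.g j k))) * two_mul_half (A := A)

theorem gammaLow_symm (i j k : Fin n) : S.gammaLow i j k = S.gammaLow i k j := by
  apply two_cancel
  rw [two_mul_gammaLow, two_mul_gammaLow, S.g_symm i k, S.g_symm j i, S.g_symm j k]
  ring

theorem gammaH_symm (i j k : Fin n) : S.gammaH i j k = S.gammaH i k j :=
  S.eq_of_g_contract (u := fun i => S.gammaH i j k) (v := fun i => S.gammaH i k j)
    (fun l => S.gammaLow_symm l j k) i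

theorem dH_g (i j k : Fin n) : S.dH k (S.g i j) = S.gammaLow i j k + S.gammaLow j i k := by
  apply two_cancel
  rw [mul_add, two_mul_gammaLow, two_mul_gammaLow, S.g_symm j i]
  ring

/-- In the Christoffel formula the term `y^j δ_j g` is a derivative along the spray. The other two
terms come from differentiating `y_i = g_{ij} y^j`, and the derivatives of `y_i` cancel by the
symmetry `dH_yLow`. -/
theorem sum_y_mul_gammaLow (i k : Fin n) : ∑ j, S.y j * S.gammaLow i j k = S.nonlinLow i k := by
  have e : ∀ i k, ∑ j, S.y j * S.dH k (S.g j i) = S.dH k (S.yLow i) + S.nonlinLow i k := by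
    intro i k
    have h := congrArg (S.dH k) (S.sum_g_mul_y i)
    simp only [map_sum, Derivation.leibniz, smul_eq_mul, sum_add_distrib, dH_y, mul_neg,
      sum_neg_distrib] at h
    rw [← h, nonlinLow]
    simp only [S.g_symm _ i]
    ring
  apply two_cancel
  have h0 : ∀ j, 2 * (S.y j * S.gammaLow i j k) = S.y j * S.dH j (S.g i k) +
      S.y j * S.dH k (S.g j i) - S.y j * S.dH i (S.g j k) := fun j => by
    rw [mul_left_comm, two_mul_gammaLow]; ring
  rw [mul_sum, sum_congr rfl fun j _ => h0 j, sum_sub_distrib, sum_add_distrib, e, e,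
    sum_y_mul_dH, flow_g, S.dH_yLow i k]
  ring

theorem sum_y_mul_gammaH (i k : Fin n) : ∑ j, S.y j * S.gammaH i j k = S.nonlin i k := by
  refine S.eq_of_g_contract (u := fun i => ∑ j, S.y j * S.gammaH i j k)
    (v := fun i => S.nonlin i k) (fun l => ?_) i
  change _ = S.nonlinLow l k
  rw [← sum_y_mul_gammaLow]
  simp only [mul_sum, gammaLow]
  rw [sum_comm]
  exact sum_congr rfl fun _ _ => sum_congr rfl fun _ _ => by ring

end FinslerCalculus

end Finsler

end

/-! ### Bianchi identities, the skew contraction of `ℜ`, and the equation for the mean Cartan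
tensor. -/

noncomputable section

namespace Finsler

open Finset

namespace FinslerCalculus

variable {n : ℕ} {A : Type*} [CommRing A] [Algebra ℝ A] (S : FinslerCalculus n A)

/-! ### Curvature identities of the Cartan connection -/

theorem nonlinCurv_antisymm (i j k : Fin n) : S.nonlinCurv i j k = - S.nonlinCurv i k j := by
  rw [nonlinCurv, nonlinCurv]; ring

theorem hhCurv_antisymm (h i j k : Fin n) : S.hhCurv h i j k = - S.hhCurv h i k j := by
  have : ∑ m, S.cartanUp i h m * S.nonlinCurv m j k = - ∑ m, S.cartanUp i h m * S.nonlinCurv m k j := by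
    rw [← sum_neg_distrib]
    exact sum_congr rfl fun m _ => by rw [S.nonlinCurv_antisymm m j k]; ring
  rw [hhCurv, hhCurv, this]; ring

theorem hhCurvLow_antisymm (h i j k : Fin n) : S.hhCurvLow h i j k = - S.hhCurvLow h i k j := by
  rw [hhCurvLow, hhCurvLow, ← sum_neg_distrib]
  exact sum_congr rfl fun m _ => by rw [S.hhCurv_antisymm h m j k]; ring

theorem curv3_antisymm (i j k : Fin n) : S.curv3 i j k = - S.curv3 i k j := by
  rw [curv3, curv3, ← sum_neg_distrib]
  exact sum_congr rfl fun m _ => by rw [S.hhCurvLow_antisymm m i j k]; ring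

/-- Contraction with `y` kills the Cartan tensor term and turns each `Γ` into `N`; since `δ_k y^h =
-N^h_k`, the leftover quadratic terms cancel. -/
theorem sum_y_mul_hhCurv (i j k : Fin n) :
    ∑ h, S.y h * S.hhCurv h i j k = S.nonlinCurv i j k := by
  have e : ∀ j k, ∑ h, S.y h * S.dH k (S.gammaH i h j) =
      S.dH k (S.nonlin i j) + ∑ m, S.nonlin m k * S.gammaH i m j := by
    intro j k
    have := congrArg (S.dH k) (S.sum_y_mul_gammaH i j)
    simp only [map_sum, Derivation.leibniz, smul_eq_mul, sum_add_distrib, dH_y, mul_neg,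
      sum_neg_distrib] at this
    have e' : ∑ m, S.nonlin m k * S.gammaH i m j = ∑ m, S.gammaH i m j * S.nonlin m k :=
      sum_congr rfl fun _ _ => mul_comm _ _
    rw [← this, e', neg_add_cancel_right]
  have e2 : ∀ j k, ∑ h, S.y h * ∑ m, S.gammaH m h j * S.gammaH i m k =
      ∑ m, S.nonlin m j * S.gammaH i m k := by
    intro j k
    simp only [mul_sum, ← mul_assoc]
    rw [sum_comm]
    simp only [← sum_mul, S.sum_y_mul_gammaH]
  have e3 : ∑ h, S.y h * ∑ m, S.cartanUp i h m * S.nonlinCurv m j k = 0 := by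
    simp only [mul_sum, ← mul_assoc]
    rw [sum_comm]
    simp only [← sum_mul, S.sum_y_mul_cartanUp, zero_mul, sum_const_zero]
  simp only [hhCurv, mul_add, mul_sub, sum_add_distrib, sum_sub_distrib, e, e2, e3]
  rw [nonlinCurv]
  ring

theorem sum_nonlinCurv_mul_y (i k : Fin n) :
    ∑ j, S.nonlinCurv i j k * S.y j = S.riemann i k := by
  have e : ∑ j, S.y j * S.dH k (S.nonlin i j) =
      S.dH k (2 * S.spray i) + ∑ j, S.nonlin i j * S.nonlin j k := by
    have := congrArg (S.dH k) (S.sum_nonlin_mul_y i)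
    simp only [map_sum, Derivation.leibniz (S.dH k) (S.nonlin _ _), smul_eq_mul, sum_add_distrib,
      dH_y, mul_neg, sum_neg_distrib] at this
    rw [← this]; ring
  have e1 : ∑ j, S.nonlinCurv i j k * S.y j =
      ∑ j, S.y j * S.dH k (S.nonlin i j) - ∑ j, S.y j * S.dH j (S.nonlin i k) := by
    rw [← sum_sub_distrib]
    exact sum_congr rfl fun j _ => by rw [nonlinCurv]; ring
  rw [e1, e, sum_y_mul_dH, derivation_two_mul, dH_apply, flow_apply, riemann]
  simp only [← nonlin.eq_1]
  have e2 : ∑ j, S.nonlin j k * S.nonlin i j = ∑ j, S.nonlin i j * S.nonlin j k :=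
    sum_congr rfl fun _ _ => mul_comm _ _
  simp only [mul_assoc, ← mul_sum, e2]
  ring

theorem sum_riemann_mul_y (i : Fin n) : ∑ k, S.riemann i k * S.y k = 0 := by
  have h : ∑ k, S.riemann i k * S.y k = - ∑ k, S.riemann i k * S.y k := by
    simp only [← sum_nonlinCurv_mul_y, sum_mul]
    conv_lhs => rw [sum_comm]
    simp only [← sum_neg_distrib]
    refine sum_congr rfl fun j _ => sum_congr rfl fun k _ => ?_
    rw [S.nonlinCurv_antisymm i j k]; ring
  apply two_cancel
  linear_combination h

theorem dH_dH (j k : Fin n) (f : A) :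
    S.dH k (S.dH j f) - S.dH j (S.dH k f) = - ∑ m, S.nonlinCurv m j k * S.dy m f := by
  have e : ∀ j k, S.dH k (S.dH j f) = S.dx k (S.dx j f) - ∑ m, S.nonlin m j * S.dx k (S.dy m f)
      - ∑ m, S.nonlin m k * S.dx j (S.dy m f)
      + ∑ m, ∑ l, S.nonlin m k * S.nonlin l j * S.dy m (S.dy l f)
      - ∑ m, S.dH k (S.nonlin m j) * S.dy m f := by
    intro j k
    rw [S.dH_apply j, map_sub, map_sum]
    simp only [Derivation.leibniz, smul_eq_mul, sum_add_distrib]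
    simp only [S.dH_apply k (S.dx _ _), S.dH_apply k (S.dy _ _), mul_sub, sum_sub_distrib, S.dy_dx]
    have e1 : ∑ l, S.nonlin l j * ∑ m, S.nonlin m k * S.dy m (S.dy l f) =
        ∑ m, ∑ l, S.nonlin m k * S.nonlin l j * S.dy m (S.dy l f) := by
      simp only [mul_sum]
      rw [sum_comm]
      exact sum_congr rfl fun _ _ => sum_congr rfl fun _ _ => by ring
    have e2 : ∑ m, S.dy m f * S.dH k (S.nonlin m j) = ∑ m, S.dH k (S.nonlin m j) * S.dy m f :=
      sum_congr rfl fun _ _ => mul_comm _ _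
    rw [e1, e2]; ring
  have e3 : ∑ m, ∑ l, S.nonlin m k * S.nonlin l j * S.dy m (S.dy l f) =
      ∑ m, ∑ l, S.nonlin m j * S.nonlin l k * S.dy m (S.dy l f) := by
    rw [sum_comm]
    refine sum_congr rfl fun _ _ => sum_congr rfl fun _ _ => ?_
    rw [S.dy_dy]; ring
  have e4 : ∑ m, S.nonlinCurv m j k * S.dy m f =
      ∑ m, S.dH k (S.nonlin m j) * S.dy m f - ∑ m, S.dH j (S.nonlin m k) * S.dy m f := by
    rw [← sum_sub_distrib]
    exact sum_congr rfl fun _ _ => by rw [nonlinCurv]; ring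
  rw [e, e, e3, e4, S.dx_dx]; ring

/-- Lowering inside the derivative is paid for by `dH_g`. The outcome contains only lowered symbols,
whose symmetries make the skewness and the cyclic identity visible. -/
theorem hhCurvLow_eq (h i j k : Fin n) : S.hhCurvLow h i j k =
    S.dH k (S.gammaLow i h j) - S.dH j (S.gammaLow i h k)
      - ∑ m, S.gammaLow m i k * S.gammaH m h j + ∑ m, S.gammaLow m i j * S.gammaH m h k
      + ∑ m, S.cartan i h m * S.nonlinCurv m j k := by
  have e : ∀ j k, S.dH k (S.gammaLow i h j) = ∑ m, S.g i m * S.dH k (S.gammaH m h j)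
      + ∑ m, S.g i m * ∑ l, S.gammaH l h j * S.gammaH m l k
      + ∑ m, S.gammaLow m i k * S.gammaH m h j := by
    intro j k
    have e1 : ∑ m, S.g i m * ∑ l, S.gammaH l h j * S.gammaH m l k =
        ∑ l, S.gammaLow i l k * S.gammaH l h j := by
      simp only [mul_sum, gammaLow, sum_mul]
      rw [sum_comm]
      exact sum_congr rfl fun _ _ => sum_congr rfl fun _ _ => by ring
    rw [e1, add_assoc, ← sum_add_distrib, ← sum_add_distrib]
    conv_lhs => rw [gammaLow, map_sum]
    refine sum_congr rfl fun m _ => ?_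
    rw [Derivation.leibniz, smul_eq_mul, smul_eq_mul, dH_g]; ring
  have e2 : ∑ m, S.g i m * ∑ l, S.cartanUp m h l * S.nonlinCurv l j k =
      ∑ m, S.cartan i h m * S.nonlinCurv m j k := by
    simp only [mul_sum, ← mul_assoc]
    rw [sum_comm]
    simp only [← sum_mul, S.sum_g_mul_cartanUp]
  rw [e, e, ← e2]
  simp only [hhCurvLow, hhCurv, mul_add, mul_sub, sum_add_distrib, sum_sub_distrib]
  ring

/-- The Ricci identity for `g_{ih}`. The commutator of horizontal derivatives leaves a vertical term
`2 C_{ihm}` times the curvature of `N`, which is exactly what the Cartan tensor terms in the two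
curvatures add up to. -/
theorem hhCurvLow_skew (h i j k : Fin n) : S.hhCurvLow h i j k = - S.hhCurvLow i h j k := by
  have hc := S.dH_dH j k (S.g i h)
  have ec : ∑ m, S.nonlinCurv m j k * S.dy m (S.g i h) =
      2 * ∑ m, S.cartan i h m * S.nonlinCurv m j k := by
    rw [mul_sum]
    refine sum_congr rfl fun m _ => ?_
    rw [← cartan_eq, S.cartan_swap m i h, S.cartan_swap' i m h]; ring
  have ec' : ∑ m, S.cartan h i m * S.nonlinCurv m j k = ∑ m, S.cartan i h m * S.nonlinCurv m j k :=
    sum_congr rfl fun m _ => by rw [S.cartan_swap]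
  have et : ∀ i h j k, ∑ m, S.gammaLow m i k * S.gammaH m h j =
      ∑ m, S.gammaLow m h j * S.gammaH m i k := by
    intro i h j k
    simp only [gammaLow, sum_mul]
    rw [sum_comm]
    refine sum_congr rfl fun _ _ => sum_congr rfl fun _ _ => ?_
    rw [S.g_symm]; ring
  rw [S.dH_g i h j, S.dH_g i h k, map_add, map_add, ec] at hc
  rw [hhCurvLow_eq, hhCurvLow_eq, ec', et i h j k, et i h k j]
  linear_combination hc

/-- `Γ` is symmetric in its lower indices, so all derivative and `ΓΓ` terms cancel in the cyclic sum
and only the Cartan tensor terms remain. -/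
theorem bianchi (h i j k : Fin n) :
    S.hhCurvLow h i j k + S.hhCurvLow j i k h + S.hhCurvLow k i h j =
      ∑ m, S.cartan i h m * S.nonlinCurv m j k + ∑ m, S.cartan i j m * S.nonlinCurv m k h
        + ∑ m, S.cartan i k m * S.nonlinCurv m h j := by
  rw [hhCurvLow_eq, hhCurvLow_eq, hhCurvLow_eq, S.gammaLow_symm i j h, S.gammaLow_symm i j k,
    S.gammaLow_symm i k h]
  simp only [S.gammaH_symm _ j h, S.gammaH_symm _ k h, S.gammaH_symm _ k j]
  ring

theorem curv3_eq (i j k : Fin n) : S.curv3 i j k = ∑ m, S.g i m * S.nonlinCurv m j k := by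
  simp only [curv3, hhCurvLow, ← sum_y_mul_hhCurv, mul_sum]
  rw [sum_comm]
  exact sum_congr rfl fun _ _ => sum_congr rfl fun _ _ => by ring

theorem curv2_eq (i k : Fin n) : S.curv2 i k = ∑ m, S.g i m * S.riemann m k := by
  simp only [curv2, curv3_eq, ← sum_nonlinCurv_mul_y, mul_sum, sum_mul]
  rw [sum_comm]
  exact sum_congr rfl fun _ _ => sum_congr rfl fun _ _ => by ring

theorem sum_y_mul_curv3 (j k : Fin n) : ∑ i, S.y i * S.curv3 i j k = 0 := by
  have h : ∑ i, S.y i * S.curv3 i j k = - ∑ i, S.y i * S.curv3 i j k := by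
    simp only [curv3, mul_sum]
    conv_lhs => rw [sum_comm]
    simp only [← sum_neg_distrib]
    refine sum_congr rfl fun a _ => sum_congr rfl fun b _ => ?_
    rw [S.hhCurvLow_skew a b]; ring
  apply two_cancel
  linear_combination h

/-- `R_{hi0k} = R_{hijk} yʲ`. -/
def curvMid (h i k : Fin n) : A := ∑ j, S.y j * S.hhCurvLow h i j k

theorem curvMid_skew (h i k : Fin n) : S.curvMid h i k = - S.curvMid i h k := by
  rw [curvMid, curvMid, ← sum_neg_distrib]
  exact sum_congr rfl fun m _ => by rw [S.hhCurvLow_skew h i m k]; ring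

theorem sum_y_mul_curvMid (i k : Fin n) : ∑ h, S.y h * S.curvMid h i k = S.curv2 i k := by
  simp only [curvMid, curv2, curv3, mul_sum, sum_mul]
  rw [sum_comm]
  exact sum_congr rfl fun _ _ => sum_congr rfl fun _ _ => by ring

theorem bianchi_contract (h i k : Fin n) :
    S.curvMid h i k + S.curv3 i k h - S.curvMid k i h =
      ∑ m, S.cartan i h m * S.riemann m k - ∑ m, S.cartan i k m * S.riemann m h := by
  have e1 : ∑ j, S.y j * S.hhCurvLow k i h j = - S.curvMid k i h := by
    rw [curvMid, ← sum_neg_distrib]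
    exact sum_congr rfl fun j _ => by rw [S.hhCurvLow_antisymm k i h j]; ring
  have e2 : ∑ j, S.y j * ∑ m, S.cartan i h m * S.nonlinCurv m j k =
      ∑ m, S.cartan i h m * S.riemann m k := by
    simp only [← sum_nonlinCurv_mul_y, mul_sum]
    rw [sum_comm]
    exact sum_congr rfl fun _ _ => sum_congr rfl fun _ _ => by ring
  have e3 : ∑ j, S.y j * ∑ m, S.cartan i k m * S.nonlinCurv m h j =
      - ∑ m, S.cartan i k m * S.riemann m h := by
    simp only [← sum_nonlinCurv_mul_y, mul_sum, ← sum_neg_distrib]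
    rw [sum_comm]
    refine sum_congr rfl fun _ _ => sum_congr rfl fun _ _ => ?_
    rw [S.nonlinCurv_antisymm _ h]; ring
  have e4 : ∑ j, S.y j * ∑ m, S.cartan i j m * S.nonlinCurv m k h = 0 := by
    simp only [mul_sum, ← mul_assoc]
    rw [sum_comm]
    simp only [← sum_mul, S.cartan_swap i, S.sum_y_mul_cartan, zero_mul, sum_const_zero]
  have := Finset.sum_congr (rfl : (univ : Finset (Fin n)) = univ)
    fun j _ => congrArg (S.y j * ·) (S.bianchi h i j k)
  simp only [mul_add, sum_add_distrib, e1, e2, e3, e4] at this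
  rw [← curvMid, ← curv3] at this
  linear_combination this

/-- A further contraction of the Bianchi identity with `y`: the Cartan terms vanish and so does `y^i
R_{ijk}`, leaving the difference of the two sides. -/
theorem curv2_symm (i k : Fin n) : S.curv2 i k = S.curv2 k i := by
  have := Finset.sum_congr (rfl : (univ : Finset (Fin n)) = univ)
    fun j _ => congrArg (S.y j * ·) (S.bianchi_contract i j k)
  have e : ∀ i k, ∑ j, S.y j * S.curvMid i j k = - S.curv2 i k := fun i k => by
    rw [← sum_y_mul_curvMid, ← sum_neg_distrib]
    exact sum_congr rfl fun j _ => by rw [S.curvMid_skew i]; ring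
  have e2 : ∀ i k, ∑ j, S.y j * ∑ m, S.cartan j i m * S.riemann m k = 0 := fun i k => by
    simp only [mul_sum, ← mul_assoc]
    rw [sum_comm]
    simp only [← sum_mul, S.sum_y_mul_cartan, zero_mul, sum_const_zero]
  simp only [mul_add, mul_sub, sum_add_distrib, sum_sub_distrib, e, e2, sum_y_mul_curv3] at this
  linear_combination -this

theorem ricci_mul_y (i : Fin n) : ∑ j, S.ricci i j * S.y j =
    ∑ r, ∑ m, S.gInv r m * S.curvMid i m r := by
  simp only [ricci, curvMid, sum_mul, mul_sum]
  rw [sum_comm]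
  refine sum_congr rfl fun _ _ => ?_
  rw [sum_comm]
  exact sum_congr rfl fun _ _ => sum_congr rfl fun _ _ => by ring

theorem ricciZero_eq (k : Fin n) : S.ricciZero k = ∑ r, ∑ m, S.gInv r m * S.curv3 m k r := by
  simp only [ricciZero, ricci, curv3, sum_mul, mul_sum]
  rw [sum_comm]
  refine sum_congr rfl fun _ _ => ?_
  rw [sum_comm]
  exact sum_congr rfl fun _ _ => sum_congr rfl fun _ _ => by ring

/-- The trace of `bianchi_contract` with `g^{rm}`. One `curvMid` term dies because it is skew in its
first two indices, another gives `R_{i0}`, and the remaining curvature term gives `-R_{0i}`. -/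
theorem ricci_mul_y_sub (i : Fin n) : ∑ j, S.ricci i j * S.y j - S.ricciZero i =
    ∑ l, ∑ r, S.cartanUp r i l * S.riemann l r - ∑ l, S.meanCartan l * S.riemann l i := by
  have := Finset.sum_congr (rfl : (univ : Finset (Fin n)) = univ) fun r _ =>
    Finset.sum_congr (rfl : (univ : Finset (Fin n)) = univ) fun m _ =>
      congrArg (S.gInv r m * ·) (S.bianchi_contract i m r)
  simp only [mul_add, mul_sub, sum_add_distrib, sum_sub_distrib] at this
  have e1 : ∑ r, ∑ m, S.gInv r m * S.curvMid r m i = 0 := by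
    have h : ∑ r, ∑ m, S.gInv r m * S.curvMid r m i =
        - ∑ r, ∑ m, S.gInv r m * S.curvMid r m i := by
      conv_lhs => rw [sum_comm]
      simp only [← sum_neg_distrib]
      refine sum_congr rfl fun a _ => sum_congr rfl fun b _ => ?_
      rw [S.curvMid_skew, S.gInv_symm]; ring
    apply two_cancel
    linear_combination h
  have e2 : ∑ r, ∑ m, S.gInv r m * S.curv3 m r i = - S.ricciZero i := by
    simp only [ricciZero_eq, ← sum_neg_distrib]
    refine sum_congr rfl fun a _ => sum_congr rfl fun b _ => ?_
    rw [S.curv3_antisymm]; ring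
  have e3 : ∑ r, ∑ m, S.gInv r m * ∑ l, S.cartan m i l * S.riemann l r =
      ∑ l, ∑ r, S.cartanUp r i l * S.riemann l r := by
    simp only [cartanUp, sum_mul, mul_sum]
    conv_rhs => rw [sum_comm]
    refine sum_congr rfl fun _ _ => ?_
    rw [sum_comm]
    exact sum_congr rfl fun _ _ => sum_congr rfl fun _ _ => by ring
  have e4 : ∑ r, ∑ m, S.gInv r m * ∑ l, S.cartan m r l * S.riemann l i =
      ∑ l, S.meanCartan l * S.riemann l i := by
    simp only [meanCartan, sum_mul, mul_sum]
    conv_rhs => rw [sum_comm]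
    refine sum_congr rfl fun _ _ => ?_
    rw [sum_comm]
    refine sum_congr rfl fun _ _ => sum_congr rfl fun _ _ => ?_
    rw [S.cartan_swap]; ring
  rw [← ricci_mul_y, e1, e2, e3, e4] at this
  linear_combination this

/-- The tensor `ℜ_{ij}`, with `w_i = F⁻¹ ℓ_i` and `c = 1/(n+1)`. -/
def frakR (c : A) (w : Fin n → A) (i j : Fin n) : A :=
  S.ricci i j - c *
    ((∑ k, S.meanCartanUp k * S.curv3 i j k)
      + (∑ k, S.meanCartanUp k * S.curv3 k j i)
      + w i * (∑ k, S.meanCartanUp k * S.curv2 k j)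
      + S.meanCartan i * S.ricciZero j)

theorem sum_meanCartanUp_mul_curv2 (i : Fin n) :
    ∑ k, S.meanCartanUp k * S.curv2 k i = ∑ m, S.meanCartan m * S.riemann m i := by
  simp only [meanCartanUp, curv2_eq, sum_mul]
  rw [sum_comm]
  refine sum_congr rfl fun a _ => ?_
  rw [← S.gInv_contract (fun m => S.riemann m i) a, mul_sum]
  refine sum_congr rfl fun b _ => ?_
  rw [S.gInv_symm]; ring

theorem sum_curv3_mul_y (i k : Fin n) : ∑ j, S.curv3 i j k * S.y j = S.curv2 i k := rfl

theorem sum_curv2_mul_y (i : Fin n) : ∑ j, S.curv2 i j * S.y j = 0 := by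
  simp only [curv2_eq, sum_mul, mul_assoc]
  rw [sum_comm]
  simp only [← mul_sum, S.sum_riemann_mul_y, mul_zero, sum_const_zero]

theorem ricciZero_mul_y : ∑ j, S.ricciZero j * S.y j = ∑ m, S.riemann m m := by
  simp only [ricciZero_eq, sum_mul]
  rw [sum_comm]
  refine sum_congr rfl fun r _ => ?_
  rw [← S.gInv_contract (fun m => S.riemann m r) r, sum_comm]
  refine sum_congr rfl fun m _ => ?_
  rw [← curv2_eq, curv2, mul_sum]
  exact sum_congr rfl fun _ _ => by ring

/-- With `y` in the second slot the corrections give `2 I_m R^m_i + I_i R^m_m`, the `w` term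
dropping out because `R_{k0j} y^j = 0`. With `y` in the first slot the second correction gives `-I_m
R^m_i` and the `w` term gives `+I_m R^m_i`, since `w_i y^i = 1`; the other two vanish. Thus the
contribution there is zero. -/
theorem frakR_sub (c : A) (w : Fin n → A) (hw : ∑ i, w i * S.y i = 1) (i : Fin n) :
    ∑ j, S.frakR c w i j * S.y j - ∑ j, S.frakR c w j i * S.y j =
      ∑ l, ∑ r, S.cartanUp r i l * S.riemann l r - ∑ l, S.meanCartan l * S.riemann l i
        - c * (2 * ∑ l, S.meanCartan l * S.riemann l i + S.meanCartan i * ∑ m, S.riemann m m) := by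
  have s1 : ∀ j, S.frakR c w i j * S.y j = S.ricci i j * S.y j - c *
      (∑ k, S.meanCartanUp k * (S.curv3 i j k * S.y j)
      + ∑ k, S.meanCartanUp k * (S.curv3 k j i * S.y j)
      + w i * ∑ k, S.meanCartanUp k * (S.curv2 k j * S.y j)
      + S.meanCartan i * (S.ricciZero j * S.y j)) := fun j => by
    simp only [frakR, ← mul_assoc, ← sum_mul]; ring
  have s2 : ∀ j, S.frakR c w j i * S.y j = S.ricci j i * S.y j - c *
      (∑ k, S.meanCartanUp k * (S.y j * S.curv3 j i k)
      - ∑ k, S.meanCartanUp k * (S.curv3 k j i * S.y j)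
      + (w j * S.y j) * ∑ k, S.meanCartanUp k * S.curv2 k i
      + (S.y j * S.meanCartan j) * S.ricciZero i) := fun j => by
    have : ∑ k, S.meanCartanUp k * (S.curv3 k j i * S.y j) =
      - ∑ k, S.meanCartanUp k * (S.curv3 k i j * S.y j) := by
        rw [← sum_neg_distrib]
        exact sum_congr rfl fun k _ => by rw [S.curv3_antisymm k j]; ring
    rw [this]
    simp only [frakR, ← mul_assoc, ← sum_mul]
    simp only [mul_assoc, mul_left_comm _ (S.y j), ← mul_sum]
    ring
  have t1 : ∑ j, ∑ k, S.meanCartanUp k * (S.curv3 i j k * S.y j) =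
      ∑ l, S.meanCartan l * S.riemann l i := by
    rw [sum_comm]
    simp only [← mul_sum, sum_curv3_mul_y]
    rw [← sum_meanCartanUp_mul_curv2]
    exact sum_congr rfl fun _ _ => by rw [S.curv2_symm]
  have t2 : ∑ j, ∑ k, S.meanCartanUp k * (S.curv3 k j i * S.y j) =
      ∑ l, S.meanCartan l * S.riemann l i := by
    rw [sum_comm]
    simp only [← mul_sum, sum_curv3_mul_y]
    rw [← sum_meanCartanUp_mul_curv2]
  have t3 : ∑ j, ∑ k, S.meanCartanUp k * (S.curv2 k j * S.y j) = 0 := by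
    rw [sum_comm]
    simp only [← mul_sum, sum_curv2_mul_y, mul_zero, sum_const_zero]
  have t4 : ∑ j, ∑ k, S.meanCartanUp k * (S.y j * S.curv3 j i k) = 0 := by
    rw [sum_comm]
    simp only [← mul_sum, sum_y_mul_curv3, mul_zero, sum_const_zero]
  simp only [s1, s2, sum_sub_distrib, ← mul_sum, sum_add_distrib, t1, t2, t3, t4, ← sum_mul, hw,
    S.sum_y_mul_meanCartan, sum_meanCartanUp_mul_curv2, ricciZero_mul_y]
  have := S.ricci_mul_y_sub i
  rw [ricciZero] at this
  linear_combination this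

/-! ### The mean Cartan tensor along the spray -/

/-- `½ g^{jk} D g_{jk}`, the logarithmic derivative of `√det g`. -/
def logVol (D : Derivation ℝ A A) : A := half A * ∑ j, ∑ k, S.gInv j k * D (S.g j k)

theorem logVol_add (D E : Derivation ℝ A A) : S.logVol (D + E) = S.logVol D + S.logVol E := by
  simp [logVol, mul_add, sum_add_distrib]

theorem logVol_smul (f : A) (D : Derivation ℝ A A) : S.logVol (f • D) = f * S.logVol D := by
  simp only [logVol, Derivation.coe_smul, Pi.smul_apply, smul_eq_mul, mul_sum]
  exact sum_congr rfl fun _ _ => sum_congr rfl fun _ _ => by ring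

theorem logVol_sum (f : Fin n → A) (D : Fin n → Derivation ℝ A A) :
    S.logVol (∑ i, f i • D i) = ∑ i, f i * S.logVol (D i) := by
  simp only [logVol, derivation_sum_apply, Derivation.coe_smul, Pi.smul_apply, smul_eq_mul, mul_sum]
  have : ∀ j, ∑ k, ∑ i, half A * (S.gInv j k * (f i * D i (S.g j k))) =
    ∑ i, ∑ k, f i * (half A * (S.gInv j k * D i (S.g j k))) := fun j => by
      rw [sum_comm]
      exact sum_congr rfl fun _ _ => sum_congr rfl fun _ _ => by ring
  simp only [this]
  rw [sum_comm]

theorem logVol_dy (i : Fin n) : S.logVol (S.dy i) = S.meanCartan i := by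
  simp only [logVol, meanCartan, mul_sum]
  refine sum_congr rfl fun j _ => sum_congr rfl fun k _ => ?_
  rw [← cartan_eq, S.cartan_swap, S.cartan_swap']
  linear_combination S.gInv j k * S.cartan j k i * two_mul_half (A := A)

theorem derivation_gInv (D : Derivation ℝ A A) (i j : Fin n) :
    D (S.gInv i j) = - ∑ a, ∑ b, S.gInv i a * S.gInv j b * D (S.g a b) := by
  have h : ∀ l, ∑ k, S.g k l * D (S.gInv i k) = - ∑ k, S.gInv i k * D (S.g k l) := by
    intro l
    have := congrArg D (S.gInv_g i l)
    simp only [map_sum, Derivation.leibniz, smul_eq_mul, sum_add_distrib] at this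
    have e : D (if i = l then (1 : A) else 0) = 0 := by split_ifs <;> simp
    rw [e] at this
    linear_combination this
  have h2 := S.gInv_contract (fun k => D (S.gInv i k)) j
  rw [← h2]
  conv_rhs => rw [sum_comm]
  rw [← sum_neg_distrib]
  refine sum_congr rfl fun l _ => ?_
  have h3 := h l
  simp only [S.g_symm _ l] at h3
  rw [h3, mul_neg, mul_sum]
  congr 1
  refine sum_congr rfl fun k _ => ?_
  rw [S.g_symm]; ring

theorem derivation_logVol (D E : Derivation ℝ A A) : D (S.logVol E) =
    half A * (∑ j, ∑ k, S.gInv j k * D (E (S.g j k)) -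
      ∑ j, ∑ k, ∑ a, ∑ b, S.gInv j a * S.gInv k b * D (S.g a b) * E (S.g j k)) := by
  have h : ∀ j k, D (S.gInv j k * E (S.g j k)) = S.gInv j k * D (E (S.g j k)) -
      ∑ a, ∑ b, S.gInv j a * S.gInv k b * D (S.g a b) * E (S.g j k) := by
    intro j k
    rw [Derivation.leibniz, derivation_gInv, smul_eq_mul, smul_eq_mul, mul_neg, mul_comm (E _),
      ← sub_eq_add_neg]
    simp only [sum_mul]
  rw [logVol, derivation_half_mul]
  simp only [map_sum, h, sum_sub_distrib]

/-- Formally `logVol D` is `D` applied to `log √det g`, a function that need not exist in `A`. The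
terms quadratic in first derivatives of `g` are symmetric in `D` and `E`, hence cancel. -/
theorem logVol_commutator (D E : Derivation ℝ A A) :
    D (S.logVol E) - E (S.logVol D) = S.logVol ⁅D, E⁆ := by
  have h : ∀ f : Fin n → Fin n → Fin n → Fin n → A, ∑ j, ∑ k, ∑ a, ∑ b, f j k a b =
      ∑ p : Fin n × Fin n, ∑ q : Fin n × Fin n, f p.1 p.2 q.1 q.2 := fun f => by
    simp only [Fintype.sum_prod_type]
  have e2 : ∑ j, ∑ k, ∑ a, ∑ b, S.gInv j a * S.gInv k b * D (S.g a b) * E (S.g j k) =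
      ∑ j, ∑ k, ∑ a, ∑ b, S.gInv j a * S.gInv k b * E (S.g a b) * D (S.g j k) := by
    rw [h, sum_comm, h]
    refine sum_congr rfl fun p _ => sum_congr rfl fun q _ => ?_
    rw [S.gInv_symm q.1, S.gInv_symm q.2]; ring
  rw [derivation_logVol, derivation_logVol, e2, logVol]
  simp only [Derivation.commutator_apply, mul_sub, sum_sub_distrib]
  ring

theorem logVol_flow : S.logVol S.flow = ∑ m, S.nonlin m m := by
  have e : ∑ j, ∑ k, S.gInv j k * S.nonlinLow k j = ∑ m, S.nonlin m m := by
    refine sum_congr rfl fun j _ => ?_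
    exact S.gInv_contract (fun m => S.nonlin m j) j
  have e2 : ∑ j, ∑ k, S.gInv j k * S.nonlinLow j k = ∑ m, S.nonlin m m := by
    rw [← e, sum_comm]
    exact sum_congr rfl fun _ _ => sum_congr rfl fun _ _ => by rw [S.gInv_symm]
  simp only [logVol, flow_g, mul_add, sum_add_distrib, e, e2]
  linear_combination (∑ m, S.nonlin m m) * two_mul_half (A := A)

/-- `I_i` is the fibre derivative of the formal `log √det g`, whose derivative along the spray is
`N^m_m`; the rest is the commutator of the spray with `∂/∂yⁱ`. -/
theorem flow_meanCartan (i : Fin n) : S.flow (S.meanCartan i) =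
    S.dy i (∑ m, S.nonlin m m) - S.logVol (S.dx i) + 2 * ∑ m, S.nonlin m i * S.meanCartan m := by
  have h := S.logVol_commutator S.flow (S.dy i)
  have hc : ⁅S.flow, S.dy i⁆ = (-1 : A) • S.dx i + ∑ m, (2 * S.nonlin m i) • S.dy m := by
    ext f
    simp only [Derivation.commutator_apply, Derivation.coe_add, Pi.add_apply, derivation_sum_apply,
      Derivation.coe_smul, Pi.smul_apply, smul_eq_mul]
    rw [S.dy_flow]
    simp only [mul_assoc, ← mul_sum]
    ring
  rw [hc, logVol_add, logVol_smul, logVol_sum, logVol_flow] at h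
  simp only [logVol_dy, mul_assoc, ← mul_sum] at h
  linear_combination h

theorem flow_logVol_dx (i : Fin n) : S.flow (S.logVol (S.dx i)) =
    S.dx i (∑ m, S.nonlin m m) + 2 * ∑ m, S.dx i (S.spray m) * S.meanCartan m := by
  have h := S.logVol_commutator S.flow (S.dx i)
  have hc : ⁅S.flow, S.dx i⁆ = ∑ m, (2 * S.dx i (S.spray m)) • S.dy m := by
    ext f
    simp only [Derivation.commutator_apply, derivation_sum_apply,
      Derivation.coe_smul, Pi.smul_apply, smul_eq_mul]
    rw [S.dx_flow]
    simp only [mul_assoc, ← mul_sum]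
    ring
  rw [hc, logVol_sum, logVol_flow] at h
  simp only [logVol_dy, mul_assoc, ← mul_sum] at h
  linear_combination h

theorem riemann_eq (i k : Fin n) : S.riemann i k =
    2 * S.dx k (S.spray i) - S.flow (S.nonlin i k) - ∑ j, S.nonlin i j * S.nonlin j k := by
  rw [riemann, flow_apply]
  simp only [← nonlin.eq_1, mul_assoc, ← mul_sum]
  ring

theorem dy_riemann (i k l : Fin n) : S.dy l (S.riemann i k) =
    2 * S.dx k (S.nonlin i l) - S.flow (S.dy l (S.nonlin i k)) - S.dx l (S.nonlin i k)
      + 2 * ∑ m, S.nonlin m l * S.dy m (S.nonlin i k)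
      - ∑ j, S.dy l (S.nonlin i j) * S.nonlin j k - ∑ j, S.nonlin i j * S.dy l (S.nonlin j k) := by
  rw [riemann_eq, map_sub, map_sub, derivation_two_mul, S.dy_dx, S.dy_flow, map_sum]
  simp only [Derivation.leibniz, smul_eq_mul, sum_add_distrib, ← nonlin.eq_1]
  have : ∑ j, S.nonlin j k * S.dy l (S.nonlin i j) = ∑ j, S.dy l (S.nonlin i j) * S.nonlin j k :=
    sum_congr rfl fun _ _ => mul_comm _ _
  rw [this]; ring

theorem dy_nonlin (i j k : Fin n) : S.dy k (S.nonlin i j) = S.dy j (S.nonlin i k) := by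
  rw [nonlin, nonlin, S.dy_dy]

/-- Two traces of `dy_riemann`, weighted so that the products of `N` with its fibre derivatives
cancel; these derivatives are symmetric in the lower indices. -/
theorem riemann_trace_identity (k : Fin n) :
    3 * (S.flow (S.dy k (∑ m, S.nonlin m m)) - S.dx k (∑ m, S.nonlin m m)) =
      - (2 * ∑ m, S.dy m (S.riemann m k) + S.dy k (∑ m, S.riemann m m)) := by
  simp only [map_sum, dy_riemann, sum_sub_distrib, sum_add_distrib, ← mul_sum]
  have e1 : ∑ m, S.flow (S.dy m (S.nonlin m k)) = ∑ m, S.flow (S.dy k (S.nonlin m m)) :=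
    sum_congr rfl fun m _ => by rw [S.dy_nonlin m k m]
  have e2 : ∑ i, ∑ m, S.nonlin m i * S.dy m (S.nonlin i k) =
      ∑ i, ∑ m, S.dy k (S.nonlin i m) * S.nonlin m i :=
    sum_congr rfl fun i _ => sum_congr rfl fun m _ => by rw [S.dy_nonlin i k m]; ring
  have e3 : ∑ i, ∑ m, S.nonlin i m * S.dy i (S.nonlin m k) =
      ∑ i, ∑ m, S.dy k (S.nonlin i m) * S.nonlin m i := by
    rw [sum_comm]
    exact sum_congr rfl fun i _ => sum_congr rfl fun m _ => by rw [S.dy_nonlin i k m]; ring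
  have e4 : ∑ i, ∑ m, S.nonlin i m * S.dy k (S.nonlin m i) =
      ∑ i, ∑ m, S.dy k (S.nonlin i m) * S.nonlin m i := by
    rw [sum_comm]
    exact sum_congr rfl fun i _ => sum_congr rfl fun m _ => by ring
  have e5 : ∑ i, ∑ m, S.nonlin m k * S.dy m (S.nonlin i i) =
      ∑ i, ∑ m, S.dy i (S.nonlin i m) * S.nonlin m k :=
    sum_congr rfl fun i _ => sum_congr rfl fun m _ => by rw [S.dy_nonlin i i m]; ring
  rw [e1, e2, e3, e4, e5]
  ring

/-- By `riemann_eq` this is `3(∇₀∇₀ I_i + R^m_i I_m) = -(2 ∂R^m_i/∂y^m + ∂R^m_m/∂yⁱ)` with the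
covariant derivatives written out. It is linear in `I` and its source involves only fibre
derivatives of the curvature. -/
theorem three_mul_flow_flow_meanCartan (i : Fin n) :
    3 * S.flow (S.flow (S.meanCartan i)) =
      - (2 * ∑ m, S.dy m (S.riemann m i) + S.dy i (∑ m, S.riemann m m))
      - 6 * ∑ m, S.dx i (S.spray m) * S.meanCartan m
      + 6 * ∑ m, S.flow (S.nonlin m i) * S.meanCartan m
      + 6 * ∑ m, S.nonlin m i * S.flow (S.meanCartan m) := by
  rw [← riemann_trace_identity, flow_meanCartan, map_add, map_sub, flow_logVol_dx,
    derivation_two_mul, map_sum S.flow]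
  simp only [Derivation.leibniz, smul_eq_mul, sum_add_distrib]
  have : ∑ j, S.meanCartan j * S.flow (S.nonlin j i) = ∑ j, S.flow (S.nonlin j i) * S.meanCartan j :=
    sum_congr rfl fun _ _ => mul_comm _ _
  rw [this]; ring

end FinslerCalculus

end Finsler

end

/-! ### Smooth functions on an open set as a model of the abstract calculus. -/

noncomputable section

namespace Finsler

open Finset TopologicalSpace

variable {n : ℕ}

/-! ### Smooth functions on an open subset of `ℝⁿ × ℝⁿ` -/

/-- Extension of a function by zero. -/
def zeroExt (Ω : Opens (Coord n × Coord n)) (f : Ω → ℝ) : Coord n × Coord n → ℝ :=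
  Function.extend Subtype.val f 0

theorem zeroExt_apply {Ω : Opens (Coord n × Coord n)} (f : Ω → ℝ) (p : Ω) :
    zeroExt Ω f p = f p :=
  Subtype.val_injective.extend_apply f 0 p

theorem zeroExt_of_mem {Ω : Opens (Coord n × Coord n)} (f : Ω → ℝ) {p : Coord n × Coord n}
    (hp : p ∈ Ω) : zeroExt Ω f p = f ⟨p, hp⟩ :=
  zeroExt_apply f ⟨p, hp⟩

/-- The algebra of smooth functions on an open set. -/
def smoothAlg (Ω : Opens (Coord n × Coord n)) : Subalgebra ℝ (Ω → ℝ) where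
  carrier := {f | ContDiffOn ℝ ∞ (zeroExt Ω f) Ω}
  mul_mem' {f g} hf hg := (ContDiffOn.mul hf hg).congr fun p hp => by
    simp [zeroExt_of_mem _ (show p ∈ Ω from hp)]
  add_mem' {f g} hf hg := (ContDiffOn.add hf hg).congr fun p hp => by
    simp [zeroExt_of_mem _ (show p ∈ Ω from hp)]
  algebraMap_mem' r := (contDiffOn_const (c := r)).congr fun p hp => by
    simp [zeroExt_of_mem _ (show p ∈ Ω from hp)]

variable {Ω : Opens (Coord n × Coord n)}

theorem smoothAlg_contDiffOn (f : smoothAlg Ω) : ContDiffOn ℝ ∞ (zeroExt Ω f) Ω := f.2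

theorem smoothAlg_contDiffAt (f : smoothAlg Ω) (p : Ω) : ContDiffAt ℝ ∞ (zeroExt Ω f) p :=
  f.2.contDiffAt (Ω.isOpen.mem_nhds p.2)

theorem smoothAlg_differentiableAt (f : smoothAlg Ω) (p : Ω) :
    DifferentiableAt ℝ (zeroExt Ω f) p :=
  (smoothAlg_contDiffAt f p).differentiableAt (by simp)

theorem zeroExt_eventuallyEq {f : smoothAlg Ω} {h : Coord n × Coord n → ℝ}
    (hf : ∀ p : Ω, h p = (f : Ω → ℝ) p) (p : Ω) : zeroExt Ω f =ᶠ[𝓝 (p : Coord n × Coord n)] h := by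
  filter_upwards [Ω.isOpen.mem_nhds p.2] with q hq
  rw [zeroExt_of_mem _ hq, ← hf]

/-- The element of `smoothAlg Ω` given by a function which is smooth on `Ω`. -/
def smoothAlg.ofFun (h : Coord n × Coord n → ℝ) (hh : ContDiffOn ℝ ∞ h Ω) : smoothAlg Ω :=
  ⟨fun p => h p, hh.congr fun _ hp => zeroExt_of_mem _ hp⟩

@[simp] theorem smoothAlg.ofFun_apply (h : Coord n × Coord n → ℝ) (hh : ContDiffOn ℝ ∞ h Ω)
    (p : Ω) : (smoothAlg.ofFun h hh : Ω → ℝ) p = h p := rfl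

/-- Evaluation at a point. -/
def evalAt (p : Ω) : smoothAlg Ω →ₐ[ℝ] ℝ := (Pi.evalAlgHom ℝ (fun _ : Ω => ℝ) p).comp (smoothAlg Ω).val

theorem evalAt_apply (p : Ω) (f : smoothAlg Ω) : evalAt p f = (f : Ω → ℝ) p := rfl

theorem smoothAlg_ext {f g : smoothAlg Ω} (h : ∀ p, evalAt p f = evalAt p g) : f = g :=
  Subtype.ext (funext h)

theorem smoothAlg_isUnit (f : smoothAlg Ω) (h : ∀ p, evalAt p f ≠ 0) : IsUnit f := by
  have hi : ContDiffOn ℝ ∞ (fun p => (zeroExt Ω f p)⁻¹) Ω :=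
    f.2.inv fun p hp => by rw [zeroExt_of_mem _ hp]; exact h ⟨p, hp⟩
  refine IsUnit.of_mul_eq_one (smoothAlg.ofFun _ hi) (smoothAlg_ext fun p => ?_)
  rw [map_mul, evalAt_apply _ (smoothAlg.ofFun _ hi), smoothAlg.ofFun_apply, zeroExt_apply, map_one]
  exact mul_inv_cancel₀ (h p)

/-- The directional derivative as a derivation of `smoothAlg Ω`. -/
def dirDeriv (v : Coord n × Coord n) : Derivation ℝ (smoothAlg Ω) (smoothAlg Ω) :=
  Derivation.mk'
    { toFun := fun f => smoothAlg.ofFun (fun p => fderiv ℝ (zeroExt Ω f) p v)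
        ((f.2.fderiv_of_isOpen Ω.isOpen (m := ∞) (by simp)).clm_apply contDiffOn_const)
      map_add' := fun f g => smoothAlg_ext fun p => by
        simp only [evalAt_apply, smoothAlg.ofFun_apply, Subalgebra.coe_add, Pi.add_apply]
        have : zeroExt Ω (f + g : smoothAlg Ω) =ᶠ[𝓝 (p : Coord n × Coord n)]
            zeroExt Ω f + zeroExt Ω g :=
          zeroExt_eventuallyEq (fun q => by simp [zeroExt_apply]) p
        rw [← Subalgebra.coe_add, this.fderiv_eq, fderiv_add (smoothAlg_differentiableAt f p)
          (smoothAlg_differentiableAt g p)]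
        simp
      map_smul' := fun c f => smoothAlg_ext fun p => by
        simp only [evalAt_apply, smoothAlg.ofFun_apply, Subalgebra.coe_smul, Pi.smul_apply,
          RingHom.id_apply]
        have : zeroExt Ω (c • f : smoothAlg Ω) =ᶠ[𝓝 (p : Coord n × Coord n)]
            c • zeroExt Ω f :=
          zeroExt_eventuallyEq (fun q => by simp [zeroExt_apply]) p
        rw [← Subalgebra.coe_smul, this.fderiv_eq, fderiv_const_smul
          (smoothAlg_differentiableAt f p)]
        simp }
    fun f g => smoothAlg_ext fun p => by
      simp only [LinearMap.coe_mk, AddHom.coe_mk, evalAt_apply, smoothAlg.ofFun_apply,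
        Subalgebra.coe_add, Pi.add_apply, smul_eq_mul, Subalgebra.coe_mul, Pi.mul_apply]
      have : zeroExt Ω (f * g : smoothAlg Ω) =ᶠ[𝓝 (p : Coord n × Coord n)]
          zeroExt Ω f * zeroExt Ω g :=
        zeroExt_eventuallyEq (fun q => by simp [zeroExt_apply]) p
      rw [← Subalgebra.coe_mul, this.fderiv_eq, fderiv_mul (smoothAlg_differentiableAt f p)
        (smoothAlg_differentiableAt g p)]
      simp [zeroExt_apply]

theorem dirDeriv_apply (v : Coord n × Coord n) (f : smoothAlg Ω) (p : Ω) :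
    evalAt p (dirDeriv v f) = fderiv ℝ (zeroExt Ω f) p v := rfl

theorem dirDeriv_comm (v w : Coord n × Coord n) (f : smoothAlg Ω) :
    dirDeriv v (dirDeriv w f) = dirDeriv w (dirDeriv v f) := by
  refine smoothAlg_ext fun p => ?_
  have hd : DifferentiableAt ℝ (fderiv ℝ (zeroExt Ω f)) p :=
    ((smoothAlg_contDiffAt f p).fderiv_right (m := ∞) (by simp)).differentiableAt
      (by simp)
  have e : ∀ v w : Coord n × Coord n, evalAt p (dirDeriv v (dirDeriv w f)) =
      fderiv ℝ (fderiv ℝ (zeroExt Ω f)) p v w := by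
    intro v w
    rw [dirDeriv_apply]
    have : zeroExt Ω (dirDeriv w f : smoothAlg Ω) =ᶠ[𝓝 (p : Coord n × Coord n)]
        fun q => fderiv ℝ (zeroExt Ω f) q w :=
      zeroExt_eventuallyEq (fun q => rfl) p
    rw [this.fderiv_eq, fderiv_clm_apply hd (differentiableAt_const w)]
    simp
  rw [e, e]
  exact ((smoothAlg_contDiffAt f p).isSymmSndFDerivAt
    (by simpa using WithTop.coe_le_coe.mpr (le_top : (2 : ℕ∞) ≤ ⊤))) v w

variable (Ω) in
/-- The coordinate derivations and fibre coordinates on `smoothAlg Ω`. -/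
def smoothSlit : SlitCalculus n (smoothAlg Ω) where
  dx i := dirDeriv (EuclideanSpace.single i 1, 0)
  dy i := dirDeriv (0, EuclideanSpace.single i 1)
  y i := smoothAlg.ofFun (fun p => p.2 i) (by fun_prop)
  dx_dx _ _ _ := dirDeriv_comm _ _ _
  dy_dy _ _ _ := dirDeriv_comm _ _ _
  dy_dx _ _ _ := dirDeriv_comm _ _ _
  dx_y i j := smoothAlg_ext fun p => by
    rw [dirDeriv_apply, (zeroExt_eventuallyEq (h := fun p => p.2 j) (fun q => rfl) p).fderiv_eq]
    have : (fun p : Coord n × Coord n => p.2 j) =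
      (EuclideanSpace.proj j : Coord n →L[ℝ] ℝ).comp (ContinuousLinearMap.snd ℝ _ _) := rfl
    rw [this, ContinuousLinearMap.fderiv]
    simp
  dy_y i j := smoothAlg_ext fun p => by
    rw [dirDeriv_apply, (zeroExt_eventuallyEq (h := fun p => p.2 j) (fun q => rfl) p).fderiv_eq]
    have : (fun p : Coord n × Coord n => p.2 j) =
      (EuclideanSpace.proj j : Coord n →L[ℝ] ℝ).comp (ContinuousLinearMap.snd ℝ _ _) := rfl
    rw [this, ContinuousLinearMap.fderiv]
    rcases eq_or_ne i j with rfl | h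
    · simp
    · simp [h, h.symm]

/-- `f` restricts to the element `a` of `smoothAlg Ω`. -/
def Represents (a : smoothAlg Ω) (f : Coord n → Coord n → ℝ) : Prop :=
  ∀ p : Ω, f p.1.1 p.1.2 = evalAt p a

namespace Represents

variable {a b : smoothAlg Ω} {f h : Coord n → Coord n → ℝ}

theorem add (ha : Represents a f) (hb : Represents b h) :
    Represents (a + b) (fun x y => f x y + h x y) := fun p => by
  simp only [map_add, ha p, hb p]

theorem sub (ha : Represents a f) (hb : Represents b h) :
    Represents (a - b) (fun x y => f x y - h x y) := fun p => by
  simp only [map_sub, ha p, hb p]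

theorem mul (ha : Represents a f) (hb : Represents b h) :
    Represents (a * b) (fun x y => f x y * h x y) := fun p => by
  simp only [map_mul, ha p, hb p]

theorem sum {ι : Type*} {s : Finset ι} {a : ι → smoothAlg Ω} {f : ι → Coord n → Coord n → ℝ}
    (ha : ∀ i, Represents (a i) (f i)) :
    Represents (∑ i ∈ s, a i) (fun x y => ∑ i ∈ s, f i x y) := fun p => by
  simp only [map_sum, ha _ p]

theorem const (c : ℝ) : Represents (algebraMap ℝ (smoothAlg Ω) c) (fun _ _ => c) := fun p => by
  simp

theorem two : Represents (2 : smoothAlg Ω) (fun _ _ => 2) := fun p =>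
  (map_ofNat (evalAt p) 2).symm

theorem half_half : Represents (half (smoothAlg Ω)) (fun _ _ => 1 / 2) := const _

theorem coord (j : Fin n) : Represents ((smoothSlit Ω).y j) (fun _ y => y j) := fun _ => rfl

theorem eventuallyEq (ha : Represents a f) (p : Ω) :
    (fun q : Coord n × Coord n => f q.1 q.2) =ᶠ[𝓝 (p : Coord n × Coord n)] zeroExt Ω a :=
  (zeroExt_eventuallyEq (h := fun q => f q.1 q.2) ha p).symm

theorem hasFDerivAt (ha : Represents a f) (p : Ω) :
    HasFDerivAt (fun q : Coord n × Coord n => f q.1 q.2) (fderiv ℝ (zeroExt Ω a) p) p :=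
  (smoothAlg_differentiableAt a p).hasFDerivAt.congr_of_eventuallyEq (ha.eventuallyEq p)

/-- `Ω` is open and `f` agrees there with a jointly smooth function, so the partial derivative is
the total derivative in a coordinate direction, whatever `f` is outside `Ω`. -/
theorem dX (ha : Represents a f) (i : Fin n) : Represents ((smoothSlit Ω).dx i a) (dX i f) := by
  intro p
  have h1 : HasFDerivAt (fun x : Coord n => (x, p.1.2)) (ContinuousLinearMap.inl ℝ _ _) p.1.1 :=
    hasFDerivAt_prodMk_left _ _
  have h2 := HasFDerivAt.comp (p.1.1 : Coord n) (ha.hasFDerivAt p) h1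
  have h3 : fderiv ℝ (fun x' => f x' p.1.2) p.1.1 = _ := h2.fderiv
  rw [Finsler.dX, h3]
  rfl

theorem dY (ha : Represents a f) (i : Fin n) : Represents ((smoothSlit Ω).dy i a) (dY i f) := by
  intro p
  have h1 : HasFDerivAt (fun y : Coord n => (p.1.1, y)) (ContinuousLinearMap.inr ℝ _ _) p.1.2 :=
    hasFDerivAt_prodMk_right _ _
  have h2 := HasFDerivAt.comp (p.1.2 : Coord n) (ha.hasFDerivAt p) h1
  have h3 : fderiv ℝ (fun y' => f p.1.1 y') p.1.2 = _ := h2.fderiv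
  rw [Finsler.dY, h3]
  rfl

end Represents

/-! ### The tensors of a Finsler function as elements of the algebra of smooth functions -/

/-- `S` is the calculus of the Finsler function `F` over the open set `Ω`. -/
structure IsCalculusOf (S : FinslerCalculus n (smoothAlg Ω)) (F : Coord n → Coord n → ℝ) :
    Prop where
  toSlit : S.toSlitCalculus = smoothSlit Ω
  energy : Represents S.energy (sqF F)

namespace IsCalculusOf

variable {F : Coord n → Coord n → ℝ} {S : FinslerCalculus n (smoothAlg Ω)} (hS : IsCalculusOf S F)
  {a : smoothAlg Ω} {f : Coord n → Coord n → ℝ}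

include hS

theorem dX (ha : Represents a f) (i : Fin n) : Represents (S.dx i a) (dX i f) := by
  rw [hS.toSlit]; exact ha.dX i

theorem dY (ha : Represents a f) (i : Fin n) : Represents (S.dy i a) (dY i f) := by
  rw [hS.toSlit]; exact ha.dY i

theorem y (j : Fin n) : Represents (S.y j) (fun _ y => y j) := by
  rw [hS.toSlit]; exact .coord j

theorem g (i j : Fin n) : Represents (S.g i j) (g F i j) :=
  .mul .half_half (hS.dY (hS.dY hS.energy j) i)

theorem cartan (i j k : Fin n) : Represents (S.cartan i j k) (cartan F i j k) := by
  have := (Represents.mul .half_half (.mul .half_half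
    (hS.dY (hS.dY (hS.dY hS.energy k) j) i)))
  intro p
  rw [FinslerCalculus.cartan, ← this p, Finsler.cartan]
  ring

/-- The abstract inverse evaluates to a left inverse of the real matrix `g`, hence to the matrix
inverse. -/
theorem gInv (i j : Fin n) : Represents (S.gInv i j) (gInv F i j) := by
  intro p
  have h : (Matrix.of fun i j => evalAt p (S.gInv i j)) *
      (Matrix.of fun k l : Fin n => Finsler.g F k l p.1.1 p.1.2) = 1 := by
    ext i j
    have := congrArg (evalAt p) (S.gInv_g i j)
    simp only [map_sum, map_mul, ← hS.g _ _ p] at this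
    rw [Matrix.mul_apply, Matrix.one_apply]
    simp only [Matrix.of_apply, this]
    split_ifs <;> simp
  rw [Finsler.gInv, Matrix.inv_eq_left_inv h, Matrix.of_apply]

theorem cartanUp (i j k : Fin n) : Represents (S.cartanUp i j k) (cartanUp F i j k) :=
  .sum fun l => (hS.gInv i l).mul (hS.cartan l j k)

theorem meanCartan (i : Fin n) : Represents (S.meanCartan i) (meanCartan F i) :=
  .sum fun j => .sum fun k => (hS.gInv j k).mul (hS.cartan j k i)

theorem meanCartanUp (k : Fin n) : Represents (S.meanCartanUp k) (meanCartanUp F k) :=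
  .sum fun i => (hS.gInv k i).mul (hS.meanCartan i)

theorem spray (i : Fin n) : Represents (S.spray i) (spray F i) := by
  have := Represents.mul .half_half (.mul .half_half (.sum (s := univ) fun l => (hS.gInv i l).mul
    (.sub (.sum (s := univ) fun k => (hS.dX (hS.dY hS.energy l) k).mul (hS.y k)) (hS.dX hS.energy l))))
  intro p
  rw [FinslerCalculus.spray, ← this p, Finsler.spray]
  ring

theorem nonlin (i j : Fin n) : Represents (S.nonlin i j) (nonlin F i j) := hS.dY (hS.spray i) j

theorem riemann (i k : Fin n) : Represents (S.riemann i k) (riemann F i k) :=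
  .sub (.add (.sub (.mul .two (hS.dX (hS.spray i) k))
    (.sum fun j => (hS.y j).mul (hS.dX (hS.nonlin i k) j)))
    (.mul .two (.sum fun j => (hS.spray j).mul (hS.dY (hS.nonlin i k) j))))
    (.sum fun j => (hS.nonlin i j).mul (hS.nonlin j k))

theorem dH (ha : Represents a f) (i : Fin n) : Represents (S.dH i a) (dH F i f) := by
  rw [S.dH_apply]
  exact .sub (hS.dX ha i) (.sum fun j => (hS.nonlin j i).mul (hS.dY ha j))

theorem gammaH (i j k : Fin n) : Represents (S.gammaH i j k) (gammaH F i j k) :=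
  .mul .half_half (.sum fun l => (hS.gInv i l).mul
    (.sub (.add (hS.dH (hS.g l k) j) (hS.dH (hS.g j l) k)) (hS.dH (hS.g j k) l)))

theorem nonlinCurv (i j k : Fin n) : Represents (S.nonlinCurv i j k) (nonlinCurv F i j k) :=
  .sub (hS.dH (hS.nonlin i j) k) (hS.dH (hS.nonlin i k) j)

theorem hhCurv (h i j k : Fin n) : Represents (S.hhCurv h i j k) (hhCurv F h i j k) :=
  .add (.sub (.add (.sub (hS.dH (hS.gammaH i h j) k) (hS.dH (hS.gammaH i h k) j))
    (.sum fun m => (hS.gammaH m h j).mul (hS.gammaH i m k)))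
    (.sum fun m => (hS.gammaH m h k).mul (hS.gammaH i m j)))
    (.sum fun m => (hS.cartanUp i h m).mul (hS.nonlinCurv m j k))

theorem hhCurvLow (h i j k : Fin n) : Represents (S.hhCurvLow h i j k) (hhCurvLow F h i j k) :=
  .sum fun m => (hS.g i m).mul (hS.hhCurv h m j k)

theorem curv3 (i j k : Fin n) : Represents (S.curv3 i j k) (curv3 F i j k) :=
  .sum fun h => (hS.y h).mul (hS.hhCurvLow h i j k)

theorem curv2 (i k : Fin n) : Represents (S.curv2 i k) (curv2 F i k) :=
  .sum fun j => (hS.curv3 i j k).mul (hS.y j)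

theorem ricci (i j : Fin n) : Represents (S.ricci i j) (ricci F i j) :=
  .sum fun r => .sum fun m => (hS.gInv r m).mul (hS.hhCurvLow i m j r)

theorem ricciZero (k : Fin n) : Represents (S.ricciZero k) (ricciZero F k) :=
  .sum fun j => (hS.ricci j k).mul (hS.y j)

theorem frakR {w : Fin n → smoothAlg Ω}
    (hw : ∀ i, Represents (w i) fun x y => (F x y)⁻¹ * Finsler.dY i F x y) (i j : Fin n) :
    Represents (S.frakR (algebraMap ℝ _ (1 / ((n : ℝ) + 1))) w i j) (frakR F i j) :=
  .sub (hS.ricci i j) (.mul (.const _)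
    (.add (.add (.add
      (.sum fun k => (hS.meanCartanUp k).mul (hS.curv3 i j k))
      (.sum fun k => (hS.meanCartanUp k).mul (hS.curv3 k j i)))
      (.mul (hw i) (.sum fun k => (hS.meanCartanUp k).mul (hS.curv2 k j))))
      (.mul (hS.meanCartan i) (hS.ricciZero j))))

/-- For `R^i_k = k(F² δ^i_k - y^i y_k)`, both `C^r_{il} R^l_r` and `I_l R^l_i` equal `k F² I_i`, and
the trace of `R` is `(n-1) k F²`. What is left is `-(2 + (n-1))/(n+1)` times `k F² I_i`. The
curvature `k` is just a number at the point `p`; no regularity in `p` enters. -/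
theorem frakR_sub {w : Fin n → smoothAlg Ω}
    (hw : ∀ i, Represents (w i) fun x y => (F x y)⁻¹ * Finsler.dY i F x y)
    (hw1 : ∑ i, w i * S.y i = 1) (i : Fin n) (p : Ω) (k : ℝ)
    (hk : ∀ i j, evalAt p (S.riemann i j) =
      k * ((if i = j then evalAt p S.energy else 0) - evalAt p (S.y i) * evalAt p (S.yLow j))) :
    frakRRightZero F i p.1.1 p.1.2 - frakRLeftZero F i p.1.1 p.1.2 =
      - (k * evalAt p S.energy * evalAt p (S.meanCartan i)) := by
  have h := congrArg (evalAt p) (S.frakR_sub (algebraMap ℝ _ (1 / ((n : ℝ) + 1))) w hw1 i)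
  have r1 : Represents (∑ j, S.frakR (algebraMap ℝ _ (1 / ((n : ℝ) + 1))) w i j * S.y j)
    (frakRRightZero F i) := .sum fun j => (hS.frakR hw i j).mul (hS.y j)
  have r2 : Represents (∑ j, S.frakR (algebraMap ℝ _ (1 / ((n : ℝ) + 1))) w j i * S.y j)
    (frakRLeftZero F i) := .sum fun j => (hS.frakR hw j i).mul (hS.y j)
  rw [map_sub, ← r1 p, ← r2 p] at h
  rw [h]
  have c1 : ∑ l, ∑ r, evalAt p (S.cartanUp r i l) * evalAt p (S.riemann l r) =
      k * evalAt p S.energy * evalAt p (S.meanCartan i) := by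
    have z : ∀ r, ∑ l, evalAt p (S.cartanUp r i l) * evalAt p (S.y l) = 0 := fun r => by
      have := congrArg (evalAt p) (S.sum_y_mul_cartanUp r i)
      simp only [map_sum, map_mul, map_zero] at this
      rw [← this]
      exact sum_congr rfl fun l _ => by rw [S.cartanUp_symm]; ring
    have t : ∑ l, evalAt p (S.cartanUp l i l) = evalAt p (S.meanCartan i) := by
      rw [← map_sum]
      congr 1
      simp only [FinslerCalculus.cartanUp, FinslerCalculus.meanCartan]
      exact sum_congr rfl fun a _ => sum_congr rfl fun b _ => by
        rw [S.cartan_swap', S.cartan_swap b a i]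
    have e : ∀ l r, evalAt p (S.cartanUp r i l) * evalAt p (S.riemann l r) =
        k * (if l = r then evalAt p S.energy * evalAt p (S.cartanUp r i l) else 0) -
          k * evalAt p (S.yLow r) * (evalAt p (S.cartanUp r i l) * evalAt p (S.y l)) := by
      intro l r
      rw [hk]
      split_ifs <;> ring
    simp only [e, sum_sub_distrib]
    rw [sum_comm (f := fun l r =>
      k * evalAt p (S.yLow r) * (evalAt p (S.cartanUp r i l) * evalAt p (S.y l)))]
    simp only [← mul_sum, z, sum_ite_eq, mem_univ, if_true, t]
    simp [mul_assoc]
  have c2 : ∑ l, evalAt p (S.meanCartan l) * evalAt p (S.riemann l i) =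
      k * evalAt p S.energy * evalAt p (S.meanCartan i) := by
    have z := congrArg (evalAt p) S.sum_y_mul_meanCartan
    simp only [map_sum, map_mul, map_zero] at z
    have e : ∀ l, evalAt p (S.meanCartan l) * evalAt p (S.riemann l i) =
        (if l = i then k * evalAt p S.energy * evalAt p (S.meanCartan l) else 0) -
          k * evalAt p (S.yLow i) * (evalAt p (S.y l) * evalAt p (S.meanCartan l)) := by
      intro l
      rw [hk]
      split_ifs <;> ring
    simp only [e, sum_sub_distrib, ← mul_sum, z, sum_ite_eq', mem_univ, if_true]
    ring
  have c3 : ∑ m, evalAt p (S.riemann m m) = k * ((n : ℝ) - 1) * evalAt p S.energy := by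
    have z := congrArg (evalAt p) S.sum_y_mul_yLow
    simp only [map_sum, map_mul] at z
    simp only [hk, if_true, ← mul_sum, sum_sub_distrib, z]
    simp; ring
  have hn : ((n : ℝ) + 1) ≠ 0 := by positivity
  simp only [map_sub, map_add, map_mul, map_sum, c1, c2, c3, AlgHom.commutes, map_ofNat]
  simp only [Algebra.algebraMap_self, RingHom.id_apply]
  field_simp
  ring

end IsCalculusOf

end Finsler

end

/-! ### Randers metrics: the mean Cartan tensor and nondegeneracy of `g`. -/

noncomputable section

namespace Finsler

open Finset TopologicalSpace

/-! ### Randers metrics, algebraically -/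

/-- A `SlitCalculus` with a quadratic form `a`, a linear form `b`, and invertible functions
`α = √a(y, y)` and `F = α + b(y)`. -/
structure RandersCalculus (n : ℕ) (A : Type*) [CommRing A] [Algebra ℝ A] extends
    SlitCalculus n A where
  /-- The quadratic form. -/
  a : Fin n → Fin n → A
  /-- The linear form. -/
  b : Fin n → A
  /-- `α` -/
  alpha : A
  /-- `α⁻¹` -/
  alphaInv : A
  /-- `F⁻¹` -/
  finslerInv : A
  a_symm : ∀ i j, a i j = a j i
  dy_a : ∀ i j k, dy k (a i j) = 0
  dy_b : ∀ i k, dy k (b i) = 0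
  alpha_sq : alpha * alpha = ∑ i, ∑ j, a i j * (y i * y j)
  alpha_mul_alphaInv : alpha * alphaInv = 1
  finsler_mul_finslerInv : (alpha + ∑ i, b i * y i) * finslerInv = 1

namespace RandersCalculus

variable {n : ℕ} {A : Type*} [CommRing A] [Algebra ℝ A] (R : RandersCalculus n A)

/-- `F = α + β`. -/
def finsler : A := R.alpha + ∑ i, R.b i * R.y i

theorem alpha_cancel {u v : A} (h : R.alpha * u = R.alpha * v) : u = v := by
  linear_combination R.alphaInv * h + (v - u) * R.alpha_mul_alphaInv

theorem finsler_cancel {u v : A} (h : R.finsler * u = R.finsler * v) : u = v := by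
  have := R.finsler_mul_finslerInv
  rw [← finsler] at this
  linear_combination R.finslerInv * h + (v - u) * this

theorem alpha_mul_dy_alpha (k : Fin n) : R.alpha * R.dy k R.alpha = ∑ j, R.a k j * R.y j := by
  have h := congrArg (R.dy k) R.alpha_sq
  simp only [map_sum, Derivation.leibniz, smul_eq_mul, R.dy_a, R.dy_y, mul_zero, add_zero,
    mul_ite, mul_one, mul_add, sum_add_distrib] at h
  have e1 : ∑ i, ∑ j, (if k = j then R.a i j * R.y i else 0) = ∑ j, R.a k j * R.y j := by
    refine sum_congr rfl fun i _ => ?_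
    rw [sum_ite_eq, if_pos (mem_univ _), R.a_symm]
  have e2 : ∑ i, ∑ j, (if k = i then R.a i j * R.y j else 0) = ∑ j, R.a k j * R.y j := by
    rw [sum_comm]
    exact sum_congr rfl fun i _ => by rw [sum_ite_eq, if_pos (mem_univ _)]
  rw [e1, e2] at h
  apply two_cancel
  linear_combination h

theorem alpha_mul_dy_dy_alpha (j k : Fin n) :
    R.alpha * R.dy j (R.dy k R.alpha) = R.a j k - R.dy j R.alpha * R.dy k R.alpha := by
  have h := congrArg (R.dy j) (R.alpha_mul_dy_alpha k)
  simp only [map_sum, Derivation.leibniz, smul_eq_mul, R.dy_a, R.dy_y, mul_zero, add_zero,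
    mul_ite, mul_one, sum_ite_eq, mem_univ, if_true] at h
  rw [R.a_symm]
  linear_combination h

theorem alpha_mul_dy_dy_dy_alpha (i j k : Fin n) :
    R.alpha * R.dy i (R.dy j (R.dy k R.alpha)) = - (R.dy i R.alpha * R.dy j (R.dy k R.alpha)
      + R.dy j R.alpha * R.dy i (R.dy k R.alpha) + R.dy k R.alpha * R.dy i (R.dy j R.alpha)) := by
  have h := congrArg (R.dy i) (R.alpha_mul_dy_dy_alpha j k)
  simp only [map_sub, Derivation.leibniz, smul_eq_mul, R.dy_a] at h
  linear_combination h

theorem dy_finsler (i : Fin n) : R.dy i R.finsler = R.dy i R.alpha + R.b i := by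
  simp [finsler, Derivation.leibniz, R.dy_b, R.dy_y]

theorem dy_dy_finsler (i j : Fin n) : R.dy i (R.dy j R.finsler) = R.dy i (R.dy j R.alpha) := by
  rw [dy_finsler, map_add, R.dy_b, add_zero]

theorem sum_y_mul_dy_alpha : ∑ k, R.y k * R.dy k R.alpha = R.alpha := by
  apply R.alpha_cancel
  rw [R.alpha_sq, mul_sum]
  refine sum_congr rfl fun k _ => ?_
  rw [mul_left_comm, alpha_mul_dy_alpha, mul_sum]
  exact sum_congr rfl fun _ _ => by ring

theorem sum_y_mul_dy_finsler : ∑ k, R.y k * R.dy k R.finsler = R.finsler := by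
  simp only [dy_finsler, mul_add, sum_add_distrib, sum_y_mul_dy_alpha]
  simp only [finsler, mul_comm]

theorem half_dy_dy_finsler_sq (i j : Fin n) :
    half A * R.dy i (R.dy j (R.finsler ^ 2)) =
      R.dy i R.finsler * R.dy j R.finsler + R.finsler * R.dy i (R.dy j R.alpha) := by
  rw [pow_two, Derivation.leibniz, map_add, smul_eq_mul, Derivation.leibniz, smul_eq_mul,
    smul_eq_mul, dy_dy_finsler]
  linear_combination (R.dy i R.finsler * R.dy j R.finsler +
    R.finsler * R.dy i (R.dy j R.alpha)) * two_mul_half (A := A)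

/-- The Finsler calculus of a Randers metric, given an inverse of its fundamental tensor. -/
def toFinsler (gInv : Fin n → Fin n → A) (h : ∀ i j, ∑ k, gInv i k *
    (half A * R.dy k (R.dy j (R.finsler ^ 2))) = if i = j then 1 else 0) :
    FinslerCalculus n A where
  toSlitCalculus := R.toSlitCalculus
  energy := R.finsler ^ 2
  gInv := gInv
  euler := by
    simp only [pow_two, Derivation.leibniz, smul_eq_mul, mul_add, sum_add_distrib,
      mul_left_comm (R.y _), ← mul_sum, sum_y_mul_dy_finsler]
    ring
  gInv_mul := h

section ToFinsler

variable (gInv : Fin n → Fin n → A) (h : ∀ i j, ∑ k, gInv i k *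
  (half A * R.dy k (R.dy j (R.finsler ^ 2))) = if i = j then 1 else 0)

theorem toFinsler_g (i j : Fin n) : (R.toFinsler gInv h).g i j =
    R.dy i R.finsler * R.dy j R.finsler + R.finsler * R.dy i (R.dy j R.alpha) :=
  R.half_dy_dy_finsler_sq i j

theorem toFinsler_yLow (i : Fin n) :
    (R.toFinsler gInv h).yLow i = R.finsler * R.dy i R.finsler := by
  change half A * R.dy i (R.finsler ^ 2) = _
  rw [pow_two, Derivation.leibniz, smul_eq_mul]
  linear_combination (R.finsler * R.dy i R.finsler) * two_mul_half (A := A)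

/-- C-reducibility of Randers metrics: the Cartan tensor is a symmetrised product of the Hessian of
`α` with a covector. It results from differentiating `g`, the third derivative of `α` being
eliminated by `alpha_mul_dy_dy_dy_alpha`. -/
theorem toFinsler_cartan (i j k : Fin n) : 2 * R.alpha * (R.toFinsler gInv h).cartan i j k =
    R.dy i (R.dy j R.alpha) * (R.alpha * R.dy k R.finsler - R.finsler * R.dy k R.alpha)
    + R.dy i (R.dy k R.alpha) * (R.alpha * R.dy j R.finsler - R.finsler * R.dy j R.alpha)
    + R.dy j (R.dy k R.alpha) * (R.alpha * R.dy i R.finsler - R.finsler * R.dy i R.alpha) := by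
  have e : 2 * (R.toFinsler gInv h).cartan i j k = R.dy i ((R.toFinsler gInv h).g j k) :=
    (R.toFinsler gInv h).cartan_eq i j k
  rw [toFinsler_g, map_add, Derivation.leibniz, Derivation.leibniz, smul_eq_mul, smul_eq_mul,
    smul_eq_mul, smul_eq_mul, dy_dy_finsler, dy_dy_finsler] at e
  linear_combination R.alpha * e + R.finsler * R.alpha_mul_dy_dy_dy_alpha i j k

/-- The trace of `toFinsler_cartan`, using `F α_{ij} = g_{ij} - ℓ_i ℓ_j`. Since `ℓ` has unit length
and is orthogonal to the covector `σ`, the three products contribute `(n-1) + 1 + 1`. -/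
theorem toFinsler_meanCartan (k : Fin n) :
    2 * R.alpha * R.finsler * (R.toFinsler gInv h).meanCartan k =
      ((n : A) + 1) * (R.alpha * R.dy k R.finsler - R.finsler * R.dy k R.alpha) := by
  set S := R.toFinsler gInv h with hS
  set σ : Fin n → A := fun k => R.alpha * R.dy k R.finsler - R.finsler * R.dy k R.alpha with hσ
  have f1 : ∀ i, R.finsler * ∑ j, S.gInv i j * R.dy j R.finsler = R.y i := fun i => by
    have := S.gInv_contract S.y i
    simp only [S.sum_g_mul_y] at this
    simp only [hS, toFinsler_yLow] at this
    rw [mul_sum]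
    refine Eq.trans (sum_congr rfl fun j _ => ?_) this
    ring
  have f2 : ∑ i, (∑ j, S.gInv i j * R.dy j R.finsler) * R.dy i R.finsler = 1 := by
    apply R.finsler_cancel
    rw [mul_sum, mul_one]
    refine Eq.trans (sum_congr rfl fun i _ => ?_) R.sum_y_mul_dy_finsler
    rw [← mul_assoc, f1]
  have f3 : ∑ i, (∑ j, S.gInv i j * R.dy j R.finsler) * σ i = 0 := by
    apply R.finsler_cancel
    have e : ∀ i, R.finsler * ((∑ j, S.gInv i j * R.dy j R.finsler) * σ i) =
        R.alpha * (R.y i * R.dy i R.finsler) - R.finsler * (R.y i * R.dy i R.alpha) := fun i => by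
      rw [← mul_assoc, f1]; ring
    rw [mul_sum, sum_congr rfl fun i _ => e i, sum_sub_distrib, ← mul_sum, ← mul_sum,
      sum_y_mul_dy_finsler, sum_y_mul_dy_alpha]
    ring
  have hh : ∀ i j, R.finsler * R.dy i (R.dy j R.alpha) =
      S.g i j - R.dy i R.finsler * R.dy j R.finsler := fun i j => by
    rw [hS, toFinsler_g]; ring
  have key : ∀ i j, 2 * R.alpha * R.finsler * (S.gInv i j * S.cartan i j k) =
      (S.gInv i j * S.g j i) * σ k - (S.gInv i j * R.dy j R.finsler) * R.dy i R.finsler * σ k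
      + (S.gInv j i * S.g i k) * σ j - (S.gInv j i * R.dy i R.finsler) * σ j * R.dy k R.finsler
      + (S.gInv i j * S.g j k) * σ i - (S.gInv i j * R.dy j R.finsler) * σ i * R.dy k R.finsler := by
    intro i j
    have hc : 2 * R.alpha * S.cartan i j k = R.dy i (R.dy j R.alpha) * σ k +
      R.dy i (R.dy k R.alpha) * σ j + R.dy j (R.dy k R.alpha) * σ i :=
      R.toFinsler_cartan gInv h i j k
    have h1 := hh i j
    have h2 := hh i k
    have h3 := hh j k
    rw [S.gInv_symm j i, S.g_symm j i]
    linear_combination R.finsler * S.gInv i j * hc + S.gInv i j * σ k * h1 +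
      S.gInv i j * σ j * h2 + S.gInv i j * σ i * h3
  have t1 : ∀ k, ∑ i, (∑ j, S.gInv i j * S.g j k) * σ i = σ k := fun k => by
    simp [S.gInv_g]
  change _ = _ * σ k
  rw [FinslerCalculus.meanCartan, mul_sum]
  simp only [mul_sum (s := univ) (a := 2 * R.alpha * R.finsler), key, sum_add_distrib,
    sum_sub_distrib]
  have s1 : ∑ i, ∑ j, S.gInv i j * S.g j i * σ k = n * σ k := by
    simp only [← sum_mul, S.gInv_g, if_true]
    simp
  have s2 : ∑ i, ∑ j, S.gInv i j * R.dy j R.finsler * R.dy i R.finsler * σ k = σ k := by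
    simp only [← sum_mul, f2, one_mul]
  have s3 : ∑ i, ∑ j, S.gInv i j * S.g j k * σ i = σ k := by
    simp only [← sum_mul, t1]
  have s4 : ∑ i, ∑ j, S.gInv j i * S.g i k * σ j = σ k := by
    rw [sum_comm, s3]
  have s5 : ∑ i, ∑ j, S.gInv i j * R.dy j R.finsler * σ i * R.dy k R.finsler = 0 := by
    simp only [← sum_mul, f3, zero_mul]
  have s6 : ∑ i, ∑ j, S.gInv j i * R.dy i R.finsler * σ j * R.dy k R.finsler = 0 := by
    rw [sum_comm, s5]
  rw [s1, s2, s3, s4, s5, s6]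
  ring

end ToFinsler

end RandersCalculus

/-! ### Bilinear forms in coordinates -/

section Bilin

variable {n : ℕ}

/-- The bilinear form with matrix `M`. -/
def bilin (M : Fin n → Fin n → ℝ) (u v : Coord n) : ℝ := ∑ i, ∑ j, M i j * (u i * v j)

theorem bilin_symm {M : Fin n → Fin n → ℝ} (hM : ∀ i j, M i j = M j i) (u v : Coord n) :
    bilin M u v = bilin M v u := by
  rw [bilin, bilin, sum_comm]
  exact sum_congr rfl fun i _ => sum_congr rfl fun j _ => by rw [hM j i]; ring

theorem bilin_sub_left (M : Fin n → Fin n → ℝ) (c d : ℝ) (u v w : Coord n) :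
    bilin M (c • u - d • v) w = c * bilin M u w - d * bilin M v w := by
  simp only [bilin, mul_sum, ← sum_sub_distrib, PiLp.sub_apply, PiLp.smul_apply, smul_eq_mul]
  exact sum_congr rfl fun i _ => sum_congr rfl fun j _ => by ring

/-- The Gram determinant as the square of the component of `u` orthogonal to `y`, giving the strict
Cauchy–Schwarz inequality for a definite form. -/
theorem bilin_lagrange {M : Fin n → Fin n → ℝ} (hM : ∀ i j, M i j = M j i) (y u : Coord n) :
    bilin M (bilin M y y • u - bilin M y u • y) (bilin M y y • u - bilin M y u • y) =
      bilin M y y * (bilin M y y * bilin M u u - bilin M y u ^ 2) := by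
  rw [bilin_sub_left, bilin_symm hM u, bilin_symm hM y (_ - _), bilin_sub_left, bilin_sub_left,
    bilin_symm hM u y]
  ring

theorem bilin_single (M : Fin n → Fin n → ℝ) (i j : Fin n) :
    bilin M (EuclideanSpace.single i 1) (EuclideanSpace.single j 1) = M i j := by
  simp [bilin]

theorem bilin_eq_zero {M : Fin n → Fin n → ℝ} (hM : ∀ i j, M i j = M j i)
    (h : ∀ u, bilin M u u = 0) (i j : Fin n) : M i j = 0 := by
  have h1 := h ((1 : ℝ) • EuclideanSpace.single i 1 - (1 : ℝ) • EuclideanSpace.single j 1)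
  rw [bilin_sub_left, bilin_symm hM _ (_ - _), bilin_symm hM _ (_ - _), bilin_sub_left,
    bilin_sub_left, h, h, bilin_single, bilin_single, hM j i] at h1
  linarith

end Bilin

/-! ### Randers metrics on an open subset of `ℝⁿ` -/

/-- A Randers metric on an open subset of `ℝⁿ`. -/
structure LocalRanders (n : ℕ) where
  /-- The domain. -/
  dom : Opens (Coord n)
  /-- The components of the Riemannian metric. -/
  a : Fin n → Fin n → Coord n → ℝ
  /-- The components of the 1-form. -/
  b : Fin n → Coord n → ℝ
  contDiffOn_a : ∀ i j, ContDiffOn ℝ ∞ (a i j) dom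
  contDiffOn_b : ∀ i, ContDiffOn ℝ ∞ (b i) dom
  a_symm : ∀ i j x, x ∈ dom → a i j x = a j i x
  abs_lt : ∀ x ∈ dom, ∀ y : Coord n, y ≠ 0 →
    |∑ i, b i x * y i| < √(∑ i, ∑ j, a i j x * (y i * y j))

namespace LocalRanders

variable {n : ℕ} (R : LocalRanders n)

/-- The slit tangent bundle of the domain. -/
def slit : Opens (Coord n × Coord n) := ⟨R.dom ×ˢ {0}ᶜ, R.dom.isOpen.prod isOpen_compl_singleton⟩

/-- The function `a(y, y)`. -/
def quad (x y : Coord n) : ℝ := ∑ i, ∑ j, R.a i j x * (y i * y j)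

/-- The Finsler function. -/
def finsler (x y : Coord n) : ℝ := √(R.quad x y) + ∑ i, R.b i x * y i

variable {R}

theorem quad_pos {x y : Coord n} (hx : x ∈ R.dom) (hy : y ≠ 0) : 0 < R.quad x y :=
  Real.sqrt_pos.mp ((abs_nonneg _).trans_lt (R.abs_lt x hx y hy))

theorem finsler_pos {x y : Coord n} (hx : x ∈ R.dom) (hy : y ≠ 0) : 0 < R.finsler x y := by
  have := (_root_.abs_lt.mp (R.abs_lt x hx y hy)).1
  unfold finsler quad
  linarith

variable (R)

theorem contDiffOn_fst_comp {f : Coord n → ℝ} (hf : ContDiffOn ℝ ∞ f R.dom) :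
    ContDiffOn ℝ ∞ (fun p : Coord n × Coord n => f p.1) R.slit :=
  hf.comp contDiffOn_fst fun _ hp => hp.1

theorem contDiffOn_coord (i : Fin n) :
    ContDiffOn ℝ ∞ (fun p : Coord n × Coord n => p.2 i) R.slit := by
  fun_prop

theorem contDiffOn_quad : ContDiffOn ℝ ∞ (fun p : Coord n × Coord n => R.quad p.1 p.2) R.slit :=
  .sum fun i _ => .sum fun j _ => (R.contDiffOn_fst_comp (R.contDiffOn_a i j)).mul
    ((R.contDiffOn_coord i).mul (R.contDiffOn_coord j))

theorem contDiffOn_alpha :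
    ContDiffOn ℝ ∞ (fun p : Coord n × Coord n => √(R.quad p.1 p.2)) R.slit :=
  R.contDiffOn_quad.sqrt fun _ hp => (quad_pos hp.1 hp.2).ne'

theorem contDiffOn_finsler :
    ContDiffOn ℝ ∞ (fun p : Coord n × Coord n => R.finsler p.1 p.2) R.slit :=
  R.contDiffOn_alpha.add (.sum fun i _ => (R.contDiffOn_fst_comp (R.contDiffOn_b i)).mul
    (R.contDiffOn_coord i))

/-- A function of position as an element of the algebra of smooth functions. -/
def lift {f : Coord n → ℝ} (hf : ContDiffOn ℝ ∞ f R.dom) : smoothAlg R.slit :=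
  smoothAlg.ofFun _ (R.contDiffOn_fst_comp hf)

theorem represents_lift {f : Coord n → ℝ} (hf : ContDiffOn ℝ ∞ f R.dom) :
    Represents (R.lift hf) (fun x _ => f x) := fun _ => rfl

theorem dy_lift {f : Coord n → ℝ} (hf : ContDiffOn ℝ ∞ f R.dom) (k : Fin n) :
    (smoothSlit R.slit).dy k (R.lift hf) = 0 := by
  refine smoothAlg_ext fun p => ?_
  rw [← (R.represents_lift hf).dY k p, dY]
  simp

/-- The Randers calculus of a local Randers metric. -/
def toCalculus : RandersCalculus n (smoothAlg R.slit) where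
  toSlitCalculus := smoothSlit R.slit
  a i j := R.lift (R.contDiffOn_a i j)
  b i := R.lift (R.contDiffOn_b i)
  alpha := smoothAlg.ofFun _ R.contDiffOn_alpha
  alphaInv := smoothAlg.ofFun _ (R.contDiffOn_alpha.inv fun _ hp =>
    (Real.sqrt_pos.mpr (quad_pos hp.1 hp.2)).ne')
  finslerInv := smoothAlg.ofFun _ (R.contDiffOn_finsler.inv fun _ hp =>
    (finsler_pos hp.1 hp.2).ne')
  a_symm i j := smoothAlg_ext fun p => R.a_symm i j _ p.2.1
  dy_a _ _ _ := R.dy_lift _ _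
  dy_b _ _ := R.dy_lift _ _
  alpha_sq := smoothAlg_ext fun p => by
    simp only [map_sum, map_mul]
    exact Real.mul_self_sqrt (quad_pos p.2.1 p.2.2).le
  alpha_mul_alphaInv := smoothAlg_ext fun p => by
    rw [map_mul, map_one]
    exact mul_inv_cancel₀ (Real.sqrt_pos.mpr (quad_pos p.2.1 p.2.2)).ne'
  finsler_mul_finslerInv := smoothAlg_ext fun p => by
    simp only [map_add, map_sum, map_mul, map_one]
    exact mul_inv_cancel₀ (finsler_pos p.2.1 p.2.2).ne'

theorem represents_finsler : Represents R.toCalculus.finsler R.finsler := fun p => by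
  simp only [RandersCalculus.finsler, map_add, map_sum, map_mul]
  rfl

theorem evalAt_alpha_pos (p : R.slit) : 0 < evalAt p R.toCalculus.alpha :=
  Real.sqrt_pos.mpr (quad_pos p.2.1 p.2.2)

theorem evalAt_finsler_pos (p : R.slit) : 0 < evalAt p R.toCalculus.finsler := by
  rw [← R.represents_finsler p]
  exact finsler_pos p.2.1 p.2.2

/-- The bilinear form `a_x(u, v)`. -/
def form (x u v : Coord n) : ℝ := bilin (fun i j => R.a i j x) u v

theorem form_symm {x : Coord n} (hx : x ∈ R.dom) (u v : Coord n) :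
    R.form x u v = R.form x v u :=
  bilin_symm (fun i j => R.a_symm i j x hx) u v

/-- The fundamental tensor in terms of `α` and `F`, before inverting it. -/
def gPre (i j : Fin n) : smoothAlg R.slit :=
  half _ * R.toCalculus.dy i (R.toCalculus.dy j (R.toCalculus.finsler ^ 2))

theorem gPre_form (p : R.slit) (u : Coord n) :
    evalAt p R.toCalculus.alpha ^ 3 * ∑ i, ∑ j, evalAt p (R.gPre i j) * (u i * u j) =
      evalAt p R.toCalculus.alpha ^ 3 *
        (∑ i, evalAt p (R.toCalculus.dy i R.toCalculus.finsler) * u i) ^ 2 +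
      evalAt p R.toCalculus.finsler * (R.form p.1.1 p.1.2 p.1.2 * R.form p.1.1 u u -
        R.form p.1.1 p.1.2 u ^ 2) := by
  set α := evalAt p R.toCalculus.alpha
  set F := evalAt p R.toCalculus.finsler
  have h1 : ∑ i, (α * evalAt p (R.toCalculus.dy i R.toCalculus.alpha)) * u i =
      R.form p.1.1 p.1.2 u := by
    rw [R.form_symm p.2.1, form, bilin]
    refine sum_congr rfl fun i _ => ?_
    have := congrArg (evalAt p) (R.toCalculus.alpha_mul_dy_alpha i)
    rw [map_mul] at this
    rw [this]
    simp only [map_sum, map_mul, sum_mul]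
    refine sum_congr rfl fun j _ => ?_
    change R.a i j p.1.1 * p.1.2 j * u i = _
    ring
  have h2 : α ^ 2 = R.form p.1.1 p.1.2 p.1.2 := Real.sq_sqrt (quad_pos p.2.1 p.2.2).le
  have h3 : ∀ i j, α ^ 3 * (evalAt p (R.gPre i j) * (u i * u j)) =
      α ^ 3 * ((evalAt p (R.toCalculus.dy i R.toCalculus.finsler) * u i) *
        (evalAt p (R.toCalculus.dy j R.toCalculus.finsler) * u j)) + F * (α ^ 2 *
        (R.a i j p.1.1 * (u i * u j))) -
        F * (((α * evalAt p (R.toCalculus.dy i R.toCalculus.alpha)) * u i) *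
          ((α * evalAt p (R.toCalculus.dy j R.toCalculus.alpha)) * u j)) := by
    intro i j
    have e1 := congrArg (evalAt p) (R.toCalculus.half_dy_dy_finsler_sq i j)
    have e2 := congrArg (evalAt p) (R.toCalculus.alpha_mul_dy_dy_alpha i j)
    change evalAt p (R.gPre i j) = _ at e1
    simp only [map_add, map_mul, map_sub] at e1 e2
    change _ = R.a i j p.1.1 - _ at e2
    rw [e1]
    linear_combination F * α ^ 2 * u i * u j * e2
  simp only [mul_sum, h3, sum_add_distrib, sum_sub_distrib]
  simp only [← mul_sum, ← sum_mul, h1, h2]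
  rw [← bilin, ← form]
  ring

/-- In `gPre_form` both terms are nonnegative. The Cauchy–Schwarz term is positive unless `u` is a
multiple of `y`, and then the square is positive because Euler's identity gives `ℓ(y) = F > 0`. -/
theorem gPre_pos (p : R.slit) {u : Coord n} (hu : u ≠ 0) :
    0 < ∑ i, ∑ j, evalAt p (R.gPre i j) * (u i * u j) := by
  have hα := R.evalAt_alpha_pos p
  have hF := R.evalAt_finsler_pos p
  have hq : 0 < R.form p.1.1 p.1.2 p.1.2 := quad_pos p.2.1 p.2.2
  refine pos_of_mul_pos_right (a := evalAt p R.toCalculus.alpha ^ 3) ?_ (by positivity)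
  rw [gPre_form]
  set c := R.form p.1.1 p.1.2 u
  set d := R.form p.1.1 p.1.2 p.1.2
  have hw : R.form p.1.1 (d • u - c • p.1.2) (d • u - c • p.1.2) =
      d * (d * R.form p.1.1 u u - c ^ 2) :=
    bilin_lagrange (fun i j => R.a_symm i j _ p.2.1) p.1.2 u
  rcases eq_or_ne (d • u - c • p.1.2) 0 with h0 | h0
  · have hz : d * R.form p.1.1 u u - c ^ 2 = 0 := by
      rw [h0] at hw
      have : R.form p.1.1 0 0 = 0 := by simp [form, bilin]
      rw [this] at hw
      exact (mul_eq_zero.mp hw.symm).resolve_left hq.ne'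
    rw [hz, mul_zero, add_zero]
    have hu' : ∀ i, d * u i = c * p.1.2 i := fun i => by
      have := congrArg (fun v : Coord n => v i) h0
      simpa [sub_eq_zero] using this
    have hc : c ≠ 0 := by
      intro hc
      apply hu
      ext i
      have := hu' i
      rw [hc, zero_mul] at this
      exact (mul_eq_zero.mp this).resolve_left hq.ne'
    have he : d * ∑ i, evalAt p (R.toCalculus.dy i R.toCalculus.finsler) * u i =
        c * evalAt p R.toCalculus.finsler := by
      have := congrArg (evalAt p) R.toCalculus.sum_y_mul_dy_finsler
      simp only [map_sum, map_mul] at this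
      rw [← this, mul_sum, mul_sum]
      refine sum_congr rfl fun i _ => ?_
      change _ = c * (p.1.2 i * _)
      linear_combination evalAt p (R.toCalculus.dy i R.toCalculus.finsler) * hu' i
    have hne : ∑ i, evalAt p (R.toCalculus.dy i R.toCalculus.finsler) * u i ≠ 0 := by
      intro h
      rw [h, mul_zero] at he
      exact mul_ne_zero hc hF.ne' he.symm
    positivity
  · have hpos : 0 < d * (d * R.form p.1.1 u u - c ^ 2) := by
      rw [← hw]; exact quad_pos p.2.1 h0
    have := (pos_iff_pos_of_mul_pos hpos).mp hq
    positivity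

/-- Positive definiteness makes the determinant nowhere zero, so `g` is invertible over the ring of
smooth functions and not merely pointwise. -/
theorem gPre_det_isUnit : IsUnit (Matrix.of R.gPre).det := by
  refine smoothAlg_isUnit _ fun p h => ?_
  rw [AlgHom.map_det] at h
  obtain ⟨v, hv, hv0⟩ := Matrix.exists_mulVec_eq_zero_iff.mpr h
  have hu : (WithLp.toLp 2 v : Coord n) ≠ 0 := by simpa using hv
  refine (R.gPre_pos p hu).ne' ?_
  refine sum_eq_zero fun i _ => ?_
  have := congrFun hv0 i
  simp only [Matrix.mulVec, dotProduct, AlgHom.mapMatrix_apply, Matrix.map_apply, Matrix.of_apply,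
    Pi.zero_apply] at this
  rw [← zero_mul (v i), ← mul_zero (1 : ℝ), ← this, one_mul, sum_mul]
  exact sum_congr rfl fun j _ => by ring

theorem gPre_inv_mul (i j : Fin n) : ∑ k, (Matrix.of R.gPre)⁻¹ i k * R.gPre k j =
    if i = j then 1 else 0 := by
  have := congrArg (fun B : Matrix _ _ _ => B i j) (Matrix.nonsing_inv_mul _ R.gPre_det_isUnit)
  simpa [Matrix.mul_apply, Matrix.one_apply] using this

/-- The Finsler calculus of a local Randers metric. -/
def calculus : FinslerCalculus n (smoothAlg R.slit) :=
  R.toCalculus.toFinsler (fun i j => (Matrix.of R.gPre)⁻¹ i j) R.gPre_inv_mul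

theorem isCalculusOf : IsCalculusOf R.calculus R.finsler where
  toSlit := rfl
  energy := fun p => by
    change _ = evalAt p (R.toCalculus.finsler ^ 2)
    rw [map_pow, ← R.represents_finsler p, sqF]

end LocalRanders

end Finsler

end

/-! ### Geodesics and propagation of the mean Cartan tensor. -/

noncomputable section

namespace Finsler

open Finset TopologicalSpace

variable {n : ℕ} {Ω : Opens (Coord n × Coord n)}

/-! ### Geodesics -/

theorem evalAt_eq_zeroExt (p : Ω) (f : smoothAlg Ω) : evalAt p f = zeroExt Ω f p :=
  (zeroExt_apply _ p).symm

theorem coord_eq_sum (v : Coord n) : v = ∑ i, v i • EuclideanSpace.single i (1 : ℝ) := by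
  ext j
  simp [Finset.sum_apply, Pi.single_apply]

/-- The geodesic vector field `(y, -2G)`. -/
def geodesicField (S : FinslerCalculus n (smoothAlg Ω)) (q : Coord n × Coord n) :
    Coord n × Coord n :=
  (q.2, WithLp.toLp 2 fun i => -(2 * zeroExt Ω (S.spray i) q))

theorem fderiv_geodesicField {S : FinslerCalculus n (smoothAlg Ω)}
    (hS : S.toSlitCalculus = smoothSlit Ω) (f : smoothAlg Ω) (p : Ω) :
    fderiv ℝ (zeroExt Ω f) p (geodesicField S p) = evalAt p (S.flow f) := by
  have e : geodesicField S p =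
      ∑ i, p.1.2 i • ((EuclideanSpace.single i (1 : ℝ) : Coord n), (0 : Coord n)) +
      ∑ i, (-(2 * zeroExt Ω (S.spray i) p)) •
        ((0 : Coord n), (EuclideanSpace.single i (1 : ℝ) : Coord n)) := by
    apply Prod.ext
    · simp only [Prod.fst_add, Prod.fst_sum, Prod.smul_fst, smul_zero, sum_const_zero, add_zero]
      exact coord_eq_sum _
    · simp only [Prod.snd_add, Prod.snd_sum, Prod.smul_snd, smul_zero, sum_const_zero, zero_add]
      exact coord_eq_sum _
  rw [e, S.flow_apply, hS]
  simp only [map_add, map_sum, map_smul, map_sub, map_mul, smul_eq_mul, ← evalAt_eq_zeroExt,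
    map_ofNat, neg_mul, sum_neg_distrib, ← sub_eq_add_neg]
  rfl

theorem hasDerivAt_along_geodesic {S : FinslerCalculus n (smoothAlg Ω)}
    (hS : S.toSlitCalculus = smoothSlit Ω) (f : smoothAlg Ω) {c : ℝ → Coord n × Coord n} {s : ℝ}
    (hc : HasDerivAt c (geodesicField S (c s)) s) (hs : c s ∈ Ω) :
    HasDerivAt (fun t => zeroExt Ω f (c t)) (zeroExt Ω (S.flow f) (c s)) s := by
  have h1 : HasFDerivAt (zeroExt Ω f) (fderiv ℝ (zeroExt Ω f) (c s)) (c s) :=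
    (smoothAlg_differentiableAt f ⟨c s, hs⟩).hasFDerivAt
  have h2 := h1.comp_hasDerivAt s hc
  have h3 := fderiv_geodesicField hS f ⟨c s, hs⟩
  rw [evalAt_eq_zeroExt] at h3
  rwa [h3] at h2

theorem contDiffAt_geodesicField (S : FinslerCalculus n (smoothAlg Ω)) (p : Ω) :
    ContDiffAt ℝ 1 (geodesicField S) p := by
  refine ContDiffAt.prodMk contDiffAt_snd ?_
  rw [contDiffAt_piLp]
  intro i
  exact ((contDiffAt_const.mul ((smoothAlg_contDiffAt (S.spray i) p).of_le (by simp))).neg)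

theorem continuousOn_zeroExt_comp (f : smoothAlg Ω) {c : ℝ → Coord n × Coord n} {s : Set ℝ}
    (hc : ContinuousOn c s) (hs : Set.MapsTo c s Ω) : ContinuousOn (fun t => zeroExt Ω f (c t)) s :=
  (smoothAlg_contDiffOn f).continuousOn.comp hc hs

/-- The mean Cartan tensor satisfies `∇₀∇₀I = 0` at `q`, written in coordinates. -/
def MeanCartanParallel (S : FinslerCalculus n (smoothAlg Ω)) (q : Coord n × Coord n) : Prop :=
  ∀ i, zeroExt Ω (S.flow (S.flow (S.meanCartan i))) q =
    ∑ m, zeroExt Ω (2 * (S.flow (S.nonlin m i) - S.dx i (S.spray m)) : smoothAlg Ω) q *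
        zeroExt Ω (S.meanCartan m) q +
      ∑ m, zeroExt Ω (2 * S.nonlin m i : smoothAlg Ω) q * zeroExt Ω (S.flow (S.meanCartan m)) q

/-- Only fibre derivatives of `R` need to vanish: the undifferentiated curvature is hidden in the
coefficient formed from the spray derivatives of `N` and the `x`-derivatives of `G`. -/
theorem meanCartanParallel_of_riemann {S : FinslerCalculus n (smoothAlg Ω)} (p : Ω)
    (h : ∀ i j k, evalAt p (S.dy i (S.riemann j k)) = 0) : MeanCartanParallel S p := by
  intro i
  have := congrArg (evalAt p) (S.three_mul_flow_flow_meanCartan i)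
  simp only [map_add, map_sub, map_neg, map_mul, map_sum, h, map_ofNat, sum_const_zero, mul_zero,
    add_zero, neg_zero, zero_sub] at this
  simp only [← evalAt_eq_zeroExt, map_mul, map_sub, map_ofNat, mul_sub, sub_mul, sum_sub_distrib,
    mul_assoc, ← mul_sum]
  linear_combination this / 3

/-- Uniqueness for a linear second order system along a geodesic: Grönwall's inequality for the pair
formed by `I` and its derivative, with coefficients bounded on the compact time interval. -/
theorem meanCartan_eq_zero_of_parallel {S : FinslerCalculus n (smoothAlg Ω)}
    (hS : S.toSlitCalculus = smoothSlit Ω) {c : ℝ → Coord n × Coord n} {s₀ s₁ : ℝ}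
    (hs : s₀ ≤ s₁)
    (hc : ∀ s ∈ Set.Icc s₀ s₁, HasDerivAt c (geodesicField S (c s)) s)
    (hΩ : ∀ s ∈ Set.Icc s₀ s₁, c s ∈ Ω)
    (hp : ∀ s ∈ Set.Icc s₀ s₁, MeanCartanParallel S (c s))
    (h0 : ∀ i, zeroExt Ω (S.meanCartan i) (c s₀) = 0)
    (h1 : ∀ i, zeroExt Ω (S.flow (S.meanCartan i)) (c s₀) = 0) (i : Fin n) :
    zeroExt Ω (S.meanCartan i) (c s₁) = 0 := by
  have hcc : ContinuousOn c (Set.Icc s₀ s₁) := fun s hs' =>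
    (hc s hs').continuousAt.continuousWithinAt
  have bound : ∀ A : Fin n → Fin n → smoothAlg Ω, ∃ K : ℝ, 0 ≤ K ∧ ∀ s ∈ Set.Icc s₀ s₁, ∀ i m,
      |zeroExt Ω (A i m) (c s)| ≤ K := by
    intro A
    have hcont : ContinuousOn (fun s => fun i m => zeroExt Ω (A i m) (c s)) (Set.Icc s₀ s₁) :=
      continuousOn_pi.mpr fun i => continuousOn_pi.mpr fun m =>
        continuousOn_zeroExt_comp (A i m) hcc hΩ
    obtain ⟨K, hK⟩ := isCompact_Icc.exists_bound_of_continuousOn hcont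
    refine ⟨K, (norm_nonneg _).trans (hK s₀ ⟨le_rfl, hs⟩), fun s hs' i m => ?_⟩
    exact ((norm_le_pi_norm (fun m => zeroExt Ω (A i m) (c s)) m).trans
      (norm_le_pi_norm (fun i m => zeroExt Ω (A i m) (c s)) i)).trans (hK s hs')
  obtain ⟨K₁, hK₁, hA⟩ := bound fun i m => 2 * (S.flow (S.nonlin m i) - S.dx i (S.spray m))
  obtain ⟨K₂, hK₂, hB⟩ := bound fun i m => 2 * S.nonlin m i
  set f : ℝ → (Fin n → ℝ) × (Fin n → ℝ) := fun s =>
    (fun i => zeroExt Ω (S.meanCartan i) (c s),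
      fun i => zeroExt Ω (S.flow (S.meanCartan i)) (c s)) with hf
  set f' : ℝ → (Fin n → ℝ) × (Fin n → ℝ) := fun s =>
    (fun i => zeroExt Ω (S.flow (S.meanCartan i)) (c s),
      fun i => zeroExt Ω (S.flow (S.flow (S.meanCartan i))) (c s)) with hf'
  have hd : ∀ s ∈ Set.Icc s₀ s₁, HasDerivAt f (f' s) s := fun s hs' =>
    (hasDerivAt_pi.mpr fun i => hasDerivAt_along_geodesic hS _ (hc s hs') (hΩ s hs')).prodMk
      (hasDerivAt_pi.mpr fun i => hasDerivAt_along_geodesic hS _ (hc s hs') (hΩ s hs'))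
  -- In the sup norm the first component of `f'` is bounded by `‖f‖` and the second by `n (K₁ + K₂)
  -- ‖f‖`; the constant dominates both.
  have h := eq_zero_of_abs_deriv_le_mul_abs_self_of_eq_zero_right (f := f) (f' := f')
    (K := 1 + n * (K₁ + K₂)) (a := s₀) (b := s₁)
    (fun s hs' => (hd s hs').continuousAt.continuousWithinAt)
    (fun s hs' => (hd s ⟨hs'.1, hs'.2.le⟩).hasDerivWithinAt)
    (by rw [hf]; simp only [h0, h1]; rfl) ?_ s₁ ⟨hs, le_rfl⟩
  · exact congrFun (congrArg Prod.fst h) i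
  · intro s hs'
    have hs'' : s ∈ Set.Icc s₀ s₁ := ⟨hs'.1, hs'.2.le⟩
    have hI : ∀ m, |zeroExt Ω (S.meanCartan m) (c s)| ≤ ‖f s‖ := fun m =>
      (norm_le_pi_norm (f s).1 m).trans (norm_fst_le _)
    have hJ : ∀ m, |zeroExt Ω (S.flow (S.meanCartan m)) (c s)| ≤ ‖f s‖ := fun m =>
      (norm_le_pi_norm (f s).2 m).trans (norm_snd_le _)
    have hn : 0 ≤ (n : ℝ) * (K₁ + K₂) := by positivity
    have hle : ‖f s‖ ≤ (1 + n * (K₁ + K₂)) * ‖f s‖ := by nlinarith [norm_nonneg (f s)]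
    refine norm_prod_le_iff.mpr ⟨(norm_snd_le (f s)).trans hle, ?_⟩
    refine (pi_norm_le_iff_of_nonneg (by positivity)).mpr fun i => ?_
    change |zeroExt Ω (S.flow (S.flow (S.meanCartan i))) (c s)| ≤ _
    rw [hp s hs'' i]
    have hsum : ∀ (A u : Fin n → ℝ) (K : ℝ), 0 ≤ K → (∀ m, |A m| ≤ K) → (∀ m, |u m| ≤ ‖f s‖) →
        |∑ m, A m * u m| ≤ n * K * ‖f s‖ := by
      intro A u K hK hA hu
      refine (abs_sum_le_sum_abs _ _).trans ((sum_le_card_nsmul _ _ (K * ‖f s‖) fun m _ => ?_).trans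
        (by simp [mul_assoc]))
      rw [abs_mul]
      exact mul_le_mul (hA m) (hu m) (abs_nonneg _) hK
    refine (abs_add_le _ _).trans ?_
    have g1 := hsum _ _ K₁ hK₁ (hA s hs'' i) hI
    have g2 := hsum _ _ K₂ hK₂ (hB s hs'' i) hJ
    nlinarith [norm_nonneg (f s)]

/-- The local geodesic flow. -/
theorem exists_geodesicFlow (S : FinslerCalculus n (smoothAlg Ω)) (p : Ω) :
    ∃ r > (0 : ℝ), ∃ ε > (0 : ℝ), ∃ Φ : (Coord n × Coord n) × ℝ → Coord n × Coord n,
      (∀ q ∈ Metric.closedBall (p : Coord n × Coord n) r, Φ (q, 0) = q ∧ ∀ t ∈ Set.Ioo (-ε) ε,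
        HasDerivAt (fun t => Φ (q, t)) (geodesicField S (Φ (q, t))) t) ∧
      ContinuousOn Φ (Metric.closedBall (p : Coord n × Coord n) r ×ˢ Set.Ioo (-ε) ε) := by
  obtain ⟨ε, hε, a, r, _, _, hr, hpl⟩ :=
    IsPicardLindelof.of_contDiffAt_one (contDiffAt_geodesicField S p)
  obtain ⟨Φ, h1, h2⟩ := (hpl 0).exists_forall_mem_closedBall_eq_hasDerivWithinAt_continuousOn
  have e : Set.Ioo (-ε) ε ⊆ Set.Icc (0 - ε) (0 + ε) := fun t ht =>
    ⟨by linarith [ht.1], by linarith [ht.2]⟩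
  refine ⟨r, hr, ε, hε, Φ, fun q hq => ⟨(h1 q hq).1, fun t ht => ?_⟩,
    h2.mono (Set.prod_mono subset_rfl e)⟩
  exact ((h1 q hq).2 t (e ht)).hasDerivAt
    (Icc_mem_nhds (by linarith [ht.1]) (by linarith [ht.2]))

end Finsler

end

/-! ### Scalar flag curvature, and the directions in which `I` vanishes. -/

noncomputable section

namespace Finsler

open Finset TopologicalSpace

namespace LocalRanders

variable {n : ℕ} (R : LocalRanders n)

/-! ### Scalar flag curvature -/

theorem calculus_y (p : R.slit) (i : Fin n) : evalAt p (R.calculus.y i) = p.1.2 i := rfl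

theorem evalAt_energy_pos (p : R.slit) : 0 < evalAt p R.calculus.energy := by
  change 0 < evalAt p (R.toCalculus.finsler ^ 2)
  rw [map_pow]
  exact pow_pos (R.evalAt_finsler_pos p) 2

theorem evalAt_g_symm (p : R.slit) (i j : Fin n) :
    evalAt p (R.calculus.g i j) = evalAt p (R.calculus.g j i) := by
  rw [R.calculus.g_symm]

theorem bilin_g_pos (p : R.slit) {u : Coord n} (hu : u ≠ 0) :
    0 < bilin (fun i j => evalAt p (R.calculus.g i j)) u u :=
  R.gPre_pos p hu

theorem bilin_g_y (p : R.slit) (u : Coord n) :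
    bilin (fun i j => evalAt p (R.calculus.g i j)) p.1.2 u =
      ∑ j, evalAt p (R.calculus.yLow j) * u j := by
  rw [bilin_symm (R.evalAt_g_symm p), bilin]
  refine sum_congr rfl fun i _ => ?_
  rw [← R.calculus.sum_g_mul_y]
  simp only [map_sum, map_mul, sum_mul, calculus_y]
  exact sum_congr rfl fun j _ => by ring

theorem bilin_g_y_y (p : R.slit) :
    bilin (fun i j => evalAt p (R.calculus.g i j)) p.1.2 p.1.2 = evalAt p R.calculus.energy := by
  rw [bilin_g_y, ← R.calculus.sum_y_mul_yLow]
  simp only [map_sum, map_mul, calculus_y]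
  exact sum_congr rfl fun j _ => by ring

theorem gForm_eq (p : R.slit) (u v : Coord n) :
    gForm R.finsler p.1.1 p.1.2 u v = bilin (fun i j => evalAt p (R.calculus.g i j)) u v := by
  simp only [gForm, bilin, ← R.isCalculusOf.g _ _ p, mul_assoc]

theorem gForm_riemannApply (p : R.slit) (u : Coord n) :
    gForm R.finsler p.1.1 p.1.2 u (riemannApply R.finsler p.1.1 p.1.2 u) =
      bilin (fun i j => evalAt p (R.calculus.curv2 i j)) u u := by
  rw [gForm_eq]
  simp only [bilin, riemannApply, R.isCalculusOf.riemann _ _ p, R.calculus.curv2_eq, map_sum,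
    map_mul, mul_sum, sum_mul]
  refine sum_congr rfl fun i _ => ?_
  rw [sum_comm]
  exact sum_congr rfl fun _ _ => sum_congr rfl fun _ _ => by ring

theorem gram_pos (p : R.slit) {u : Coord n} (hu : LinearIndependent ℝ ![p.1.2, u]) :
    0 < bilin (fun i j => evalAt p (R.calculus.g i j)) p.1.2 p.1.2 *
      bilin (fun i j => evalAt p (R.calculus.g i j)) u u -
      bilin (fun i j => evalAt p (R.calculus.g i j)) p.1.2 u ^ 2 := by
  have hy := R.bilin_g_pos p p.2.2
  have hw := bilin_lagrange (R.evalAt_g_symm p) p.1.2 u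
  have hne : bilin (fun i j => evalAt p (R.calculus.g i j)) p.1.2 p.1.2 • u -
      bilin (fun i j => evalAt p (R.calculus.g i j)) p.1.2 u • p.1.2 ≠ 0 := by
    intro h
    have := LinearIndependent.pair_iff.mp hu
      (-bilin (fun i j => evalAt p (R.calculus.g i j)) p.1.2 u)
      (bilin (fun i j => evalAt p (R.calculus.g i j)) p.1.2 p.1.2)
      (by rw [← h, neg_smul]; abel)
    exact hy.ne' this.2
  have := R.bilin_g_pos p hne
  rw [hw] at this
  exact (pos_iff_pos_of_mul_pos this).mp hy

theorem flagCurvature_eq_zero (p : R.slit) (h : ∀ i j, evalAt p (R.calculus.riemann i j) = 0)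
    (u : Coord n) : flagCurvature R.finsler p.1.1 p.1.2 u = 0 := by
  rw [flagCurvature, gForm_riemannApply]
  simp [R.calculus.curv2_eq, h, bilin]

/-- The flag curvature sees only the quadratic form of `R_{ik} = g_{im} R^m_k`. As `R_{ik}` is
symmetric by `curv2_symm`, polarisation recovers it entirely, and raising an index gives the claim.
-/
theorem riemann_of_flagCurvature (p : R.slit) (κ : ℝ)
    (h : ∀ u, LinearIndependent ℝ ![p.1.2, u] → flagCurvature R.finsler p.1.1 p.1.2 u = κ)
    (i j : Fin n) : evalAt p (R.calculus.riemann i j) =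
      κ * ((if i = j then evalAt p R.calculus.energy else 0) -
        evalAt p (R.calculus.y i) * evalAt p (R.calculus.yLow j)) := by
  set E := evalAt p R.calculus.energy
  set Q : Fin n → Fin n → ℝ := fun i j => evalAt p (R.calculus.curv2 i j) -
    κ * (E * evalAt p (R.calculus.g i j) -
      evalAt p (R.calculus.yLow i) * evalAt p (R.calculus.yLow j)) with hQ
  have hQs : ∀ i j, Q i j = Q j i := fun i j => by
    simp only [hQ]
    rw [R.calculus.curv2_symm, R.calculus.g_symm]; ring
  have hQb : ∀ u, bilin Q u u = bilin (fun i j => evalAt p (R.calculus.curv2 i j)) u u -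
      κ * (bilin (fun i j => evalAt p (R.calculus.g i j)) p.1.2 p.1.2 *
        bilin (fun i j => evalAt p (R.calculus.g i j)) u u -
        bilin (fun i j => evalAt p (R.calculus.g i j)) p.1.2 u ^ 2) := by
    intro u
    rw [bilin_g_y_y, bilin_g_y, pow_two, sum_mul_sum]
    simp only [bilin, mul_sum, ← sum_sub_distrib, hQ]
    exact sum_congr rfl fun _ _ => sum_congr rfl fun _ _ => by ring
  have hQ0 : ∀ u, bilin Q u u = 0 := by
    intro u
    rw [hQb]
    by_cases hu : LinearIndependent ℝ ![p.1.2, u]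
    · have := h u hu
      rw [flagCurvature, gForm_riemannApply, gForm_eq, gForm_eq, gForm_eq,
        div_eq_iff (R.gram_pos p hu).ne'] at this
      rw [this]; ring
    -- On multiples of `y` there is no flag; there both quadratic forms vanish, by `R_{ij} y^j = 0`
    -- and by the degenerate Gram determinant.
    · obtain ⟨c, rfl⟩ : ∃ c : ℝ, u = c • p.1.2 := by
        rw [LinearIndependent.pair_iff' p.2.2] at hu
        push Not at hu
        obtain ⟨c, hc⟩ := hu
        exact ⟨c, hc.symm⟩
      have h1 : bilin (fun i j => evalAt p (R.calculus.curv2 i j)) (c • p.1.2) (c • p.1.2) = 0 := by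
        refine sum_eq_zero fun i _ => ?_
        have := congrArg (evalAt p) (R.calculus.sum_curv2_mul_y i)
        simp only [map_sum, map_mul, map_zero, calculus_y] at this
        rw [← mul_zero (c ^ 2 * p.1.2 i), ← this, mul_sum]
        refine sum_congr rfl fun j _ => ?_
        simp only [PiLp.smul_apply, smul_eq_mul]
        ring
      have h2 : ∀ u v : Coord n, bilin (fun i j => evalAt p (R.calculus.g i j)) u (c • v) =
          c * bilin (fun i j => evalAt p (R.calculus.g i j)) u v := fun u v => by
        simp only [bilin, mul_sum, PiLp.smul_apply, smul_eq_mul]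
        exact sum_congr rfl fun _ _ => sum_congr rfl fun _ _ => by ring
      rw [h1, h2, h2, bilin_symm (R.evalAt_g_symm p) (c • _), h2]
      ring
  have hz := bilin_eq_zero hQs hQ0
  have key : ∀ l, ∑ k, evalAt p (R.calculus.g l k) * evalAt p (R.calculus.riemann k j) =
      κ * (E * evalAt p (R.calculus.g l j) -
        evalAt p (R.calculus.yLow l) * evalAt p (R.calculus.yLow j)) := fun l => by
    have h1 := hz l j
    simp only [hQ, R.calculus.curv2_eq, map_sum, map_mul] at h1
    linear_combination h1
  have c1 := congrArg (evalAt p) (R.calculus.gInv_contract (fun k => R.calculus.riemann k j) i)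
  have c2 := congrArg (evalAt p) (R.calculus.gInv_g i j)
  have c3 := congrArg (evalAt p) (R.calculus.gInv_contract R.calculus.y i)
  simp only [R.calculus.sum_g_mul_y] at c3
  simp only [map_sum, map_mul, key] at c1 c2 c3
  rw [← c1]
  have e : ∀ l, evalAt p (R.calculus.gInv i l) * (κ * (E * evalAt p (R.calculus.g l j) -
      evalAt p (R.calculus.yLow l) * evalAt p (R.calculus.yLow j))) =
      κ * (E * (evalAt p (R.calculus.gInv i l) * evalAt p (R.calculus.g l j))) -
      κ * (evalAt p (R.calculus.gInv i l) * evalAt p (R.calculus.yLow l) *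
        evalAt p (R.calculus.yLow j)) := fun l => by ring
  rw [sum_congr rfl fun l _ => e l, sum_sub_distrib, ← mul_sum, ← mul_sum, ← mul_sum, ← sum_mul,
    c2, c3]
  split_ifs <;> simp [mul_sub]

theorem frakR_sub (p : R.slit) (κ : ℝ) (hκ : ∀ i j, evalAt p (R.calculus.riemann i j) =
      κ * ((if i = j then evalAt p R.calculus.energy else 0) -
        evalAt p (R.calculus.y i) * evalAt p (R.calculus.yLow j))) (i : Fin n) :
    frakRRightZero R.finsler i p.1.1 p.1.2 - frakRLeftZero R.finsler i p.1.1 p.1.2 =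
      - (κ * evalAt p R.calculus.energy * evalAt p (R.calculus.meanCartan i)) := by
  refine R.isCalculusOf.frakR_sub
    (w := fun i => R.toCalculus.finslerInv * R.toCalculus.dy i R.toCalculus.finsler)
    (fun i => ?_) ?_ i p κ hκ
  · have h1 : Represents R.toCalculus.finslerInv fun x y => (R.finsler x y)⁻¹ := fun _ => rfl
    exact h1.mul (R.represents_finsler.dY i)
  · have := R.toCalculus.sum_y_mul_dy_finsler
    have h2 := R.toCalculus.finsler_mul_finslerInv
    rw [← RandersCalculus.finsler, ← this, sum_mul] at h2
    rw [← h2]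
    refine sum_congr rfl fun i _ => ?_
    change _ * R.toCalculus.y i = _
    ring

/-! ### The mean Cartan tensor of a Randers metric -/

theorem meanCartan_eq (p : R.slit) (k : Fin n) :
    2 * R.quad p.1.1 p.1.2 * R.finsler p.1.1 p.1.2 * evalAt p (R.calculus.meanCartan k) =
      (n + 1) * (R.quad p.1.1 p.1.2 * R.b k p.1.1 -
        (∑ i, R.b i p.1.1 * p.1.2 i) * ∑ j, R.a k j p.1.1 * p.1.2 j) := by
  have h := congrArg (evalAt p) (R.toCalculus.toFinsler_meanCartan _ R.gPre_inv_mul k)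
  have ha := congrArg (evalAt p) (R.toCalculus.alpha_mul_dy_alpha k)
  have hf := congrArg (evalAt p) (R.toCalculus.dy_finsler k)
  simp only [map_mul, map_sub, map_add, map_sum, map_ofNat, map_natCast, map_one] at h ha hf
  have hq : evalAt p R.toCalculus.alpha ^ 2 = R.quad p.1.1 p.1.2 :=
    Real.sq_sqrt (quad_pos p.2.1 p.2.2).le
  have hF : evalAt p R.toCalculus.finsler =
      evalAt p R.toCalculus.alpha + ∑ i, R.b i p.1.1 * p.1.2 i := by
    rw [RandersCalculus.finsler, map_add, map_sum]
    simp only [map_mul]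
    rfl
  have hb : evalAt p (R.toCalculus.b k) = R.b k p.1.1 := rfl
  have ha' : ∑ j, evalAt p (R.toCalculus.a k j) * evalAt p (R.toCalculus.y j) =
    ∑ j, R.a k j p.1.1 * p.1.2 j := rfl
  rw [ha'] at ha
  rw [hb] at hf
  change _ * _ * _ * evalAt p (R.calculus.meanCartan k) = _ at h
  rw [R.represents_finsler p, ← hq, ← ha]
  rw [hf] at h
  have hF' : ∑ i, R.b i p.1.1 * p.1.2 i = evalAt p R.toCalculus.finsler -
    evalAt p R.toCalculus.alpha := by rw [hF]; ring
  rw [hF']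
  linear_combination evalAt p R.toCalculus.alpha * h

theorem meanCartan_eq_zero (p : R.slit) (h : ∀ i, R.b i p.1.1 = 0) (k : Fin n) :
    evalAt p (R.calculus.meanCartan k) = 0 := by
  have := R.meanCartan_eq p k
  simp only [h, zero_mul, sum_const_zero, mul_zero, sub_zero] at this
  have h1 := quad_pos p.2.1 p.2.2
  have h2 := finsler_pos p.2.1 p.2.2
  exact (mul_eq_zero.mp this).resolve_left (by positivity)

/-- Lowering the index with `a_x`. -/
def lower (x : Coord n) : Coord n →ₗ[ℝ] (Fin n → ℝ) :=
  (Matrix.mulVecLin (Matrix.of fun i j => R.a i j x)) ∘ₗ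
    (WithLp.linearEquiv 2 ℝ (Fin n → ℝ)).toLinearMap

theorem lower_apply (x y : Coord n) (k : Fin n) : R.lower x y k = ∑ j, R.a k j x * y j := rfl

theorem lower_injective {x : Coord n} (hx : x ∈ R.dom) : Function.Injective (R.lower x) := by
  refine (injective_iff_map_eq_zero _).mpr fun y hy => ?_
  by_contra h
  refine (quad_pos hx h).ne' (sum_eq_zero fun i _ => ?_)
  have := congrFun hy i
  rw [lower_apply, Pi.zero_apply] at this
  rw [← mul_zero (y i), ← this, mul_sum]
  exact sum_congr rfl fun _ _ => by ring

/-- The vectors proportional to the dual of `b`. -/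
def parallel (x : Coord n) : Submodule ℝ (Coord n) :=
  (Submodule.span ℝ {fun i => R.b i x}).comap (R.lower x)

/-- Lowering the index is injective, so this subspace has dimension at most one; this is where `n ≥
2` enters. -/
theorem parallel_ne_top (hn : 2 ≤ n) {x : Coord n} (hx : x ∈ R.dom) : R.parallel x ≠ ⊤ := by
  intro h
  have h1 : (R.lower x).range ≤ Submodule.span ℝ {fun i => R.b i x} := by
    rw [LinearMap.range_eq_map, Submodule.map_le_iff_le_comap, ← parallel, h]
  have h2 := Submodule.finrank_mono h1
  rw [LinearMap.finrank_range_of_inj (R.lower_injective hx)] at h2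
  have h3 := (finrank_span_le_card (R := ℝ) ({fun i => R.b i x} : Set (Fin n → ℝ)))
  simp at h2 h3
  omega

/-- If `I = 0` then `α² b_k = β a_{kj} y^j`. When `b ≠ 0` this forces `β ≠ 0`, so the lowered `y` is
a multiple of `b`. -/
theorem mem_parallel (p : R.slit) (hb : ∃ i, R.b i p.1.1 ≠ 0)
    (h : ∀ k, evalAt p (R.calculus.meanCartan k) = 0) : p.1.2 ∈ R.parallel p.1.1 := by
  have hq := quad_pos p.2.1 p.2.2
  have h1 : ∀ k, R.quad p.1.1 p.1.2 * R.b k p.1.1 =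
      (∑ i, R.b i p.1.1 * p.1.2 i) * R.lower p.1.1 p.1.2 k := fun k => by
    have := R.meanCartan_eq p k
    rw [h, mul_zero] at this
    have hn : (n : ℝ) + 1 ≠ 0 := by positivity
    have := (mul_eq_zero.mp this.symm).resolve_left hn
    rw [lower_apply]
    linarith
  have hβ : ∑ i, R.b i p.1.1 * p.1.2 i ≠ 0 := by
    intro h0
    obtain ⟨i, hi⟩ := hb
    have := h1 i
    rw [h0, zero_mul] at this
    exact mul_ne_zero hq.ne' hi this
  refine Submodule.mem_span_singleton.mpr
    ⟨R.quad p.1.1 p.1.2 / ∑ i, R.b i p.1.1 * p.1.2 i, ?_⟩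
  ext k
  rw [Pi.smul_apply, smul_eq_mul, div_mul_eq_mul_div, h1, mul_div_cancel_left₀ _ hβ]

theorem exists_notMem_parallel (hn : 2 ≤ n) {x : Coord n} (hx : x ∈ R.dom) {W : Set (Coord n)}
    (hW : IsOpen W) (hne : W.Nonempty) : ∃ y ∈ W, y ∉ R.parallel x := by
  by_contra! h
  refine R.parallel_ne_top hn hx (Submodule.eq_top_of_nonempty_interior' _ ?_)
  obtain ⟨y, hy⟩ := hne
  exact ⟨y, interior_maximal h hW hy⟩

end LocalRanders

end Finsler

end

/-! ### The interior of the zero set of `b` is relatively closed in a chart. -/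

noncomputable section

namespace Finsler

open Finset TopologicalSpace

theorem isOpen_ne_zero {n : ℕ} {Ω : Opens (Coord n × Coord n)} (f : smoothAlg Ω) :
    IsOpen {q : Coord n × Coord n | q ∈ Ω ∧ zeroExt Ω f q ≠ 0} :=
  (smoothAlg_contDiffOn f).continuousOn.isOpen_inter_preimage Ω.isOpen isOpen_compl_singleton

namespace LocalRanders

variable {n : ℕ} (R : LocalRanders n)

/-- The set where `b ≠ 0`. -/
def support : Set (Coord n) := {x | x ∈ R.dom ∧ ∃ i, R.b i x ≠ 0}

/-- The interior of the zero set of `b`. -/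
def zeroInterior : Set (Coord n) := interior {x | x ∈ R.dom ∧ ∀ i, R.b i x = 0}

/-- `F` is of scalar flag curvature `κ`, with `κ I = 0`. -/
def ScalarWithNullCartan : Prop := ∀ p : R.slit, ∃ κ : ℝ,
  (∀ i j, evalAt p (R.calculus.riemann i j) =
    κ * ((if i = j then evalAt p R.calculus.energy else 0) -
      evalAt p (R.calculus.y i) * evalAt p (R.calculus.yLow j))) ∧
  ∀ k, κ * evalAt p (R.calculus.meanCartan k) = 0

variable {R}

theorem isOpen_slice_ne_zero (f : smoothAlg R.slit) (x : Coord n) :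
    IsOpen {y : Coord n | (x, y) ∈ R.slit ∧ zeroExt R.slit f (x, y) ≠ 0} :=
  (isOpen_ne_zero f).preimage (Continuous.prodMk_right x)

theorem isOpen_slice_ne_zero' (f : smoothAlg R.slit) (y : Coord n) :
    IsOpen {x : Coord n | (x, y) ∈ R.slit ∧ zeroExt R.slit f (x, y) ≠ 0} :=
  (isOpen_ne_zero f).preimage (Continuous.prodMk_left y)

theorem zeroExt_eq_zero_of_closure {f : smoothAlg R.slit} {W : Set (Coord n)}
    (h : ∀ p : R.slit, p.1.1 ∈ W → evalAt p f = 0) (p : R.slit) (hp : p.1.1 ∈ closure W) :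
    evalAt p f = 0 := by
  by_contra hne
  obtain ⟨x, hx, hxW⟩ := mem_closure_iff.mp hp _ (isOpen_slice_ne_zero' f p.1.2)
    ⟨p.2, by rwa [evalAt_eq_zeroExt] at hne⟩
  refine hx.2 ?_
  have := h ⟨(x, p.1.2), hx.1⟩ hxW
  rwa [evalAt_eq_zeroExt] at this

/-- Over a point with `b ≠ 0`, `I` is nonzero in a dense set of directions, where `κ = 0`. The
curvature factor `κ` is not known to be continuous, so the density argument is applied to the smooth
components `R^i_k`, first in the fibre and then in the base. -/
theorem riemann_eq_zero (hn : 2 ≤ n) (h : R.ScalarWithNullCartan) (p : R.slit)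
    (hp : p.1.1 ∈ closure R.support) (i j : Fin n) : evalAt p (R.calculus.riemann i j) = 0 := by
  refine zeroExt_eq_zero_of_closure (fun p hp => ?_) p hp
  by_contra hne
  obtain ⟨y, hy, hyP⟩ := R.exists_notMem_parallel hn p.2.1
    (isOpen_slice_ne_zero (R.calculus.riemann i j) p.1.1)
    ⟨p.1.2, p.2, by rwa [evalAt_eq_zeroExt] at hne⟩
  obtain ⟨κ, hκ, hI⟩ := h ⟨(p.1.1, y), hy.1⟩
  obtain ⟨k, hk⟩ : ∃ k, evalAt ⟨(p.1.1, y), hy.1⟩ (R.calculus.meanCartan k) ≠ 0 := by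
    by_contra! hall
    exact hyP (R.mem_parallel ⟨(p.1.1, y), hy.1⟩ hp.2 hall)
  have hκ0 : κ = 0 := (mul_eq_zero.mp (hI k)).resolve_right hk
  have := hκ i j
  rw [hκ0, zero_mul, evalAt_eq_zeroExt] at this
  exact hy.2 this

/-- The vanishing set contains whole fibres, so fibre derivatives vanish even over boundary points
of the support. -/
theorem dy_riemann_eq_zero (hn : 2 ≤ n) (h : R.ScalarWithNullCartan) (p : R.slit)
    (hp : p.1.1 ∈ closure R.support) (i j k : Fin n) :
    evalAt p (R.calculus.dy i (R.calculus.riemann j k)) = 0 := by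
  have hr := R.isCalculusOf.riemann j k
  rw [← R.isCalculusOf.dY hr i p, dY]
  have : (fun y => riemann R.finsler j k p.1.1 y) =ᶠ[𝓝 p.1.2] fun _ => 0 := by
    filter_upwards [isOpen_compl_singleton.mem_nhds p.2.2] with y hy
    have := hr ⟨(p.1.1, y), p.2.1, hy⟩
    rw [this]
    exact riemann_eq_zero hn h ⟨(p.1.1, y), p.2.1, hy⟩ hp j k
  rw [this.fderiv_eq]
  simp

theorem meanCartanParallel (hn : 2 ≤ n) (h : R.ScalarWithNullCartan) (p : R.slit)
    (hp : p.1.1 ∈ closure R.support) : MeanCartanParallel R.calculus p :=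
  meanCartanParallel_of_riemann p fun i j k => dy_riemann_eq_zero hn h p hp i j k

theorem flow_eq_zero {f : smoothAlg R.slit}
    (h : ∀ p : R.slit, p.1.1 ∈ R.zeroInterior → evalAt p f = 0) (p : R.slit)
    (hp : p.1.1 ∈ R.zeroInterior) : evalAt p (R.calculus.flow f) = 0 := by
  rw [← fderiv_geodesicField rfl]
  have : zeroExt R.slit f =ᶠ[𝓝 (p : Coord n × Coord n)] fun _ => 0 := by
    have h1 : ∀ᶠ q : Coord n × Coord n in 𝓝 (p : Coord n × Coord n), q.1 ∈ R.zeroInterior :=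
      continuous_fst.continuousAt.eventually (isOpen_interior.mem_nhds hp)
    filter_upwards [R.slit.isOpen.mem_nhds p.2, h1] with q hq hq1
    have := h ⟨q, hq⟩ hq1
    rwa [evalAt_eq_zeroExt] at this
  rw [this.fderiv_eq]
  simp

theorem meanCartan_eq_zero_of_zeroInterior (p : R.slit) (hp : p.1.1 ∈ R.zeroInterior)
    (k : Fin n) : evalAt p (R.calculus.meanCartan k) = 0 :=
  R.meanCartan_eq_zero p (interior_subset hp).2 k

theorem mem_closure_support {x : Coord n} (hx : x ∈ R.dom) (h : x ∉ R.zeroInterior) :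
    x ∈ closure R.support := by
  rw [zeroInterior, ← Set.mem_compl_iff, ← closure_compl] at h
  rw [mem_closure_iff] at h ⊢
  intro W hW hxW
  obtain ⟨z, hz, hz'⟩ := h (W ∩ R.dom) (hW.inter R.dom.isOpen) ⟨hxW, hx⟩
  refine ⟨z, hz.1, hz.2, ?_⟩
  by_contra! hb
  exact hz' ⟨hz.2, hb⟩

/-- Along a geodesic which starts over the closure of the interior of the zero set of `b`, the
mean Cartan tensor vanishes. -/
theorem meanCartan_eq_zero_of_geodesic (hn : 2 ≤ n) (h : R.ScalarWithNullCartan)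
    {c : ℝ → Coord n × Coord n} {s₀ s₁ : ℝ} (hs : s₀ ≤ s₁)
    (hc : ∀ s ∈ Set.Icc s₀ s₁, HasDerivAt c (geodesicField R.calculus (c s)) s)
    (hΩ : ∀ s ∈ Set.Icc s₀ s₁, c s ∈ R.slit) (h0 : (c s₀).1 ∈ R.zeroInterior) (i : Fin n) :
    zeroExt R.slit (R.calculus.meanCartan i) (c s₁) = 0 := by
  have hcc : ContinuousOn (fun s => (c s).1) (Set.Icc s₀ s₁) := fun s hs' =>
    (continuous_fst.continuousAt.comp (hc s hs').continuousAt).continuousWithinAt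
  have hcl : IsClosed (Set.Icc s₀ s₁ ∩ (fun s => (c s).1) ⁻¹' closure R.zeroInterior) :=
    hcc.preimage_isClosed_of_isClosed isClosed_Icc isClosed_closure
  have hcomp := isCompact_Icc.of_isClosed_subset hcl Set.inter_subset_left
  -- The last time `t` at which the geodesic is over the closure of `V`; afterwards it stays over
  -- the closure of the support of `b`.
  obtain ⟨t, ⟨ht, htV⟩, hmax⟩ := hcomp.exists_isGreatest
    ⟨s₀, ⟨le_rfl, hs⟩, subset_closure h0⟩
  have z0 : ∀ p : R.slit, p.1.1 ∈ R.zeroInterior → ∀ i, evalAt p (R.calculus.meanCartan i) = 0 :=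
    fun p hp i => meanCartan_eq_zero_of_zeroInterior p hp i
  have z1 : ∀ p : R.slit, p.1.1 ∈ R.zeroInterior → ∀ i,
      evalAt p (R.calculus.flow (R.calculus.meanCartan i)) = 0 :=
    fun p hp i => flow_eq_zero (fun p hp => z0 p hp i) p hp
  have z2 : ∀ p : R.slit, p.1.1 ∈ R.zeroInterior → ∀ i,
      evalAt p (R.calculus.flow (R.calculus.flow (R.calculus.meanCartan i))) = 0 :=
    fun p hp i => flow_eq_zero (fun p hp => z1 p hp i) p hp
  have y0 : ∀ i, zeroExt R.slit (R.calculus.meanCartan i) (c t) = 0 := fun i => by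
    have := zeroExt_eq_zero_of_closure (fun p hp => z0 p hp i) ⟨c t, hΩ t ht⟩ htV
    rwa [evalAt_eq_zeroExt] at this
  have y1 : ∀ i, zeroExt R.slit (R.calculus.flow (R.calculus.meanCartan i)) (c t) = 0 := fun i => by
    have := zeroExt_eq_zero_of_closure (fun p hp => z1 p hp i) ⟨c t, hΩ t ht⟩ htV
    rwa [evalAt_eq_zeroExt] at this
  have y2 : ∀ i, zeroExt R.slit (R.calculus.flow (R.calculus.flow (R.calculus.meanCartan i)))
      (c t) = 0 := fun i => by
    have := zeroExt_eq_zero_of_closure (fun p hp => z2 p hp i) ⟨c t, hΩ t ht⟩ htV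
    rwa [evalAt_eq_zeroExt] at this
  have hsub : Set.Icc t s₁ ⊆ Set.Icc s₀ s₁ := Set.Icc_subset_Icc_left ht.1
  refine meanCartan_eq_zero_of_parallel (S := R.calculus) rfl ht.2 (fun s hs => hc s (hsub hs))
    (fun s hs => hΩ s (hsub hs)) (fun s hs => ?_) y0 y1 i
  -- At the initial time `t` the equation holds trivially, since `I` and its first two derivatives
  -- along the spray vanish over the closure of `V`.
  rcases hs.1.eq_or_lt with rfl | hlt
  · intro i
    rw [y2]
    simp only [y0, y1, mul_zero, sum_const_zero, add_zero]
  · refine meanCartanParallel hn h ⟨c s, hΩ s (hsub hs)⟩ (mem_closure_support (hΩ s (hsub hs)).1 ?_)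
    intro hV
    exact absurd (hmax ⟨hsub hs, subset_closure hV⟩) (not_le.mpr hlt)

/-- Otherwise a ball inside `V` touches the complement of `V` at a point `p` of the domain. The
geodesic through `p` with outward radial velocity comes from the ball, and so do all geodesics with
nearby data. By propagation `I` vanishes on a neighbourhood of this tangent vector, although near
`p` there are points with `b ≠ 0` and directions in which `I ≠ 0`. -/
theorem closure_zeroInterior (hn : 2 ≤ n) (h : R.ScalarWithNullCartan) {x : Coord n}
    (hx : x ∈ R.dom) (hxV : x ∈ closure R.zeroInterior) : x ∈ R.zeroInterior := by
  by_contra hxn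
  obtain ⟨ρ, hρ, hball⟩ := Metric.isOpen_iff.mp R.dom.isOpen x hx
  -- The radius `ρ / 2` keeps the point of the complement nearest to `x₀` within distance `ρ` of
  -- `x`, hence inside the domain.
  obtain ⟨x₀, hx₀V, hx₀⟩ := Metric.mem_closure_iff.mp hxV (ρ / 2) (half_pos hρ)
  have hVo : IsOpen R.zeroInterior := isOpen_interior
  obtain ⟨p, hpW, hpd⟩ := hVo.isClosed_compl.exists_infDist_eq_dist ⟨x, hxn⟩ x₀
  have hd1 : dist x₀ p ≤ dist x₀ x := hpd ▸ Metric.infDist_le_dist_of_mem hxn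
  have hp : p ∈ R.dom := hball (by
    rw [Metric.mem_ball]
    have := dist_triangle p x₀ x
    rw [dist_comm p x₀] at this
    rw [dist_comm x₀ x] at hd1
    rw [dist_comm x₀ x] at this
    linarith)
  have hbV : Metric.ball x₀ (dist x₀ p) ⊆ R.zeroInterior := fun z hz => by
    by_contra hzn
    have := Metric.infDist_le_dist_of_mem (x := x₀) (show z ∈ R.zeroInteriorᶜ from hzn)
    rw [hpd] at this
    rw [Metric.mem_ball, dist_comm] at hz
    exact absurd this (not_le.mpr hz)
  have hv : p - x₀ ≠ 0 := fun h0 => hpW (by rw [sub_eq_zero.mp h0]; exact hx₀V)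
  -- The velocity `p - x₀` is normal to the sphere about `x₀` through `p`, so the crossing is
  -- transversal: the squared distance to `x₀` has derivative `2‖p - x₀‖² > 0` at time zero.
  set P : R.slit := ⟨(p, p - x₀), hp, hv⟩ with hP
  obtain ⟨r, hr, ε, hε, Φ, hΦ, hΦc⟩ := exists_geodesicFlow R.calculus P
  have hPr : (P : Coord n × Coord n) ∈ Metric.closedBall (P : Coord n × Coord n) r :=
    Metric.mem_closedBall_self hr.le
  have hΦP := hΦ P hPr
  have h00 : (0 : ℝ) ∈ Set.Ioo (-ε) ε := ⟨by linarith, hε⟩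
  have hdom : Metric.closedBall (P : Coord n × Coord n) r ×ˢ Set.Ioo (-ε) ε ∈ 
      𝓝 ((P : Coord n × Coord n), (0 : ℝ)) :=
    prod_mem_nhds (Metric.closedBall_mem_nhds _ hr) (Ioo_mem_nhds h00.1 h00.2)
  -- The flow stays in the slit tangent bundle for a short time.
  have hslit : ∀ᶠ z in 𝓝 ((P : Coord n × Coord n), (0 : ℝ)), Φ z ∈ R.slit := by
    refine (hΦc.continuousAt hdom).eventually (R.slit.isOpen.mem_nhds ?_)
    rw [hΦP.1]; exact P.2
  rw [nhds_prod_eq, Filter.eventually_prod_iff] at hslit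
  obtain ⟨A, hA, B, hB, hAB⟩ := hslit
  obtain ⟨δ, hδ, hδB⟩ := Metric.eventually_nhds_iff.mp hB
  -- The geodesic from `P` enters the ball around `x₀` in negative time.
  have hsq : HasDerivAt (fun s => ‖(Φ (P, s)).1 - x₀‖ ^ 2) (2 * ‖p - x₀‖ ^ 2) 0 := by
    have h1 := (hΦP.2 0 h00)
    have h2 : HasDerivAt (fun s => (Φ (P, s)).1) (p - x₀) 0 := by
      have := (hasFDerivAt_fst (𝕜 := ℝ) (p := Φ (P, 0))).comp_hasDerivAt 0 h1
      rw [hΦP.1] at this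
      exact this
    have h3 := (h2.sub_const x₀).norm_sq
    rw [hΦP.1] at h3
    change HasDerivAt _ (2 * inner ℝ (p - x₀) (p - x₀)) 0 at h3
    rwa [real_inner_self_eq_norm_sq] at h3
  have hneg : ∀ᶠ s in 𝓝[<] (0 : ℝ), ‖(Φ (P, s)).1 - x₀‖ ^ 2 < ‖p - x₀‖ ^ 2 := by
    have hpos : 0 < 2 * ‖p - x₀‖ ^ 2 := by positivity
    have := (hasDerivAt_iff_tendsto_slope.mp hsq).eventually (lt_mem_nhds hpos)
    have h1 := nhdsWithin_mono (0 : ℝ) (show Set.Iio (0 : ℝ) ⊆ {0}ᶜ from fun s hs => ne_of_lt hs) this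
    filter_upwards [h1, self_mem_nhdsWithin] with s hs hs0
    have hs' : 0 < slope (fun s => ‖(Φ (P, s)).1 - x₀‖ ^ 2) 0 s := hs
    rw [slope_def_field, div_pos_iff] at hs'
    have hs0' : s < 0 := hs0
    rcases hs' with h | h
    · linarith [h.2]
    · have := h.1
      rw [hΦP.1] at this
      have e : (P : Coord n × Coord n).1 = p := rfl
      rw [e] at this
      linarith
  have hsmall : ∀ᶠ s in 𝓝[<] (0 : ℝ), s ∈ Set.Ioo (-min ε δ) 0 :=
    Ioo_mem_nhdsLT (by simp [hε, hδ])
  -- One fixed negative time serves all nearby data: by continuity of the flow their geodesics are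
  -- also over `V` at time `s`, and they remain in the slit bundle up to time zero.
  obtain ⟨s, hs1, hs2⟩ := (hneg.and hsmall).exists
  have hsε : s ∈ Set.Ioo (-ε) ε :=
    ⟨by linarith [hs2.1, min_le_left ε δ], by linarith [hs2.2]⟩
  have hsV : ∀ᶠ q in 𝓝 (P : Coord n × Coord n), (Φ (q, s)).1 ∈ R.zeroInterior := by
    have hc : ContinuousAt (fun q => (Φ (q, s)).1) (P : Coord n × Coord n) := by
      have hc1 : ContinuousAt Φ ((P : Coord n × Coord n), s) := hΦc.continuousAt
        (prod_mem_nhds (Metric.closedBall_mem_nhds _ hr) (Ioo_mem_nhds hsε.1 hsε.2))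
      have hc2 : ContinuousAt (fun q : Coord n × Coord n => (q, s)) (P : Coord n × Coord n) :=
        (Continuous.prodMk_left s).continuousAt
      exact continuous_fst.continuousAt.comp
        (ContinuousAt.comp (f := fun q : Coord n × Coord n => (q, s)) (g := Φ) hc1 hc2)
    refine hc.eventually (hVo.mem_nhds (hbV ?_))
    rw [Metric.mem_ball, dist_eq_norm, dist_comm, dist_eq_norm]
    exact lt_of_pow_lt_pow_left₀ 2 (norm_nonneg _) hs1
  -- A nearby geodesic ending over the support of `b` in a direction not dual to `b`.
  have hnear := hA.and (hsV.and (Metric.closedBall_mem_nhds (P : Coord n × Coord n) hr))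
  obtain ⟨η, hη, hηb⟩ := Metric.eventually_nhds_iff_ball.mp hnear
  obtain ⟨q, hqU, hq⟩ := Metric.mem_closure_iff.mp (mem_closure_support hp hpW) η hη
  obtain ⟨w, hw, hwP⟩ := R.exists_notMem_parallel hn hqU.1 (Metric.isOpen_ball (x := p - x₀) (ε := η))
    ⟨p - x₀, Metric.mem_ball_self hη⟩
  have hw0 : w ≠ 0 := fun h0 => hwP (h0 ▸ Submodule.zero_mem _)
  have hqw : (q, w) ∈ Metric.ball (P : Coord n × Coord n) η := by
    rw [Metric.mem_ball, Prod.dist_eq, max_lt_iff]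
    exact ⟨by rw [dist_comm]; exact hq, hw⟩
  obtain ⟨hA', hV', hr'⟩ := hηb _ hqw
  have hΦq := hΦ _ hr'
  have hI : ∀ i, zeroExt R.slit (R.calculus.meanCartan i) (q, w) = 0 := by
    intro i
    have := meanCartan_eq_zero_of_geodesic hn h (c := fun t => Φ ((q, w), t)) hs2.2.le
      (fun t ht => hΦq.2 t ⟨by linarith [hsε.1, ht.1], by linarith [ht.2]⟩)
      (fun t ht => hAB hA' (hδB (by
        rw [Real.dist_eq, sub_zero, _root_.abs_lt]
        exact ⟨by linarith [hs2.1, ht.1, min_le_right ε δ], by linarith [ht.2]⟩))) hV' i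
    rwa [hΦq.1] at this
  refine hwP (R.mem_parallel ⟨(q, w), hqU.1, hw0⟩ hqU.2 fun k => ?_)
  rw [evalAt_eq_zeroExt]
  exact hI k

end LocalRanders

end Finsler

end

/-! ### Coordinate expressions of a Randers metric. -/

noncomputable section

namespace Finsler

open Finset TopologicalSpace IsManifold

variable {n : ℕ} {M : Type*} [TopologicalSpace M] [ChartedSpace (Coord n) M]

/-! ### Randers metrics in a chart -/

section Chart

variable {φ : OpenPartialHomeomorph M (Coord n)} (hφ : φ ∈ maximalAtlas (𝓡 n) ∞ M)

/-- The coordinate vector field `∂/∂xⁱ`, along the inverse of the chart. -/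
def coordVec (φ : OpenPartialHomeomorph M (Coord n)) (i : Fin n) (x : Coord n) :
    TangentSpace (𝓡 n) (φ.symm x) :=
  mfderiv 𝓘(ℝ, Coord n) (𝓡 n) φ.symm x (EuclideanSpace.single i (1 : ℝ) : Coord n)

theorem mfderiv_symm_eq (x y : Coord n) :
    mfderiv 𝓘(ℝ, Coord n) (𝓡 n) φ.symm x y = ∑ i, y i • coordVec φ i x := by
  conv_lhs => rw [coord_eq_sum y]
  simp only [coordVec]
  exact (map_sum (mfderiv 𝓘(ℝ, Coord n) (𝓡 n) φ.symm x) _ _).trans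
    (sum_congr rfl fun i _ => map_smul _ _ _)

include hφ

theorem chart_mdifferentiable : φ.MDifferentiable (𝓡 n) (𝓡 n) :=
  ⟨(contMDiffOn_of_mem_maximalAtlas hφ).mdifferentiableOn (by simp),
    (contMDiffOn_symm_of_mem_maximalAtlas hφ).mdifferentiableOn (by simp)⟩

theorem contMDiffOn_coordVec [IsManifold (𝓡 n) ∞ M] (i : Fin n) : ContMDiffOn 𝓘(ℝ, Coord n) (𝓡 n).tangent ∞
    (fun x => (⟨φ.symm x, coordVec φ i x⟩ : TangentBundle (𝓡 n) M)) φ.target := by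
  have h1 := (contMDiffOn_symm_of_mem_maximalAtlas hφ).contMDiffOn_tangentMapWithin (m := ∞)
    (by simp) φ.open_target.uniqueMDiffOn
  have h2 : ContMDiff 𝓘(ℝ, Coord n) (𝓡 n).tangent ∞
      (fun x : Coord n => (⟨x, (EuclideanSpace.single i (1 : ℝ) : Coord n)⟩ :
        TangentBundle 𝓘(ℝ, Coord n) (Coord n))) :=
    contMDiff_vectorSpace_iff_contDiff.mpr contDiff_const
  have h3 := h1.comp (h2.contMDiffOn (s := φ.target)) (fun x hx => hx)
  refine h3.congr fun x hx => ?_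
  simp only [Function.comp, tangentMapWithin, coordVec]
  rw [mfderivWithin_of_isOpen φ.open_target hx]

theorem mfderiv_symm_injective {x : Coord n} (hx : x ∈ φ.target) :
    Function.Injective (mfderiv 𝓘(ℝ, Coord n) (𝓡 n) φ.symm x) :=
  (chart_mdifferentiable hφ).symm.mfderiv_injective hx

theorem mfderiv_symm_surjective {x : Coord n} (hx : x ∈ φ.target) :
    Function.Surjective (mfderiv 𝓘(ℝ, Coord n) (𝓡 n) φ.symm x) :=
  (chart_mdifferentiable hφ).symm.mfderiv_surjective hx

end Chart

namespace RandersMetric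

variable [IsManifold (𝓡 n) ∞ M] (R : RandersMetric n M) {φ : OpenPartialHomeomorph M (Coord n)}
  (hφ : φ ∈ maximalAtlas (𝓡 n) ∞ M)

theorem b_mfderiv (φ : OpenPartialHomeomorph M (Coord n)) (x y : Coord n) :
    R.b (φ.symm x) (mfderiv 𝓘(ℝ, Coord n) (𝓡 n) φ.symm x y) =
      ∑ i, R.b (φ.symm x) (coordVec φ i x) * y i := by
  rw [mfderiv_symm_eq, map_sum]
  exact sum_congr rfl fun i _ => by rw [map_smul, smul_eq_mul, mul_comm]

theorem a_mfderiv (φ : OpenPartialHomeomorph M (Coord n)) (x y : Coord n) :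
    R.a.inner (φ.symm x) (mfderiv 𝓘(ℝ, Coord n) (𝓡 n) φ.symm x y)
        (mfderiv 𝓘(ℝ, Coord n) (𝓡 n) φ.symm x y) =
      ∑ i, ∑ j, R.a.inner (φ.symm x) (coordVec φ i x) (coordVec φ j x) * (y i * y j) := by
  have h : ∀ w, R.a.inner (φ.symm x) (∑ i, y i • coordVec φ i x) w =
      ∑ i, y i * R.a.inner (φ.symm x) (coordVec φ i x) w := fun w => by
    rw [map_sum, _root_.sum_apply]
    exact sum_congr rfl fun i _ => by rw [map_smul, _root_.smul_apply, smul_eq_mul]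
  rw [mfderiv_symm_eq, h]
  refine sum_congr rfl fun i _ => ?_
  rw [map_sum, mul_sum]
  refine sum_congr rfl fun j _ => ?_
  rw [map_smul, smul_eq_mul]; ring

/-- The coordinate expression of a Randers metric. -/
def toLocal : LocalRanders n where
  dom := ⟨φ.target, φ.open_target⟩
  a i j x := R.a.inner (φ.symm x) (coordVec φ i x) (coordVec φ j x)
  b i x := R.b (φ.symm x) (coordVec φ i x)
  contDiffOn_a i j := by
    rw [← contMDiffOn_iff_contDiffOn]
    intro x hx
    have hsymm := contMDiffOn_symm_of_mem_maximalAtlas hφ x hx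
    -- The component is viewed as a section of the trivial line bundle, so that smoothness of bundle
    -- evaluation applies.
    have : ContMDiffWithinAt 𝓘(ℝ, Coord n) ((𝓡 n).prod 𝓘(ℝ)) ∞
        (fun x => Bundle.TotalSpace.mk' ℝ (E := Bundle.Trivial M ℝ) (φ.symm x)
          (R.a.inner (φ.symm x) (coordVec φ i x) (coordVec φ j x))) φ.target x := by
      apply ContMDiffWithinAt.clm_bundle_apply₂ (F₁ := Coord n) (F₂ := Coord n)
      · exact ContMDiffAt.comp_contMDiffWithinAt x R.a.contMDiff.contMDiffAt hsymm
      · exact contMDiffOn_coordVec hφ i x hx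
      · exact contMDiffOn_coordVec hφ j x hx
    simp only [Bundle.contMDiffWithinAt_totalSpace] at this
    exact this.2
  contDiffOn_b i := by
    rw [← contMDiffOn_iff_contDiffOn]
    intro x hx
    have hsymm := contMDiffOn_symm_of_mem_maximalAtlas hφ x hx
    have : ContMDiffWithinAt 𝓘(ℝ, Coord n) ((𝓡 n).prod 𝓘(ℝ)) ∞
        (fun x => Bundle.TotalSpace.mk' ℝ (E := Bundle.Trivial M ℝ) (φ.symm x)
          (R.b (φ.symm x) (coordVec φ i x))) φ.target x := by
      apply ContMDiffWithinAt.clm_bundle_apply (F₁ := Coord n)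
      · exact ContMDiffAt.comp_contMDiffWithinAt x R.contMDiff_b.contMDiffAt hsymm
      · exact contMDiffOn_coordVec hφ i x hx
    simp only [Bundle.contMDiffWithinAt_totalSpace] at this
    exact this.2
  a_symm i j x _ := R.a.symm _ _ _
  abs_lt x hx y hy := by
    have h := R.norm_b_lt_one (φ.symm x) (mfderiv 𝓘(ℝ, Coord n) (𝓡 n) φ.symm x y) (by
      intro h0
      exact hy (mfderiv_symm_injective hφ hx (h0.trans (map_zero _).symm)))
    rwa [b_mfderiv, a_mfderiv] at h

theorem localRep_finsler : localRep R.finsler φ = (R.toLocal hφ).finsler := by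
  funext x y
  exact congrArg₂ (fun q l : ℝ => √q + l) (R.a_mfderiv φ x y) (R.b_mfderiv φ x y)

theorem toLocal_b_eq_zero_iff {x : Coord n} (hx : x ∈ φ.target) :
    (∀ i, (R.toLocal hφ).b i x = 0) ↔ R.b (φ.symm x) = 0 := by
  constructor
  · intro h
    ext v
    obtain ⟨y, rfl⟩ := mfderiv_symm_surjective hφ hx v
    refine (R.b_mfderiv φ x y).trans (sum_eq_zero fun i _ => ?_)
    rw [show R.b (φ.symm x) (coordVec φ i x) = 0 from h i, zero_mul]
  · intro h i
    change R.b (φ.symm x) (coordVec φ i x) = 0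
    rw [h]; rfl

end RandersMetric

end Finsler

end

/-! ### Globalisation by connectedness. -/

noncomputable section

namespace Finsler

open TopologicalSpace IsManifold

variable {n : ℕ} {M : Type*} [TopologicalSpace M] [ChartedSpace (Coord n) M]
  [IsManifold (𝓡 n) ∞ M]

theorem exists_tangentOfCoord (v : TangentBundle (𝓡 n) M) :
    ∃ φ ∈ maximalAtlas (𝓡 n) ∞ M, ∃ x ∈ φ.target, ∃ y, tangentOfCoord φ x y = v := by
  obtain ⟨p, v⟩ := v
  obtain ⟨φ, hφ, hp⟩ : ∃ φ ∈ maximalAtlas (𝓡 n) ∞ M, p ∈ φ.source :=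
    ⟨chartAt (Coord n) p, chart_mem_maximalAtlas p, mem_chart_source _ p⟩
  obtain ⟨x, hx, rfl⟩ : ∃ x ∈ φ.target, φ.symm x = p :=
    ⟨φ p, φ.map_source hp, φ.left_inv hp⟩
  obtain ⟨y, hy⟩ := mfderiv_symm_surjective hφ hx v
  exact ⟨φ, hφ, x, hx, y, congrArg (Bundle.TotalSpace.mk (φ.symm x)) hy⟩

namespace RandersMetric

variable (R : RandersMetric n M) {φ : OpenPartialHomeomorph M (Coord n)}
  (hφ : φ ∈ maximalAtlas (𝓡 n) ∞ M) {K : TangentBundle (𝓡 n) M → ℝ}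

theorem riemann_of_isOfScalarFlagCurvature (hK : IsOfScalarFlagCurvature R.finsler K)
    (p : (R.toLocal hφ).slit) (i j : Fin n) :
    evalAt p ((R.toLocal hφ).calculus.riemann i j) = K (tangentOfCoord φ p.1.1 p.1.2) *
      ((if i = j then evalAt p (R.toLocal hφ).calculus.energy else 0) -
        evalAt p ((R.toLocal hφ).calculus.y i) * evalAt p ((R.toLocal hφ).calculus.yLow j)) := by
  refine (R.toLocal hφ).riemann_of_flagCurvature p _ (fun u hu => ?_) i j
  rw [← R.localRep_finsler hφ]
  exact hK φ hφ p.1.1 p.2.1 p.1.2 u hu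

theorem frakR_sub (hK : IsOfScalarFlagCurvature R.finsler K) (p : (R.toLocal hφ).slit)
    (i : Fin n) : frakRRightZero (localRep R.finsler φ) i p.1.1 p.1.2 -
      frakRLeftZero (localRep R.finsler φ) i p.1.1 p.1.2 =
      - (K (tangentOfCoord φ p.1.1 p.1.2) * evalAt p (R.toLocal hφ).calculus.energy *
        evalAt p ((R.toLocal hφ).calculus.meanCartan i)) := by
  rw [R.localRep_finsler hφ]
  exact (R.toLocal hφ).frakR_sub p _ (R.riemann_of_isOfScalarFlagCurvature hφ hK p) i

theorem frakRZeroSymmetric_of_eq_zero (hK : IsOfScalarFlagCurvature R.finsler K)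
    (h : ∀ (p : M) (v : TangentSpace (𝓡 n) p), v ≠ 0 → K ⟨p, v⟩ = 0) :
    FrakRZeroSymmetric R.finsler := by
  intro φ hφ x hx y hy i
  have hv : mfderiv 𝓘(ℝ, Coord n) (𝓡 n) φ.symm x y ≠ 0 := fun h0 =>
    hy (mfderiv_symm_injective hφ hx (h0.trans (map_zero _).symm))
  have := R.frakR_sub hφ hK ⟨(x, y), hx, hy⟩ i
  rw [tangentOfCoord, h _ _ hv, zero_mul, zero_mul, neg_zero] at this
  exact sub_eq_zero.mp this

theorem scalarWithNullCartan (hK : IsOfScalarFlagCurvature R.finsler K)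
    (h : FrakRZeroSymmetric R.finsler) : (R.toLocal hφ).ScalarWithNullCartan := by
  intro p
  refine ⟨_, R.riemann_of_isOfScalarFlagCurvature hφ hK p, fun k => ?_⟩
  have h1 := R.frakR_sub hφ hK p k
  rw [sub_eq_zero.mpr (h φ hφ p.1.1 p.2.1 p.1.2 p.2.2 k), zero_eq_neg, mul_right_comm] at h1
  exact (mul_eq_zero.mp h1).resolve_right ((R.toLocal hφ).evalAt_energy_pos p).ne'

theorem target_inter_zeroInterior :
    φ.target ∩ φ.symm ⁻¹' interior {p | R.b p = 0} = (R.toLocal hφ).zeroInterior := by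
  have e : {x | x ∈ (R.toLocal hφ).dom ∧ ∀ i, (R.toLocal hφ).b i x = 0} =
      φ.target ∩ φ.symm ⁻¹' {p | R.b p = 0} := by
    ext x
    exact and_congr_right fun hx => R.toLocal_b_eq_zero_iff hφ hx
  rw [LocalRanders.zeroInterior, e, interior_inter, φ.open_target.interior_eq]
  exact φ.symm.preimage_interior _

/-- Closedness is local: around a point of the closure it is read off in the preferred chart from
`closure_zeroInterior`. -/
theorem isClosed_interior_zero (hn : 2 ≤ n) (hK : IsOfScalarFlagCurvature R.finsler K)
    (h : FrakRZeroSymmetric R.finsler) : IsClosed (interior {p | R.b p = 0}) := by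
  refine isClosed_of_closure_subset fun p hp => ?_
  set φ := chartAt (Coord n) p
  have hφ : φ ∈ maximalAtlas (𝓡 n) ∞ M := chart_mem_maximalAtlas p
  have hps : p ∈ φ.source := mem_chart_source _ p
  have hx : φ p ∈ φ.target := φ.map_source hps
  have h1 : φ p ∈ φ.target ∩ φ.symm ⁻¹' closure (interior {p | R.b p = 0}) :=
    ⟨hx, by rwa [Set.mem_preimage, φ.left_inv hps]⟩
  have h2 : φ p ∈ φ.target ∩ closure (φ.symm ⁻¹' interior {p | R.b p = 0}) :=
    (φ.symm.preimage_closure _).le h1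
  have h3 := φ.open_target.inter_closure h2
  rw [R.target_inter_zeroInterior hφ] at h3
  have h4 := LocalRanders.closure_zeroInterior hn (R.scalarWithNullCartan hφ hK h) hx h3
  rw [← R.target_inter_zeroInterior hφ] at h4
  have h5 := h4.2
  rwa [Set.mem_preimage, φ.left_inv hps] at h5

theorem eq_zero_of_frakRZeroSymmetric [ConnectedSpace M] (hn : 2 ≤ n)
    (hR : ¬ IsRiemannian R.finsler) (hK : IsOfScalarFlagCurvature R.finsler K)
    (h : FrakRZeroSymmetric R.finsler) (p : M) (v : TangentSpace (𝓡 n) p) (hv : v ≠ 0) :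
    K ⟨p, v⟩ = 0 := by
  have hempty : interior {p | R.b p = 0} = ∅ := by
    -- If the clopen set is all of `M`, then `b = 0` and `F` is the norm of `a`, contrary to the
    -- assumption.
    rcases isClopen_iff.mp ⟨R.isClosed_interior_zero hn hK h, isOpen_interior⟩ with h0 | h0
    · exact h0
    · refine absurd ⟨R.a, fun p v => ?_⟩ hR
      have hp : p ∈ interior {p | R.b p = 0} := by rw [h0]; exact Set.mem_univ p
      have hb : p ∈ {p | R.b p = 0} := interior_subset hp
      rw [Set.mem_ofPred_eq] at hb
      simp [finsler, hb]
  obtain ⟨φ, hφ, x, hx, y, hy⟩ := exists_tangentOfCoord (⟨p, v⟩ : TangentBundle (𝓡 n) M)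
  have hy0 : y ≠ 0 := by
    rintro rfl
    have h0 : tangentOfCoord φ x 0 = ⟨φ.symm x, 0⟩ :=
      congrArg (Bundle.TotalSpace.mk (φ.symm x))
        (map_zero (mfderiv 𝓘(ℝ, Coord n) (𝓡 n) φ.symm x))
    rw [h0] at hy
    cases hy
    exact hv rfl
  have hz : (R.toLocal hφ).zeroInterior = ∅ := by
    rw [← R.target_inter_zeroInterior hφ, hempty, Set.preimage_empty, Set.inter_empty]
  have hr := LocalRanders.riemann_eq_zero hn (R.scalarWithNullCartan hφ hK h) ⟨(x, y), hx, hy0⟩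
    (LocalRanders.mem_closure_support hx (by rw [hz]; exact Set.notMem_empty x))
  -- `K` is determined only through flags, so a second direction is needed to turn `R = 0` into `K =
  -- 0`; it exists because `n ≥ 2`.
  obtain ⟨u, hu⟩ := exists_linearIndependent_pair_of_one_lt_finrank (R := ℝ) (M := Coord n)
    (by rw [finrank_euclideanSpace_fin]; omega) hy0
  rw [← hy, ← hK φ hφ x hx y u hu, R.localRep_finsler hφ]
  exact (R.toLocal hφ).flagCurvature_eq_zero ⟨(x, y), hx, hy0⟩ hr u

end RandersMetric

end Finsler

end

theorem mainTheorem5 (n : ℕ) (hn : 2 ≤ n) (M : Type*) [TopologicalSpace M]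
    [ChartedSpace (Finsler.Coord n) M] [IsManifold (𝓡 n) ∞ M] [ConnectedSpace M]
    (R : Finsler.RandersMetric n M) (hR : ¬ Finsler.IsRiemannian R.finsler)
    (K : TangentBundle (𝓡 n) M → ℝ) (hK : Finsler.IsOfScalarFlagCurvature R.finsler K) :
    (∀ (p : M) (v : TangentSpace (𝓡 n) p), v ≠ 0 → K ⟨p, v⟩ = 0) ↔
      Finsler.FrakRZeroSymmetric R.finsler :=
  ⟨R.frakRZeroSymmetric_of_eq_zero hK, R.eq_zero_of_frakRZeroSymmetric hn hR hK⟩
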